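/- Let $k$ be a field; algebras are associative and unital over $k$, $\otimes=\otimes_k$, and $Z(D)$ is the centre of $D$. **The bicategories $T(A,B)$.** Let $A,B$ be commutative algebras. The following data form a bicategory $T(A,B)$. Objects: algebras $D$ with an algebra homomorphism $\alpha\colon A\otimes B\to Z(D)$. 1-cells $(D,\alpha)\to(E,\beta)$: $D$–$E$ bimodules on which the actions of $A\otimes B$ induced by $\alpha$ and $\beta$ agree. 2-cells: bimodule homomorphisms. The composite of $M\colon D\to E$ and $N\colon E\to F$ is $M\otimes_E N$, with $\varphi\otimes_E\psi$ on 2-cells; the identity of $D$ is the bimodule $D$. The associativity constraint is $(m\otimes n)\otimes p\mapsto m\otimes(n\otimes p)$ and the inverse unit constraints are $m\mapsto 1\otimes m$ and $m\mapsto m\otimes 1$. **Composition.** For commutative algebras $A,B,C$ the following data form a pseudofunctor $\otimes_B\colon T(A,B)\times T(B,C)\to T(A,C)$. It sends $((D,\alpha),(E,\beta))$ to the algebra $D\otimes_B E$ with $a\otimes c\mapsto\alpha(a\otimes1)\otimes\beta(1\otimes c)$, 1-cells $(M,N)$ to $M\otimes_B N$, and 2-cells $(\varphi,\psi)$ to $\varphi\otimes_B\psi$.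 Its unit constraint is the identity of $D\otimes_B E$, and its composition constraint is $(M\otimes_B N)\otimes_{D'\otimes_B E'}(M'\otimes_B N')\to(M\otimes_{D'}M')\otimes_B(N\otimes_{E'}N')$, $(m\otimes n)\otimes(m'\otimes n')\mapsto(m\otimes m')\otimes(n\otimes n')$. **The tricategory.** There is a tricategory $\mathsf{ComAlgebra}$ (in the sense of Gurski, with 1-cells composed in diagrammatic order) whose objects are the commutative algebras, whose hom bicategories are the $T(A,B)$, whose composition functors are the $\otimes_B$, and whose unit at $A$ is $A$ with the multiplication map $\mu\colon A\otimes A\to A$ (as a constant pseudofunctor from the unit bicategory), with the following canonical coherence data. *Associator and unitors.* They are adjoint equivalences of pseudofunctors $a,l,r$ with adjoint inverses $a^\bullet,l^\bullet,r^\bullet$. Their components are: $a_{D,E,F}=(D\otimes E)\otimes F$, as a bimodule from $(D\otimes E)\otimes F$ to $D\otimes(E\otimes F)$; $a^\bullet_{D,E,F}=D\otimes(E\otimes F)$, as a bimodule from $D\otimes(E\otimes F)$ to $(D\otimes E)\otimes F$; and $l_D=l_D^\bullet=r_D=r_D^\bullet=D$, as bimodules between $D$ and $A\otimes_A D$, respectively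 $D\otimes_B B$, for $D\in T(A,B)$. Here tensor products of algebras are over the intermediate commutative algebras, and algebras act through the canonical isomorphisms $(D\otimes E)\otimes F\cong D\otimes(E\otimes F)$, $A\otimes_A D\cong D$, $D\otimes_B B\cong D$. *Notation.* Write $u$ for the element $1$ of each of these bimodules. All the remaining data are isomorphisms of bimodules, and they are determined by the formulas below. *Naturality constraints*, for 1-cells $M,N,P$ with primed targets: - $((m\otimes n)\otimes p)\otimes u\mapsto u\otimes(m\otimes(n\otimes p))$ for $a$, and $(m\otimes(n\otimes p))\otimes u\mapsto u\otimes((m\otimes n)\otimes p)$ for $a^\bullet$; - $(1\otimes m)\otimes u\mapsto u\otimes m$ for $l$, and $m\otimes u\mapsto u\otimes(1\otimes m)$ for $l^\bullet$; - $(m\otimes1)\otimes u\mapsto u\otimes m$ for $r$, and $m\otimes u\mapsto u\otimes(m\otimes1)$ for $r^\bullet$. *Units and counits* of the three adjoint equivalences: $1\mapsto u\otimes u$ and $u\otimes u\mapsto1$. *Invertible modifications*: - $\pi_{D,E,F,G}\colon (a_{D,E,F}\otimes 1_G)\cdot\bigl(a_{D,E\otimes F,G}\cdot(1_D\otimes a_{E,F,G})\bigr)\Rightarrow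 a_{D\otimes E,F,G}\cdot a_{D,E,F\otimes G}$, $(u\otimes1)\otimes(u\otimes(1\otimes u))\mapsto u\otimes u$; - $\mu_{D,E}\colon (r^\bullet_D\otimes1_E)\cdot\bigl(a_{D,B,E}\cdot(1_D\otimes l_E)\bigr)\Rightarrow 1_{D\otimes E}$, $(u\otimes1)\otimes(u\otimes(1\otimes u))\mapsto1$; - $\lambda_{D,E}\colon l_D\otimes1_E\Rightarrow a_{A,D,E}\cdot l_{D\otimes E}$, $u\otimes1\mapsto u\otimes u$; - $\rho_{D,E}\colon 1_D\otimes r^\bullet_E\Rightarrow r^\bullet_{D\otimes E}\cdot a_{D,E,C}$, $1\otimes u\mapsto u\otimes u$. Here $D\in T(A,B)$, $E\in T(B,C)$ in the last three items, and $\cdot$ is composition in the hom bicategories, in diagrammatic order. That these data form a tricategory means that $a,l,r$ and their inverses are pseudonatural, their units and counits are invertible modifications satisfying the triangle identities, $\pi,\mu,\lambda,\rho$ are modifications, and the nonabelian 4-cocycle condition and the left and right normalization conditions hold. -/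

import Mathlib

open CategoryTheory Bicategory TensorProduct MulOpposite

universe u v w

/-! ### Balanced tensor products -/

section BTensor

variable {k : Type u} [Field k] {S : Type w} {M N P M' N' : Type v}
  [AddCommGroup M] [Module k M] [AddCommGroup N] [Module k N] [AddCommGroup P] [Module k P]
  [AddCommGroup M'] [Module k M'] [AddCommGroup N'] [Module k N']

/-- For a set `S` acting `k`-linearly on `M` (through `r`, thought of as a right action) and on `N`
(through `l`, thought of as a left action), the subspace of `M ⊗[k] N` spanned by the elements
`(m · s) ⊗ n - m ⊗ (s · n)`. -/
def balancedRel (r : S → Module.End k M) (l : S → Module.End k N) : Submodule k (M ⊗[k] N) :=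
  Submodule.span k {t | ∃ (s : S) (m : M) (n : N), t = r s m ⊗ₜ[k] n - m ⊗ₜ[k] l s n}

/-- The balanced tensor product `M ⊗_S N`.  When `S` is a `k`-algebra, `M` a right `S`-module and
`N` a left `S`-module, this is the usual tensor product over the (not necessarily commutative)
ring `S`. -/
def BTensor (r : S → Module.End k M) (l : S → Module.End k N) : Type v :=
  (M ⊗[k] N) ⧸ balancedRel r l

namespace BTensor

instance (r : S → Module.End k M) (l : S → Module.End k N) : AddCommGroup (BTensor r l) :=
  inferInstanceAs (AddCommGroup ((M ⊗[k] N) ⧸ balancedRel r l))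

instance (r : S → Module.End k M) (l : S → Module.End k N) : Module k (BTensor r l) :=
  inferInstanceAs (Module k ((M ⊗[k] N) ⧸ balancedRel r l))

variable (r : S → Module.End k M) (l : S → Module.End k N)

/-- The quotient map. -/
def proj : M ⊗[k] N →ₗ[k] BTensor r l := (balancedRel r l).mkQ

/-- The universal balanced bilinear map `(m, n) ↦ m ⊗ n`. -/
def mk : M →ₗ[k] N →ₗ[k] BTensor r l := (TensorProduct.mk k M N).compr₂ (proj r l)

lemma proj_surjective : Function.Surjective (proj r l) := Submodule.mkQ_surjective _

lemma proj_tmul (m : M) (n : N) : proj r l (m ⊗ₜ n) = mk r l m n := rfl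

lemma mk_bal (s : S) (m : M) (n : N) : mk r l (r s m) n = mk r l m (l s n) := by
  have h : r s m ⊗ₜ[k] n - m ⊗ₜ[k] l s n ∈ balancedRel r l :=
    Submodule.subset_span ⟨s, m, n, rfl⟩
  exact (Submodule.Quotient.eq _).2 h

variable {r l}

@[elab_as_elim]
lemma induction {C : BTensor r l → Prop} (t : BTensor r l) (h0 : C 0)
    (h1 : ∀ m n, C (mk r l m n)) (h2 : ∀ x y, C x → C y → C (x + y)) : C t := by
  obtain ⟨t, rfl⟩ := proj_surjective r l t
  induction t using TensorProduct.induction_on with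
  | zero => simpa using h0
  | tmul m n => exact h1 m n
  | add x y hx hy => rw [map_add]; exact h2 _ _ hx hy

@[ext high]
lemma hom_ext {f g : BTensor r l →ₗ[k] P}
    (h : ∀ m n, f (mk r l m n) = g (mk r l m n)) : f = g := by
  ext t
  induction t using BTensor.induction with
  | h0 => simp
  | h1 m n => exact h m n
  | h2 x y hx hy => simp [hx, hy]

/-- The universal property of the balanced tensor product. -/
def lift (f : M →ₗ[k] N →ₗ[k] P) (h : ∀ s m n, f (r s m) n = f m (l s n)) :
    BTensor r l →ₗ[k] P :=
  (balancedRel r l).liftQ (TensorProduct.lift f) (by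
    refine Submodule.span_le.2 ?_
    rintro _ ⟨s, m, n, rfl⟩
    simp [h s m n])

@[simp]
lemma lift_mk (f : M →ₗ[k] N →ₗ[k] P) (h : ∀ s m n, f (r s m) n = f m (l s n)) (m : M) (n : N) :
    lift f h (mk r l m n) = f m n := by
  rfl

/-- Functoriality of the balanced tensor product. -/
def map {r' : S → Module.End k M'} {l' : S → Module.End k N'}
    (f : M →ₗ[k] M') (g : N →ₗ[k] N') (hf : ∀ s m, f (r s m) = r' s (f m))
    (hg : ∀ s n, g (l s n) = l' s (g n)) : BTensor r l →ₗ[k] BTensor r' l' :=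
  lift ((mk r' l').compl₁₂ f g) (fun s m n => by simp [hf, hg, mk_bal])

@[simp]
lemma map_mk {r' : S → Module.End k M'} {l' : S → Module.End k N'}
    (f : M →ₗ[k] M') (g : N →ₗ[k] N') (hf : ∀ s m, f (r s m) = r' s (f m))
    (hg : ∀ s n, g (l s n) = l' s (g n)) (m : M) (n : N) :
    map (r := r) (l := l) f g hf hg (mk r l m n) = mk r' l' (f m) (g n) := by
  simp [map]

/-- An algebra acting on `M` and commuting with `S` acts on `M ⊗_S N`. -/
def actL {R : Type v} [Ring R] [Algebra k R] (φ : R →ₐ[k] Module.End k M)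
    (h : ∀ x s m, φ x (r s m) = r s (φ x m)) : R →ₐ[k] Module.End k (BTensor r l) where
  toFun x := map (φ x) LinearMap.id (h x) (fun _ _ => rfl)
  map_one' := by ext; simp
  map_mul' _ _ := by ext; simp
  map_zero' := by ext; simp
  map_add' _ _ := by ext; simp
  commutes' _ := by ext; simp [Module.algebraMap_end_apply]

@[simp]
lemma actL_mk {R : Type v} [Ring R] [Algebra k R] (φ : R →ₐ[k] Module.End k M)
    (h : ∀ x s m, φ x (r s m) = r s (φ x m)) (x : R) (m : M) (n : N) :
    actL (l := l) φ h x (mk r l m n) = mk r l (φ x m) n := by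
  simp [actL]

/-- An algebra acting on `N` and commuting with `S` acts on `M ⊗_S N`. -/
def actR {R : Type v} [Ring R] [Algebra k R] (φ : R →ₐ[k] Module.End k N)
    (h : ∀ x s n, φ x (l s n) = l s (φ x n)) : R →ₐ[k] Module.End k (BTensor r l) where
  toFun x := map LinearMap.id (φ x) (fun _ _ => rfl) (h x)
  map_one' := by ext; simp
  map_mul' _ _ := by ext; simp
  map_zero' := by ext; simp
  map_add' _ _ := by ext; simp
  commutes' _ := by ext; simp [Module.algebraMap_end_apply]

@[simp]
lemma actR_mk {R : Type v} [Ring R] [Algebra k R] (φ : R →ₐ[k] Module.End k N)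
    (h : ∀ x s n, φ x (l s n) = l s (φ x n)) (x : R) (m : M) (n : N) :
    actR (r := r) φ h x (mk r l m n) = mk r l m (φ x n) := by
  simp [actR]

end BTensor

end BTensor

/-! ### Algebras over a pair of commutative algebras -/

section Algebras

variable {k : Type u} [Field k]

/-- An object of `T(A, B)`: an associative unital `k`-algebra `D` together with an algebra
homomorphism `A ⊗ B → Z(D)`. -/
structure CentralAlg (A B : CommAlgCat.{v} k) where
  carrier : Type v
  [ring : Ring carrier]
  [algebra : Algebra k carrier]
  str : (A ⊗[k] B) →ₐ[k] Subalgebra.center k carrier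

namespace CentralAlg

attribute [instance] ring algebra

instance (A B : CommAlgCat.{v} k) : CoeSort (CentralAlg A B) (Type v) := ⟨carrier⟩

variable {A B C : CommAlgCat.{v} k}

/-- The homomorphism `a ↦ α(a ⊗ 1)`. -/
def left (D : CentralAlg A B) : A →ₐ[k] D :=
  ((Subalgebra.center k D).val.comp D.str).comp Algebra.TensorProduct.includeLeft

/-- The homomorphism `b ↦ α(1 ⊗ b)`. -/
def right (D : CentralAlg A B) : B →ₐ[k] D :=
  ((Subalgebra.center k D).val.comp D.str).comp Algebra.TensorProduct.includeRight

lemma left_comm (D : CentralAlg A B) (a : A) (d : D) : D.left a * d = d * D.left a :=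
  (Subalgebra.mem_center_iff.1 (D.str (a ⊗ₜ 1)).2 d).symm

lemma right_comm (D : CentralAlg A B) (b : B) (d : D) : D.right b * d = d * D.right b :=
  (Subalgebra.mem_center_iff.1 (D.str (1 ⊗ₜ b)).2 d).symm

/-- The right action of `B` on `D`. -/
def actB (D : CentralAlg A B) (b : B) : Module.End k D := LinearMap.mulRight k (D.right b)

/-- The left action of `B` on `E`. -/
def actB' (E : CentralAlg B C) (b : B) : Module.End k E := LinearMap.mulLeft k (E.left b)

@[simp] lemma actB_apply (D : CentralAlg A B) (b : B) (d : D) : D.actB b d = d * D.right b := rfl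
@[simp] lemma actB'_apply (E : CentralAlg B C) (b : B) (e : E) : E.actB' b e = E.left b * e := rfl

/-- The underlying vector space of `D ⊗_B E`. -/
abbrev TensorCarrier (D : CentralAlg A B) (E : CentralAlg B C) : Type v :=
  BTensor D.actB E.actB'

variable (D : CentralAlg A B) (E : CentralAlg B C)

/-- The element `d ⊗ e` of `D ⊗_B E`. -/
def tmul : D →ₗ[k] E →ₗ[k] TensorCarrier D E := BTensor.mk _ _

lemma tmul_bal (b : B) (d : D) (e : E) :
    tmul D E (d * D.right b) e = tmul D E d (E.left b * e) :=
  BTensor.mk_bal D.actB E.actB' b d e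

variable {D E} in
@[elab_as_elim]
lemma tensor_induction {P : TensorCarrier D E → Prop} (t : TensorCarrier D E) (h0 : P 0)
    (h1 : ∀ d e, P (tmul D E d e)) (h2 : ∀ x y, P x → P y → P (x + y)) : P t :=
  BTensor.induction t h0 h1 h2

lemma mulLeft_actB (d : D) (b : B) (x : D) :
    LinearMap.mulLeft k d (D.actB b x) = D.actB b (LinearMap.mulLeft k d x) :=
  (mul_assoc _ _ _).symm

lemma mulLeft_actB' (e : E) (b : B) (x : E) :
    LinearMap.mulLeft k e (E.actB' b x) = E.actB' b (LinearMap.mulLeft k e x) := by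
  simp [← mul_assoc, E.left_comm]

/-- The multiplication `(d ⊗ e)(d' ⊗ e') = dd' ⊗ ee'`. -/
def tensorMul : TensorCarrier D E →ₗ[k] TensorCarrier D E →ₗ[k] TensorCarrier D E :=
  BTensor.lift
    (LinearMap.mk₂ k (fun d e => BTensor.map (LinearMap.mulLeft k d) (LinearMap.mulLeft k e)
        (mulLeft_actB D d) (mulLeft_actB' E e))
      (fun _ _ _ => by ext; simp [add_mul])
      (fun _ _ _ => by ext; simp)
      (fun _ _ _ => by ext; simp [add_mul])
      (fun _ _ _ => by ext; simp))
    (fun b d e => by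
      ext d' e'
      have := tmul_bal D E b (d * d') (e * e')
      simpa [tmul, mul_assoc, D.right_comm] using this)

lemma tensorMul_tmul (d d' : D) (e e' : E) :
    tensorMul D E (tmul D E d e) (tmul D E d' e') = tmul D E (d * d') (e * e') := rfl

instance tensorRing : Ring (TensorCarrier D E) where
  __ := (inferInstance : AddCommGroup (TensorCarrier D E))
  mul x y := tensorMul D E x y
  one := tmul D E 1 1
  left_distrib x y z := map_add (tensorMul D E x) y z
  right_distrib x y z := by
    change tensorMul D E (x + y) z = tensorMul D E x z + tensorMul D E y z
    rw [map_add, LinearMap.add_apply]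
  zero_mul x := by
    change tensorMul D E 0 x = 0
    rw [map_zero, LinearMap.zero_apply]
  mul_zero x := map_zero (tensorMul D E x)
  mul_assoc x y z := by
    change tensorMul D E (tensorMul D E x y) z = tensorMul D E x (tensorMul D E y z)
    induction x using tensor_induction with
    | h0 => simp
    | h2 x x' hx hx' => simp only [map_add, LinearMap.add_apply, hx, hx']
    | h1 d e =>
    induction y using tensor_induction with
    | h0 => simp
    | h2 x x' hx hx' => simp only [map_add, LinearMap.add_apply, hx, hx']
    | h1 d' e' =>
    induction z using tensor_induction with
    | h0 => simp
    | h2 x x' hx hx' => simp only [map_add, hx, hx']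
    | h1 d'' e'' => simp only [tensorMul_tmul, mul_assoc]
  one_mul x := by
    change tensorMul D E (tmul D E 1 1) x = x
    induction x using tensor_induction with
    | h0 => simp
    | h2 x x' hx hx' => simp only [map_add, hx, hx']
    | h1 d e => rw [tensorMul_tmul, one_mul, one_mul]
  mul_one x := by
    change tensorMul D E x (tmul D E 1 1) = x
    induction x using tensor_induction with
    | h0 => simp
    | h2 x x' hx hx' => simp only [map_add, LinearMap.add_apply, hx, hx']
    | h1 d e => rw [tensorMul_tmul, mul_one, mul_one]

lemma tmul_mul_tmul (d d' : D) (e e' : E) :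
    tmul D E d e * tmul D E d' e' = tmul D E (d * d') (e * e') := rfl

lemma one_def : (1 : TensorCarrier D E) = tmul D E 1 1 := rfl

instance tensorAlgebra : Algebra k (TensorCarrier D E) :=
  Algebra.ofModule
    (fun c x y => by
      change tensorMul D E (c • x) y = c • tensorMul D E x y
      rw [map_smul, LinearMap.smul_apply])
    (fun c x y => map_smul (tensorMul D E x) c y)

/-- `d ↦ d ⊗ 1`. -/
def inl : D →ₐ[k] TensorCarrier D E :=
  AlgHom.ofLinearMap ((tmul D E).flip 1) rfl (fun d d' => by
    rw [LinearMap.flip_apply, LinearMap.flip_apply, LinearMap.flip_apply, tmul_mul_tmul, mul_one])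

/-- `e ↦ 1 ⊗ e`. -/
def inr : E →ₐ[k] TensorCarrier D E :=
  AlgHom.ofLinearMap (tmul D E 1) rfl (fun d d' => by rw [tmul_mul_tmul, mul_one])

lemma inl_apply (d : D) : inl D E d = tmul D E d 1 := rfl
lemma inr_apply (e : E) : inr D E e = tmul D E 1 e := rfl

lemma inl_comm_inr (d : D) (e : E) : Commute (inl D E d) (inr D E e) := by
  change inl D E d * inr D E e = inr D E e * inl D E d
  simp only [inl_apply, inr_apply, tmul_mul_tmul, mul_one, one_mul]

lemma inl_mul_inr (d : D) (e : E) : inl D E d * inr D E e = tmul D E d e := by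
  simp only [inl_apply, inr_apply, tmul_mul_tmul, mul_one, one_mul]

lemma inl_right (b : B) : inl D E (D.right b) = inr D E (E.left b) := by
  simpa only [inl_apply, inr_apply, mul_one, one_mul] using tmul_bal D E b 1 1

lemma mem_center_tensor (d : D) (e : E) (hd : ∀ x, d * x = x * d) (he : ∀ x, e * x = x * e) :
    tmul D E d e ∈ Subalgebra.center k (TensorCarrier D E) := by
  rw [Subalgebra.mem_center_iff]
  intro x
  induction x using tensor_induction with
  | h0 => rw [zero_mul, mul_zero]
  | h1 d' e' => rw [tmul_mul_tmul, tmul_mul_tmul, hd, he]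
  | h2 x y hx hy => rw [add_mul, mul_add, hx, hy]

/-- The homomorphism `A ⊗ C → D ⊗_B E`, `a ⊗ c ↦ α(a ⊗ 1) ⊗ β(1 ⊗ c)`. -/
def tensorStr : (A ⊗[k] C) →ₐ[k] TensorCarrier D E :=
  Algebra.TensorProduct.lift ((inl D E).comp D.left) ((inr D E).comp E.right)
    (fun a c => inl_comm_inr D E (D.left a) (E.right c))

lemma tensorStr_tmul (a : A) (c : C) :
    tensorStr D E (a ⊗ₜ c) = tmul D E (D.left a) (E.right c) :=
  (Algebra.TensorProduct.lift_tmul ..).trans (inl_mul_inr D E _ _)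

lemma tensorStr_mem (x : A ⊗[k] C) : tensorStr D E x ∈ Subalgebra.center k (TensorCarrier D E) := by
  induction x using TensorProduct.induction_on with
  | zero => rw [map_zero]; exact zero_mem _
  | add x y hx hy => rw [map_add]; exact add_mem hx hy
  | tmul a c =>
    rw [tensorStr_tmul]
    exact mem_center_tensor D E _ _ (D.left_comm a) (E.right_comm c)

/-- The algebra `D ⊗_B E` with the homomorphism `a ⊗ c ↦ α(a ⊗ 1) ⊗ β(1 ⊗ c)`: the composite of
`D ∈ T(A, B)` and `E ∈ T(B, C)`. -/
def tensor : CentralAlg A C where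
  carrier := TensorCarrier D E
  str := AlgHom.codRestrict (tensorStr D E) _ (tensorStr_mem D E)

variable {D E} in
/-- The element `d ⊗ e` of the algebra `D ⊗_B E`. -/
def pure (d : D) (e : E) : D.tensor E := tmul D E d e

variable {D E} in
lemma alg_induction {P : D.tensor E → Prop} (t : D.tensor E) (h0 : P 0)
    (h1 : ∀ d e, P (pure d e)) (h2 : ∀ x y, P x → P y → P (x + y)) : P t :=
  BTensor.induction t h0 h1 h2

lemma tensor_left (a : A) : (D.tensor E).left a = tmul D E (D.left a) 1 :=
  (tensorStr_tmul D E a 1).trans (by rw [map_one])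

lemma tensor_right (c : C) : (D.tensor E).right c = tmul D E 1 (E.right c) :=
  (tensorStr_tmul D E 1 c).trans (by rw [map_one])

section lift

variable {R : Type v} [Ring R] [Algebra k R] (f : D →ₐ[k] R) (g : E →ₐ[k] R)
    (hc : ∀ d e, f d * g e = g e * f d) (hb : ∀ b, f (D.right b) = g (E.left b))

/-- The linear map `d ⊗ e ↦ f d * g e`. -/
def liftLin : TensorCarrier D E →ₗ[k] R :=
  BTensor.lift ((LinearMap.mul k R).compl₁₂ f.toLinearMap g.toLinearMap) (fun b d e => by
    change f (d * D.right b) * g e = f d * g (E.left b * e)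
    rw [map_mul, map_mul, hb, mul_assoc])

lemma liftLin_tmul (d : D) (e : E) : liftLin D E f g hb (tmul D E d e) = f d * g e := rfl

/-- Algebra homomorphisms out of `D ⊗_B E`: `d ⊗ e ↦ f d * g e`. -/
def liftAlg : TensorCarrier D E →ₐ[k] R :=
  AlgHom.ofLinearMap (liftLin D E f g hb)
    (by rw [one_def, liftLin_tmul, map_one, map_one, mul_one])
    (fun x y => by
      induction x using tensor_induction with
      | h0 => rw [zero_mul, map_zero, zero_mul]
      | h2 x x' hx hx' => simp only [add_mul, map_add, hx, hx']
      | h1 d e =>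
      induction y using tensor_induction with
      | h0 => rw [mul_zero, map_zero, mul_zero]
      | h2 x x' hx hx' => simp only [mul_add, map_add, hx, hx']
      | h1 d' e' =>
      rw [tmul_mul_tmul, liftLin_tmul, liftLin_tmul, liftLin_tmul, map_mul, map_mul,
        mul_assoc, mul_assoc, ← mul_assoc (f d') (g e), hc, mul_assoc])

@[simp]
lemma liftAlg_tmul (d : D) (e : E) : liftAlg D E f g hc hb (tmul D E d e) = f d * g e := rfl

end lift

variable (A) in
/-- The unit of `T(A, A)`: the algebra `A` with the multiplication map `A ⊗ A → Z(A) = A`. -/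
def unit : CentralAlg A A where
  carrier := A
  str := AlgHom.codRestrict (Algebra.TensorProduct.lmul' k) _ (fun x => by
    rw [Subalgebra.mem_center_iff]
    intro y
    exact mul_comm _ _)

lemma unit_left (a : A) : (unit A).left a = a :=
  (Algebra.TensorProduct.lmul'_apply_tmul a 1).trans (mul_one a)

lemma unit_right (a : A) : (unit A).right a = a :=
  (Algebra.TensorProduct.lmul'_apply_tmul 1 a).trans (one_mul a)

end CentralAlg

end Algebras

/-! ### Bimodules -/

section Bimodules

variable {k : Type u} [Field k] {A B C : CommAlgCat.{v} k}

/-- An object of `S(D, α, E, β)`: a `D`-`E` bimodule over `k` on which the two actions of `A ⊗ B`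
induced by `α` and `β` agree.  The left action is an algebra homomorphism from `D` to the linear
endomorphisms, the right action one from the opposite algebra of `E`. -/
structure CompatBimod (D E : CentralAlg A B) where
  carrier : Type v
  [addCommGroup : AddCommGroup carrier]
  [module : Module k carrier]
  lact : D →ₐ[k] Module.End k carrier
  ract : (E : Type v)ᵐᵒᵖ →ₐ[k] Module.End k carrier
  lact_ract : ∀ d e m, lact d (ract e m) = ract e (lact d m)
  compat : ∀ (x : A ⊗[k] B) (m : carrier),
    lact (D.str x : D) m = ract (op (E.str x : E)) m

namespace CompatBimod

attribute [instance] addCommGroup module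

/-- A homomorphism of bimodules. -/
structure Hom {D E : CentralAlg A B} (M N : CompatBimod D E) where
  toLin : M.carrier →ₗ[k] N.carrier
  map_lact : ∀ d m, toLin (M.lact d m) = N.lact d (toLin m)
  map_ract : ∀ e m, toLin (M.ract e m) = N.ract e (toLin m)

/-- The category `S(D, E)` of bimodules and bimodule homomorphisms. -/
instance homCategory (D E : CentralAlg A B) : Category (CompatBimod D E) where
  Hom M N := Hom M N
  id M := ⟨LinearMap.id, fun _ _ => rfl, fun _ _ => rfl⟩
  comp f g := ⟨g.toLin.comp f.toLin,
    fun d m => (congrArg g.toLin (f.map_lact d m)).trans (g.map_lact d _),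
    fun d m => (congrArg g.toLin (f.map_ract d m)).trans (g.map_ract d _)⟩

section

variable {D E F G : CentralAlg A B}

lemma hom_ext' {M N : CompatBimod D E} {f g : M ⟶ N} (h : f.toLin = g.toLin) : f = g := by
  obtain ⟨f, _, _⟩ : Hom M N := f
  obtain ⟨g, _, _⟩ : Hom M N := g
  obtain rfl : f = g := h
  rfl

lemma hom_ext {M N : CompatBimod D E} {f g : M ⟶ N} (h : ∀ m, f.toLin m = g.toLin m) : f = g :=
  hom_ext' (LinearMap.ext h)

@[simp] lemma comp_apply {M N P : CompatBimod D E} (f : M ⟶ N) (g : N ⟶ P) (m : M.carrier) :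
    (f ≫ g).toLin m = g.toLin (f.toLin m) := rfl

@[simp] lemma id_apply {M : CompatBimod D E} (m : M.carrier) : Hom.toLin (𝟙 M) m = m := rfl

/-- The right action of an element, as an endomorphism. -/
def racts (M : CompatBimod D E) (e : E) : Module.End k M.carrier := M.ract (op e)

@[simp] lemma racts_apply (M : CompatBimod D E) (e : E) (m : M.carrier) :
    M.racts e m = M.ract (op e) m := rfl

/-- The left action of an element, as an endomorphism. -/
def lacts (M : CompatBimod D E) (d : D) : Module.End k M.carrier := M.lact d

@[simp] lemma lacts_apply (M : CompatBimod D E) (d : D) (m : M.carrier) : M.lacts d m = M.lact d m := rfl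

/-- The algebra `D` as a `D`-`D` bimodule. -/
def regular (D : CentralAlg A B) : CompatBimod D D where
  carrier := D
  lact := Algebra.lmul k D
  ract := AlgHom.ofLinearMap
    ((LinearMap.mul k D).flip.comp (MulOpposite.opLinearEquiv k).symm.toLinearMap)
    (LinearMap.ext fun x => mul_one x)
    (fun x y => LinearMap.ext fun z => (mul_assoc z y.unop x.unop).symm)
  lact_ract d e m := (mul_assoc d m e.unop).symm
  compat x m := (Subalgebra.mem_center_iff.1 (D.str x).2 m).symm

/-- An element of `D`, as an element of the regular bimodule. -/
def reg {D : CentralAlg A B} (d : D) : (regular D).carrier := d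

lemma regular_lact (d m : D) : (regular D).lact d m = d * m := rfl
lemma regular_ract (e : Dᵐᵒᵖ) (m : D) : (regular D).ract e m = m * e.unop := rfl

/-- The tensor product `M ⊗_E N` of a `D`-`E` and an `E`-`F` bimodule. -/
def tensor (M : CompatBimod D E) (N : CompatBimod E F) : CompatBimod D F where
  carrier := BTensor M.racts N.lacts
  lact := BTensor.actL M.lact (fun d e m => M.lact_ract d (op e) m)
  ract := BTensor.actR N.ract (fun f e n => (N.lact_ract e f n).symm)
  lact_ract d e t := by
    induction t using BTensor.induction with
    | h0 => simp only [map_zero]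
    | h1 m n => rfl
    | h2 x y hx hy => simp only [map_add, hx, hy]
  compat x t := by
    induction t using BTensor.induction with
    | h0 => simp only [map_zero]
    | h2 x y hx hy => simp only [map_add, hx, hy]
    | h1 m n =>
      change BTensor.mk M.racts N.lacts (M.lact (D.str x : D) m) n =
        BTensor.mk M.racts N.lacts m (N.ract (op (F.str x : F)) n)
      rw [M.compat, ← N.compat]
      exact BTensor.mk_bal M.racts N.lacts _ m n

/-- The element `m ⊗ n` of `M ⊗_E N`. -/
def tmul (M : CompatBimod D E) (N : CompatBimod E F) :
    M.carrier →ₗ[k] N.carrier →ₗ[k] (M.tensor N).carrier := BTensor.mk M.racts N.lacts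

variable {M M' M'' : CompatBimod D E} {N N' N'' : CompatBimod E F} {P P' : CompatBimod F G}

lemma tmul_bal (e : E) (m : M.carrier) (n : N.carrier) :
    tmul M N (M.ract (op e) m) n = tmul M N m (N.lact e n) :=
  BTensor.mk_bal M.racts N.lacts e m n

@[simp] lemma lact_tmul (d : D) (m : M.carrier) (n : N.carrier) :
    (M.tensor N).lact d (tmul M N m n) = tmul M N (M.lact d m) n := rfl

@[simp] lemma ract_tmul (f : (F : Type v)ᵐᵒᵖ) (m : M.carrier) (n : N.carrier) :
    (M.tensor N).ract f (tmul M N m n) = tmul M N m (N.ract f n) := rfl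

@[elab_as_elim]
lemma tensor_induction {C : (M.tensor N).carrier → Prop} (t : (M.tensor N).carrier) (h0 : C 0)
    (h1 : ∀ m n, C (tmul M N m n)) (h2 : ∀ x y, C x → C y → C (x + y)) : C t :=
  BTensor.induction t h0 h1 h2

lemma lin_ext {X : Type v} [AddCommGroup X] [Module k X] {f g : (M.tensor N).carrier →ₗ[k] X}
    (h : ∀ m n, f (tmul M N m n) = g (tmul M N m n)) : f = g :=
  BTensor.hom_ext h

lemma tensor_ext {Q : CompatBimod D F} {f g : M.tensor N ⟶ Q}
    (h : ∀ m n, f.toLin (tmul M N m n) = g.toLin (tmul M N m n)) : f = g :=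
  hom_ext' (BTensor.hom_ext h)

/-- Linear maps out of a tensor product of bimodules. -/
def lift {X : Type v} [AddCommGroup X] [Module k X] (f : M.carrier →ₗ[k] N.carrier →ₗ[k] X)
    (h : ∀ e m n, f (M.ract (op e) m) n = f m (N.lact e n)) : (M.tensor N).carrier →ₗ[k] X :=
  BTensor.lift f h

@[simp] lemma lift_tmul {X : Type v} [AddCommGroup X] [Module k X]
    (f : M.carrier →ₗ[k] N.carrier →ₗ[k] X)
    (h : ∀ e m n, f (M.ract (op e) m) n = f m (N.lact e n)) (m : M.carrier) (n : N.carrier) :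
    lift f h (tmul M N m n) = f m n := rfl

/-- Bimodule homomorphisms out of a tensor product of bimodules. -/
def tensorHom {Q : CompatBimod D F} (f : (M.tensor N).carrier →ₗ[k] Q.carrier)
    (hl : ∀ d m n, f (tmul M N (M.lact d m) n) = Q.lact d (f (tmul M N m n)))
    (hr : ∀ e m n, f (tmul M N m (N.ract e n)) = Q.ract e (f (tmul M N m n))) :
    M.tensor N ⟶ Q where
  toLin := f
  map_lact d t := by
    induction t using tensor_induction with
    | h0 => simp only [map_zero]
    | h2 x y hx hy => simp only [map_add, hx, hy]
    | h1 m n => exact hl d m n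
  map_ract d t := by
    induction t using tensor_induction with
    | h0 => simp only [map_zero]
    | h2 x y hx hy => simp only [map_add, hx, hy]
    | h1 m n => exact hr d m n

/-- The homomorphism `φ ⊗ ψ`. -/
def map (φ : M ⟶ M') (ψ : N ⟶ N') : M.tensor N ⟶ M'.tensor N' :=
  tensorHom (lift ((tmul M' N').compl₁₂ φ.toLin ψ.toLin) (fun e m n => by
      change tmul M' N' (φ.toLin _) (ψ.toLin _) = tmul M' N' (φ.toLin _) (ψ.toLin _)
      rw [φ.map_ract, ψ.map_lact, tmul_bal]))
    (fun d m n => congrArg (fun x => tmul M' N' x (ψ.toLin n)) (φ.map_lact d m))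
    (fun d m n => congrArg (tmul M' N' (φ.toLin m)) (ψ.map_ract d n))

lemma map_tmul (φ : M ⟶ M') (ψ : N ⟶ N') (m : M.carrier) (n : N.carrier) :
    (map φ ψ).toLin (tmul M N m n) = tmul M' N' (φ.toLin m) (ψ.toLin n) := rfl

/-- Build an isomorphism of bimodules from homomorphisms inverse to each other. -/
def mkIso {Q R : CompatBimod D E} (f : Q ⟶ R) (g : R ⟶ Q) (h : ∀ x, g.toLin (f.toLin x) = x)
    (h' : ∀ x, f.toLin (g.toLin x) = x) : Q ≅ R :=
  ⟨f, g, hom_ext h, hom_ext h'⟩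

/-- The linear map `m ↦ (n ↦ (p ↦ m ⊗ (n ⊗ p)))`, descended to `n ⊗ p`. -/
def assocInvAux (M : CompatBimod D E) (N : CompatBimod E F) (P : CompatBimod F G) (m : M.carrier) :
    (N.tensor P).carrier →ₗ[k] ((M.tensor N).tensor P).carrier :=
  lift ((tmul (M.tensor N) P).comp (tmul M N m)) (fun e n p => by
    exact tmul_bal (M := M.tensor N) (N := P) e (tmul M N m n) p)

/-- The isomorphism `(m ⊗ n) ⊗ p ↦ m ⊗ (n ⊗ p)`. -/
def assoc (M : CompatBimod D E) (N : CompatBimod E F) (P : CompatBimod F G) :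
    (M.tensor N).tensor P ≅ M.tensor (N.tensor P) :=
  mkIso
    (tensorHom
      (lift (lift
        (LinearMap.mk₂ k (fun m n => (tmul M (N.tensor P) m).comp (tmul N P n))
          (fun _ _ _ => LinearMap.ext fun _ => by simp)
          (fun _ _ _ => LinearMap.ext fun _ => by simp)
          (fun _ _ _ => LinearMap.ext fun _ => by simp)
          (fun _ _ _ => LinearMap.ext fun _ => by simp))
        (fun e m n => LinearMap.ext fun p =>
          tmul_bal (M := M) (N := N.tensor P) e m (tmul N P n p)))
        (fun e t p => by
          induction t using tensor_induction with
          | h0 => simp only [map_zero, LinearMap.zero_apply]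
          | h2 x y hx hy => simp only [map_add, LinearMap.add_apply, hx, hy]
          | h1 m n => exact congrArg (tmul M (N.tensor P) m) (tmul_bal (M := N) (N := P) e n p)))
      (fun d t p => by
        induction t using tensor_induction with
        | h0 => simp only [map_zero, LinearMap.zero_apply]
        | h2 x y hx hy => simp only [map_add, LinearMap.add_apply, hx, hy]
        | h1 m n => rfl)
      (fun d t p => by
        induction t using tensor_induction with
        | h0 => simp only [map_zero, LinearMap.zero_apply]
        | h2 x y hx hy => simp only [map_add, LinearMap.add_apply, hx, hy]
        | h1 m n => rfl))
    (tensorHom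
      (lift
        { toFun := assocInvAux M N P
          map_add' := fun m m' => lin_ext fun n p => by
            change tmul _ P (tmul M N (m + m') n) p =
              tmul _ P (tmul M N m n) p + tmul _ P (tmul M N m' n) p
            simp only [map_add, LinearMap.add_apply]
          map_smul' := fun c m => lin_ext fun n p => by
            change tmul _ P (tmul M N (c • m) n) p = c • tmul _ P (tmul M N m n) p
            simp only [map_smul, LinearMap.smul_apply] }
        (fun e m t => by
          induction t using tensor_induction with
          | h0 => simp only [map_zero]
          | h2 x y hx hy => simp only [map_add, hx, hy]
          | h1 n p =>
            exact congrArg (fun x => tmul (M.tensor N) P x p) (tmul_bal (M := M) (N := N) e m n)))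
      (fun d m t => by
        induction t using tensor_induction with
        | h0 => simp only [map_zero]
        | h2 x y hx hy => simp only [map_add, hx, hy]
        | h1 n p => rfl)
      (fun d m t => by
        induction t using tensor_induction with
        | h0 => simp only [map_zero]
        | h2 x y hx hy => simp only [map_add, hx, hy]
        | h1 n p => rfl))
    (fun x => by
      induction x using tensor_induction with
      | h0 => simp only [map_zero]
      | h2 x y hx hy => simp only [map_add, hx, hy]
      | h1 t p =>
      induction t using tensor_induction with
      | h0 => simp only [map_zero, LinearMap.zero_apply]
      | h2 x y hx hy => simp only [map_add, LinearMap.add_apply, hx, hy]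
      | h1 m n => rfl)
    (fun x => by
      induction x using tensor_induction with
      | h0 => simp only [map_zero]
      | h2 x y hx hy => simp only [map_add, hx, hy]
      | h1 m t =>
      induction t using tensor_induction with
      | h0 => simp only [map_zero]
      | h2 x y hx hy => simp only [map_add, hx, hy]
      | h1 n p => rfl)

lemma assoc_hom_tmul (m : M.carrier) (n : N.carrier) (p : P.carrier) :
    (assoc M N P).hom.toLin (tmul _ P (tmul M N m n) p) = tmul M _ m (tmul N P n p) := rfl

lemma assoc_inv_tmul (m : M.carrier) (n : N.carrier) (p : P.carrier) :
    (assoc M N P).inv.toLin (tmul M _ m (tmul N P n p)) = tmul _ P (tmul M N m n) p := rfl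

lemma reg_tmul (M : CompatBimod D E) (d d' : D) (m : M.carrier) :
    tmul (regular D) M (reg (d * d')) m = tmul (regular D) M (reg d) (M.lact d' m) :=
  tmul_bal (M := regular D) (N := M) d' (reg d) m

lemma tmul_reg (M : CompatBimod D E) (e e' : E) (m : M.carrier) :
    tmul M (regular E) (M.ract (op e) m) (reg e') = tmul M (regular E) m (reg (e * e')) :=
  tmul_bal (M := M) (N := regular E) e m (reg e')

/-- The isomorphism `d ⊗ m ↦ d · m`. -/
def leftUnitor (M : CompatBimod D E) : (regular D).tensor M ≅ M :=
  mkIso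
    (tensorHom (lift (M := regular D) M.lact.toLinearMap
        (fun e d m => congrArg (fun f : Module.End k M.carrier => f m)
          (map_mul M.lact (show D from d) e)))
      (fun d d' m => congrArg (fun f : Module.End k M.carrier => f m)
          (map_mul M.lact d (show D from d')))
      (fun e d m => M.lact_ract d e m))
    ⟨tmul (regular D) M (reg 1), fun d m => by
        refine (reg_tmul M 1 d m).symm.trans ?_
        rw [one_mul]
        exact congrArg (fun x => tmul (regular D) M (reg x) m) (mul_one d).symm,
      fun _ _ => rfl⟩
    (fun x => by
      induction x using tensor_induction with
      | h0 => simp only [map_zero]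
      | h2 x y hx hy => simp only [map_add, hx, hy]
      | h1 d m =>
        refine (reg_tmul M 1 d m).symm.trans ?_
        exact congrArg (fun x => tmul (regular D) M (reg x) m) (one_mul (show D from d)))
    (fun m => congrArg (fun f : Module.End k M.carrier => f m) (map_one M.lact))

lemma leftUnitor_hom_tmul (d : D) (m : M.carrier) :
    (leftUnitor M).hom.toLin (tmul (regular D) M (reg d) m) = M.lact d m := rfl

lemma leftUnitor_inv_apply (m : M.carrier) :
    (leftUnitor M).inv.toLin m = tmul (regular D) M (reg 1) m := rfl

/-- The isomorphism `m ⊗ e ↦ m · e`. -/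
def rightUnitor (M : CompatBimod D E) : M.tensor (regular E) ≅ M :=
  mkIso
    (tensorHom (lift (N := regular E)
        (M.ract.toLinearMap.comp (MulOpposite.opLinearEquiv k).toLinearMap).flip
        (fun e m e' => (congrArg (fun f : Module.End k M.carrier => f m)
          (map_mul M.ract (op (show E from e')) (op e))).symm))
      (fun d m e => (M.lact_ract d (op (show E from e)) m).symm)
      (fun e m e' => congrArg (fun f : Module.End k M.carrier => f m)
          (map_mul M.ract e (op (show E from e')))))
    ⟨(tmul M (regular E)).flip (reg 1), fun _ _ => rfl, fun e m => by
        refine (tmul_reg M e.unop 1 m).trans ?_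
        rw [mul_one]
        exact congrArg (fun x => tmul M (regular E) m (reg x)) (one_mul e.unop).symm⟩
    (fun x => by
      induction x using tensor_induction with
      | h0 => simp only [map_zero]
      | h2 x y hx hy => simp only [map_add, hx, hy]
      | h1 m e =>
        refine (tmul_reg M e 1 m).trans ?_
        exact congrArg (fun x => tmul M (regular E) m (reg x)) (mul_one (show E from e)))
    (fun m => congrArg (fun f : Module.End k M.carrier => f m) (map_one M.ract))

lemma rightUnitor_hom_tmul (e : E) (m : M.carrier) :
    (rightUnitor M).hom.toLin (tmul M (regular E) m (reg e)) = M.ract (op e) m := rfl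

lemma rightUnitor_inv_apply (m : M.carrier) :
    (rightUnitor M).inv.toLin m = tmul M (regular E) m (reg 1) := rfl

end

end CompatBimod

/-- The bicategory `T(A, B)`: its objects are the algebras `D` with a homomorphism from `A ⊗ B` to
the centre of `D`, its 1-cells `D ⟶ E` the bimodules in `S(D, E)`, its 2-cells the bimodule
homomorphisms, and `M ≫ N` is `M ⊗_E N`. -/
instance CentralAlg.bicategory (A B : CommAlgCat.{v} k) : Bicategory (CentralAlg A B) where
  Hom D E := CompatBimod D E
  id D := CompatBimod.regular D
  comp M N := M.tensor N
  homCategory D E := CompatBimod.homCategory D E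
  whiskerLeft M _ _ ψ := CompatBimod.map (𝟙 M) ψ
  whiskerRight φ N := CompatBimod.map φ (𝟙 N)
  associator M N P := CompatBimod.assoc M N P
  leftUnitor M := CompatBimod.leftUnitor M
  rightUnitor M := CompatBimod.rightUnitor M
  whiskerLeft_id _ _ := CompatBimod.tensor_ext fun _ _ => rfl
  whiskerLeft_comp _ _ _ _ _ _ := CompatBimod.tensor_ext fun _ _ => rfl
  id_whiskerLeft η := by
    rw [← Category.assoc, Iso.eq_comp_inv]
    exact CompatBimod.tensor_ext fun d m => (η.map_lact d m).symm
  comp_whiskerLeft M N _ _ η := by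
    rw [← Category.assoc, Iso.eq_comp_inv]
    refine CompatBimod.hom_ext fun t => ?_
    induction t using CompatBimod.tensor_induction with
    | h0 => simp only [map_zero]
    | h2 x y hx hy => simp only [map_add, hx, hy]
    | h1 t p =>
    induction t using CompatBimod.tensor_induction with
    | h0 => simp only [map_zero, LinearMap.zero_apply]
    | h2 x y hx hy => simp only [map_add, LinearMap.add_apply, hx, hy]
    | h1 m n => rfl
  id_whiskerRight _ _ := CompatBimod.tensor_ext fun _ _ => rfl
  comp_whiskerRight _ _ _ := CompatBimod.tensor_ext fun _ _ => rfl
  whiskerRight_id η := by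
    rw [← Category.assoc, Iso.eq_comp_inv]
    exact CompatBimod.tensor_ext fun m e => (η.map_ract (op e) m).symm
  whiskerRight_comp η N P := by
    rw [Iso.eq_inv_comp]
    refine CompatBimod.hom_ext fun t => ?_
    induction t using CompatBimod.tensor_induction with
    | h0 => simp only [map_zero]
    | h2 x y hx hy => simp only [map_add, hx, hy]
    | h1 t p =>
    induction t using CompatBimod.tensor_induction with
    | h0 => simp only [map_zero, LinearMap.zero_apply]
    | h2 x y hx hy => simp only [map_add, LinearMap.add_apply, hx, hy]
    | h1 m n => rfl
  whisker_assoc M _ _ η P := by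
    rw [← Category.assoc, Iso.eq_comp_inv]
    refine CompatBimod.hom_ext fun t => ?_
    induction t using CompatBimod.tensor_induction with
    | h0 => simp only [map_zero]
    | h2 x y hx hy => simp only [map_add, hx, hy]
    | h1 t p =>
    induction t using CompatBimod.tensor_induction with
    | h0 => simp only [map_zero, LinearMap.zero_apply]
    | h2 x y hx hy => simp only [map_add, LinearMap.add_apply, hx, hy]
    | h1 m n => rfl
  whisker_exchange _ _ := CompatBimod.tensor_ext fun _ _ => rfl
  pentagon M N P Q := by
    refine CompatBimod.hom_ext fun t => ?_
    induction t using CompatBimod.tensor_induction with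
    | h0 => simp only [map_zero]
    | h2 x y hx hy => simp only [map_add, hx, hy]
    | h1 t q =>
    induction t using CompatBimod.tensor_induction with
    | h0 => simp only [map_zero, LinearMap.zero_apply]
    | h2 x y hx hy => simp only [map_add, LinearMap.add_apply, hx, hy]
    | h1 t p =>
    induction t using CompatBimod.tensor_induction with
    | h0 => simp only [map_zero, LinearMap.zero_apply]
    | h2 x y hx hy => simp only [map_add, LinearMap.add_apply, hx, hy]
    | h1 m n => rfl
  triangle {D E F} M N := by
    refine CompatBimod.hom_ext fun t => ?_
    induction t using CompatBimod.tensor_induction with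
    | h0 => simp only [map_zero]
    | h2 x y hx hy => simp only [map_add, hx, hy]
    | h1 t n =>
    induction t using CompatBimod.tensor_induction with
    | h0 => simp only [map_zero, LinearMap.zero_apply]
    | h2 x y hx hy => simp only [map_add, LinearMap.add_apply, hx, hy]
    | h1 m e => exact (CompatBimod.tmul_bal (M := M) (N := N) e m n).symm

end Bimodules

/-! ### The composition functor `T(A, B) × T(B, C) → T(A, C)` -/

section Composition

variable {k : Type u} [Field k] {A B C : CommAlgCat.{v} k}

namespace CompatBimod

section

variable {D D' D'' : CentralAlg A B} {E E' E'' : CentralAlg B C}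

lemma compat_right (M : CompatBimod D D') (b : B) (m : M.carrier) :
    M.lact (D.right b) m = M.ract (op (D'.right b)) m := M.compat (1 ⊗ₜ b) m

lemma compat_left (M : CompatBimod D D') (a : A) (m : M.carrier) :
    M.lact (D.left a) m = M.ract (op (D'.left a)) m := M.compat (a ⊗ₜ 1) m

/-- The right action of `B` on a bimodule between objects of `T(A, B)`. -/
def actB (M : CompatBimod D D') (b : B) : Module.End k M.carrier := M.ract (op (D'.right b))

/-- The left action of `B` on a bimodule between objects of `T(B, C)`. -/
def actB' (N : CompatBimod E E') (b : B) : Module.End k N.carrier := N.lact (E.left b)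

lemma lact_actB (M : CompatBimod D D') (d : D) (b : B) (m : M.carrier) :
    M.lact d (M.actB b m) = M.actB b (M.lact d m) := M.lact_ract _ _ _

lemma ract_actB (M : CompatBimod D D') (d : (D' : Type v)ᵐᵒᵖ) (b : B) (m : M.carrier) :
    M.ract d (M.actB b m) = M.actB b (M.ract d m) := by
  change M.ract d (M.ract (op (D'.right b)) m) = M.ract (op (D'.right b)) (M.ract d m)
  rw [← M.compat_right, ← M.compat_right, M.lact_ract]

lemma lact_actB' (N : CompatBimod E E') (e : E) (b : B) (n : N.carrier) :
    N.lact e (N.actB' b n) = N.actB' b (N.lact e n) := by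
  change N.lact e (N.lact (E.left b) n) = N.lact (E.left b) (N.lact e n)
  rw [N.compat_left, N.compat_left, N.lact_ract]

lemma ract_actB' (N : CompatBimod E E') (e : (E' : Type v)ᵐᵒᵖ) (b : B) (n : N.carrier) :
    N.ract e (N.actB' b n) = N.actB' b (N.ract e n) := (N.lact_ract _ _ _).symm

/-- The left action of `D ⊗_B E` on `M ⊗_B N`. -/
def boxLact (M : CompatBimod D D') (N : CompatBimod E E') :
    D.TensorCarrier E →ₐ[k] Module.End k (BTensor M.actB N.actB') :=
  CentralAlg.liftAlg D E (BTensor.actL M.lact M.lact_actB) (BTensor.actR N.lact N.lact_actB')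
    (fun _ _ => BTensor.hom_ext fun _ _ => rfl)
    (fun b => BTensor.hom_ext fun m n => by
      change BTensor.mk M.actB N.actB' (M.lact (D.right b) m) n =
        BTensor.mk M.actB N.actB' m (N.lact (E.left b) n)
      rw [M.compat_right]
      exact BTensor.mk_bal M.actB N.actB' b m n)

/-- The right action of `D' ⊗_B E'` on `M ⊗_B N`. -/
def boxRact (M : CompatBimod D D') (N : CompatBimod E E') :
    (D'.TensorCarrier E')ᵐᵒᵖ →ₐ[k] Module.End k (BTensor M.actB N.actB') :=
  AlgHom.opComm (CentralAlg.liftAlg D' E'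
    (AlgHom.opComm.symm (BTensor.actL M.ract M.ract_actB))
    (AlgHom.opComm.symm (BTensor.actR N.ract N.ract_actB'))
    (fun _ _ => unop_injective (BTensor.hom_ext fun _ _ => rfl))
    (fun b => unop_injective (BTensor.hom_ext fun m n => by
      change BTensor.mk M.actB N.actB' (M.ract (op (D'.right b)) m) n =
        BTensor.mk M.actB N.actB' m (N.ract (op (E'.left b)) n)
      rw [← N.compat_left]
      exact BTensor.mk_bal M.actB N.actB' b m n)))

lemma boxLact_mk (M : CompatBimod D D') (N : CompatBimod E E') (d : D) (e : E) (m : M.carrier)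
    (n : N.carrier) : boxLact M N (CentralAlg.tmul D E d e) (BTensor.mk M.actB N.actB' m n) =
      BTensor.mk M.actB N.actB' (M.lact d m) (N.lact e n) := rfl

lemma boxRact_mk (M : CompatBimod D D') (N : CompatBimod E E') (d : D') (e : E') (m : M.carrier)
    (n : N.carrier) : boxRact M N (op (CentralAlg.tmul D' E' d e)) (BTensor.mk M.actB N.actB' m n) =
      BTensor.mk M.actB N.actB' (M.ract (op d) m) (N.ract (op e) n) := rfl

lemma boxLact_boxRact (M : CompatBimod D D') (N : CompatBimod E E') (x : D.TensorCarrier E)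
    (y : D'.TensorCarrier E') (t : BTensor M.actB N.actB') :
    boxLact M N x (boxRact M N (op y) t) = boxRact M N (op y) (boxLact M N x t) := by
  induction t using BTensor.induction with
  | h0 => simp only [map_zero]
  | h2 t t' ht ht' => simp only [map_add, ht, ht']
  | h1 m n =>
  induction x using CentralAlg.tensor_induction with
  | h0 => simp only [map_zero, LinearMap.zero_apply]
  | h2 x x' hx hx' => simp only [map_add, LinearMap.add_apply, hx, hx']
  | h1 d e =>
  induction y using CentralAlg.tensor_induction with
  | h0 => simp only [MulOpposite.op_zero, map_zero, LinearMap.zero_apply]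
  | h2 x x' hx hx' => simp only [MulOpposite.op_add, map_add, LinearMap.add_apply, hx, hx']
  | h1 d' e' => simp only [boxLact_mk, boxRact_mk, M.lact_ract, N.lact_ract]

/-- The tensor product `M ⊗_B N` of `M ∈ S(D, D')` and `N ∈ S(E, E')`, as a bimodule between
`D ⊗_B E` and `D' ⊗_B E'`, where `D, D' ∈ T(A, B)` and `E, E' ∈ T(B, C)`. -/
def box (M : CompatBimod D D') (N : CompatBimod E E') :
    CompatBimod (D.tensor E) (D'.tensor E') where
  carrier := BTensor M.actB N.actB'
  lact := boxLact M N
  ract := boxRact M N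
  lact_ract x y t := boxLact_boxRact M N x y.unop t
  compat x t := by
    change boxLact M N (D.tensorStr E x) t = boxRact M N (op (D'.tensorStr E' x)) t
    induction x using TensorProduct.induction_on with
    | zero => simp only [map_zero, op_zero, LinearMap.zero_apply]
    | add x y hx hy => simp only [map_add, MulOpposite.op_add, LinearMap.add_apply, hx, hy]
    | tmul a c =>
    rw [CentralAlg.tensorStr_tmul, CentralAlg.tensorStr_tmul]
    induction t using BTensor.induction with
    | h0 => simp only [map_zero]
    | h2 t t' ht ht' => simp only [map_add, ht, ht']
    | h1 m n => rw [boxLact_mk, boxRact_mk, M.compat_left, N.compat_right]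

/-- The element `m ⊗ n` of `M ⊗_B N`. -/
def btmul (M : CompatBimod D D') (N : CompatBimod E E') :
    M.carrier →ₗ[k] N.carrier →ₗ[k] (M.box N).carrier := BTensor.mk M.actB N.actB'

variable {M M₁ : CompatBimod D D'} {M' : CompatBimod D' D''} {N N₁ : CompatBimod E E'}
  {N' : CompatBimod E' E''}

lemma btmul_bal (b : B) (m : M.carrier) (n : N.carrier) :
    btmul M N (M.ract (op (D'.right b)) m) n = btmul M N m (N.lact (E.left b) n) :=
  BTensor.mk_bal M.actB N.actB' b m n

lemma lact_btmul (d : D) (e : E) (m : M.carrier) (n : N.carrier) :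
    (M.box N).lact (CentralAlg.pure d e) (btmul M N m n) =
      btmul M N (M.lact d m) (N.lact e n) := rfl

lemma ract_btmul (d : D') (e : E') (m : M.carrier) (n : N.carrier) :
    (M.box N).ract (op (CentralAlg.pure d e)) (btmul M N m n) =
      btmul M N (M.ract (op d) m) (N.ract (op e) n) := rfl

@[elab_as_elim]
lemma box_induction {C : (M.box N).carrier → Prop} (t : (M.box N).carrier) (h0 : C 0)
    (h1 : ∀ m n, C (btmul M N m n)) (h2 : ∀ x y, C x → C y → C (x + y)) : C t :=
  BTensor.induction t h0 h1 h2

lemma blin_ext {X : Type v} [AddCommGroup X] [Module k X] {f g : (M.box N).carrier →ₗ[k] X}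
    (h : ∀ m n, f (btmul M N m n) = g (btmul M N m n)) : f = g :=
  BTensor.hom_ext h

lemma box_ext {Q : CompatBimod (D.tensor E) (D'.tensor E')} {f g : M.box N ⟶ Q}
    (h : ∀ m n, f.toLin (btmul M N m n) = g.toLin (btmul M N m n)) : f = g :=
  hom_ext' (BTensor.hom_ext h)

/-- Linear maps out of `M ⊗_B N`. -/
def blift {X : Type v} [AddCommGroup X] [Module k X] (f : M.carrier →ₗ[k] N.carrier →ₗ[k] X)
    (h : ∀ b m n, f (M.ract (op (D'.right b)) m) n = f m (N.lact (E.left b) n)) :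
    (M.box N).carrier →ₗ[k] X :=
  BTensor.lift f h

/-- Bimodule homomorphisms out of `M ⊗_B N`. -/
def boxHom {Q : CompatBimod (D.tensor E) (D'.tensor E')} (f : (M.box N).carrier →ₗ[k] Q.carrier)
    (hl : ∀ d e m n, f (btmul M N (M.lact d m) (N.lact e n)) =
      Q.lact (CentralAlg.pure d e) (f (btmul M N m n)))
    (hr : ∀ d e m n, f (btmul M N (M.ract (op d) m) (N.ract (op e) n)) =
      Q.ract (op (CentralAlg.pure d e)) (f (btmul M N m n))) :
    M.box N ⟶ Q where
  toLin := f
  map_lact x t := by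
    induction t using box_induction with
    | h0 => simp only [map_zero]
    | h2 x y hx hy => simp only [map_add, hx, hy]
    | h1 m n =>
    refine CentralAlg.alg_induction
      (P := fun x => f ((M.box N).lact x (btmul M N m n)) = Q.lact x (f (btmul M N m n))) x
      ?_ (fun d e => hl d e m n) (fun x y hx hy => ?_)
    · simp only [map_zero, LinearMap.zero_apply]
    · simp only [map_add, LinearMap.add_apply, hx, hy]
  map_ract x t := by
    induction t using box_induction with
    | h0 => simp only [map_zero]
    | h2 x y hx hy => simp only [map_add, hx, hy]
    | h1 m n =>
    refine CentralAlg.alg_induction (P := fun x => f ((M.box N).ract (op x) (btmul M N m n)) =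
      Q.ract (op x) (f (btmul M N m n))) x.unop ?_ (fun d e => hr d e m n) (fun x y hx hy => ?_)
    · simp only [MulOpposite.op_zero, map_zero, LinearMap.zero_apply]
    · simp only [MulOpposite.op_add, map_add, LinearMap.add_apply, hx, hy]

/-- The homomorphism `φ ⊗_B ψ`. -/
def boxMap (φ : M ⟶ M₁) (ψ : N ⟶ N₁) : M.box N ⟶ M₁.box N₁ :=
  boxHom (blift ((btmul M₁ N₁).compl₁₂ φ.toLin ψ.toLin) (fun e m n => by
      change btmul M₁ N₁ (φ.toLin _) (ψ.toLin _) = btmul M₁ N₁ (φ.toLin _) (ψ.toLin _)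
      rw [φ.map_ract, ψ.map_lact, btmul_bal]))
    (fun d e m n => congrArg₂ (fun x y => btmul M₁ N₁ x y) (φ.map_lact d m) (ψ.map_lact e n))
    (fun d e m n => congrArg₂ (fun x y => btmul M₁ N₁ x y)
      (φ.map_ract (op d) m) (ψ.map_ract (op e) n))

lemma boxMap_btmul (φ : M ⟶ M₁) (ψ : N ⟶ N₁) (m : M.carrier) (n : N.carrier) :
    (boxMap φ ψ).toLin (btmul M N m n) = btmul M₁ N₁ (φ.toLin m) (ψ.toLin n) := rfl

/-- The identity map of `D ⊗_B E`, from the tensor product of the regular bimodules to the regular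
bimodule. -/
def boxIdHom (D : CentralAlg A B) (E : CentralAlg B C) :
    (regular D).box (regular E) ⟶ regular (D.tensor E) :=
  boxHom (M := regular D) (N := regular E) (Q := regular (D.tensor E))
    (blift (M := regular D) (N := regular E) (CentralAlg.tmul D E)
      (fun b d e => CentralAlg.tmul_bal D E b d e))
    (fun _ _ _ _ => rfl) (fun _ _ _ _ => rfl)

lemma boxIdHom_btmul (d : D) (e : E) : (boxIdHom D E).toLin
    (btmul (regular D) (regular E) (reg d) (reg e)) = reg (CentralAlg.pure d e) := rfl

/-- The inverse of `boxIdHom`. -/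
def boxIdInv (D : CentralAlg A B) (E : CentralAlg B C) :
    (regular (D.tensor E)).carrier →ₗ[k] ((regular D).box (regular E)).carrier :=
  BTensor.lift (btmul (regular D) (regular E))
    (fun b d e => btmul_bal (M := regular D) (N := regular E) b d e)

lemma boxIdInv_boxIdHom (t : ((regular D).box (regular E)).carrier) :
    boxIdInv D E ((boxIdHom D E).toLin t) = t :=
  LinearMap.congr_fun
    (blin_ext (M := regular D) (N := regular E) (f := boxIdInv D E ∘ₗ (boxIdHom D E).toLin)
      (g := LinearMap.id) (fun _ _ => rfl)) t

lemma boxIdHom_boxIdInv (t : (regular (D.tensor E)).carrier) :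
    (boxIdHom D E).toLin (boxIdInv D E t) = t :=
  LinearMap.congr_fun
    (BTensor.hom_ext (r := D.actB) (l := E.actB') (f := (boxIdHom D E).toLin ∘ₗ boxIdInv D E)
      (g := LinearMap.id) (fun _ _ => rfl)) t

/-- A bijective bimodule homomorphism is an isomorphism. -/
def isoOfInv {D E : CentralAlg A B} {M N : CompatBimod D E} (f : M ⟶ N)
    (g : N.carrier →ₗ[k] M.carrier) (h : ∀ x, g (f.toLin x) = x)
    (h' : ∀ x, f.toLin (g x) = x) : M ≅ N :=
  mkIso f
    ⟨g, fun d n => by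
        conv_lhs => rw [← h' n, ← f.map_lact, h],
      fun d n => by
        conv_lhs => rw [← h' n, ← f.map_ract, h]⟩ h h'

/-- The identity map of `D ⊗_B E`, as an isomorphism from the tensor product of the regular
bimodules to the regular bimodule. -/
def boxId (D : CentralAlg A B) (E : CentralAlg B C) :
    (regular D).box (regular E) ≅ regular (D.tensor E) :=
  isoOfInv (boxIdHom D E) (boxIdInv D E) boxIdInv_boxIdHom boxIdHom_boxIdInv

section interchange

variable (M : CompatBimod D D') (M' : CompatBimod D' D'') (N : CompatBimod E E')
  (N' : CompatBimod E' E'')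

lemma ract_pure_one (d : D') (m : M.carrier) (n : N.carrier) :
    (M.box N).ract (op (CentralAlg.pure d 1)) (btmul M N m n) =
      btmul M N (M.ract (op d) m) n := by
  rw [ract_btmul, op_one, map_one]; rfl

lemma ract_one_pure (e : E') (m : M.carrier) (n : N.carrier) :
    (M.box N).ract (op (CentralAlg.pure 1 e)) (btmul M N m n) =
      btmul M N m (N.ract (op e) n) := by
  rw [ract_btmul, op_one, map_one]; rfl

lemma lact_pure_one (d : D) (m : M.carrier) (n : N.carrier) :
    (M.box N).lact (CentralAlg.pure d 1) (btmul M N m n) = btmul M N (M.lact d m) n := by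
  rw [lact_btmul, map_one]; rfl

lemma lact_one_pure (e : E) (m : M.carrier) (n : N.carrier) :
    (M.box N).lact (CentralAlg.pure 1 e) (btmul M N m n) = btmul M N m (N.lact e n) := by
  rw [lact_btmul, map_one]; rfl

/-- `n ⊗ n' ↦ (m ⊗ n) ⊗ (m' ⊗ n')`. -/
def interAux (m : M.carrier) (m' : M'.carrier) :
    (N.tensor N').carrier →ₗ[k] ((M.box N).tensor (M'.box N')).carrier :=
  lift ((tmul (M.box N) (M'.box N')).compl₁₂ (btmul M N m) (btmul M' N' m'))
    (fun e n n' => by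
      change tmul (M.box N) (M'.box N') (btmul M N m _) (btmul M' N' m' _) =
        tmul (M.box N) (M'.box N') (btmul M N m _) (btmul M' N' m' _)
      rw [← ract_one_pure, tmul_bal, lact_one_pure])

lemma interAux_tmul (m : M.carrier) (m' : M'.carrier) (n : N.carrier) (n' : N'.carrier) :
    interAux M M' N N' m m' (tmul N N' n n') =
      tmul (M.box N) (M'.box N') (btmul M N m n) (btmul M' N' m' n') := rfl

/-- `m ⊗ m' ↦ (n ⊗ n' ↦ (m ⊗ n) ⊗ (m' ⊗ n'))`. -/
def interAux₂ : (M.tensor M').carrier →ₗ[k]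
    (N.tensor N').carrier →ₗ[k] ((M.box N).tensor (M'.box N')).carrier :=
  lift
    (LinearMap.mk₂ k (interAux M M' N N')
      (fun m₁ m₂ m' => lin_ext fun n n' => by
        simp only [LinearMap.add_apply, interAux_tmul, map_add])
      (fun c m m' => lin_ext fun n n' => by
        simp only [LinearMap.smul_apply, interAux_tmul, map_smul])
      (fun m m₁ m₂ => lin_ext fun n n' => by
        simp only [LinearMap.add_apply, interAux_tmul, map_add])
      (fun c m m' => lin_ext fun n n' => by
        simp only [LinearMap.smul_apply, interAux_tmul, map_smul]))
    (fun d m m' => lin_ext fun n n' => by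
      change interAux M M' N N' _ _ _ = interAux M M' N N' _ _ _
      rw [interAux_tmul, interAux_tmul, ← ract_pure_one, tmul_bal, lact_pure_one])

/-- The bimodule homomorphism `(m ⊗ m') ⊗ (n ⊗ n') ↦ (m ⊗ n) ⊗ (m' ⊗ n')`. -/
def interHom : (M.tensor M').box (N.tensor N') ⟶ (M.box N).tensor (M'.box N') :=
  boxHom
    (blift (interAux₂ M M' N N') (fun b s t => by
      induction s using tensor_induction with
      | h0 => simp only [map_zero, LinearMap.zero_apply]
      | h2 x y hx hy => simp only [map_add, LinearMap.add_apply, hx, hy]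
      | h1 m m' =>
      induction t using tensor_induction with
      | h0 => simp only [map_zero]
      | h2 x y hx hy => simp only [map_add, hx, hy]
      | h1 n n' =>
      change tmul _ _ (btmul M N m n) (btmul M' N' (M'.ract (op (D''.right b)) m') n') =
        tmul _ _ (btmul M N m (N.lact (E.left b) n)) (btmul M' N' m' n')
      rw [← btmul_bal (M := M), ← ract_pure_one M N, tmul_bal, lact_pure_one, M'.compat_right]))
    (fun d e s t => by
      induction s using tensor_induction with
      | h0 => simp only [map_zero, LinearMap.zero_apply]
      | h2 x y hx hy => simp only [map_add, LinearMap.add_apply, hx, hy]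
      | h1 m m' =>
      induction t using tensor_induction with
      | h0 => simp only [map_zero]
      | h2 x y hx hy => simp only [map_add, hx, hy]
      | h1 n n' => rfl)
    (fun d e s t => by
      induction s using tensor_induction with
      | h0 => simp only [map_zero, LinearMap.zero_apply]
      | h2 x y hx hy => simp only [map_add, LinearMap.add_apply, hx, hy]
      | h1 m m' =>
      induction t using tensor_induction with
      | h0 => simp only [map_zero]
      | h2 x y hx hy => simp only [map_add, hx, hy]
      | h1 n n' => rfl)

lemma interHom_apply (m : M.carrier) (m' : M'.carrier) (n : N.carrier) (n' : N'.carrier) :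
    (interHom M M' N N').toLin (btmul _ _ (tmul M M' m m') (tmul N N' n n')) =
      tmul (M.box N) (M'.box N') (btmul M N m n) (btmul M' N' m' n') := rfl

/-- `m' ⊗ n' ↦ (m ⊗ m') ⊗ (n ⊗ n')`. -/
def interInvAux (m : M.carrier) (n : N.carrier) :
    (M'.box N').carrier →ₗ[k] ((M.tensor M').box (N.tensor N')).carrier :=
  blift ((btmul (M.tensor M') (N.tensor N')).compl₁₂ (tmul M M' m) (tmul N N' n))
    (fun b m' n' => by
      change btmul (M.tensor M') (N.tensor N') (tmul M M' m _) (tmul N N' n _) =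
        btmul (M.tensor M') (N.tensor N') (tmul M M' m _) (tmul N N' n _)
      rw [← ract_tmul, btmul_bal, lact_tmul, ← tmul_bal, N.compat_left])

lemma interInvAux_btmul (m : M.carrier) (m' : M'.carrier) (n : N.carrier) (n' : N'.carrier) :
    interInvAux M M' N N' m n (btmul M' N' m' n') =
      btmul (M.tensor M') (N.tensor N') (tmul M M' m m') (tmul N N' n n') := rfl

/-- `m ⊗ n ↦ (m' ⊗ n' ↦ (m ⊗ m') ⊗ (n ⊗ n'))`. -/
def interInvAux₂ : (M.box N).carrier →ₗ[k]
    (M'.box N').carrier →ₗ[k] ((M.tensor M').box (N.tensor N')).carrier :=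
  blift
    (LinearMap.mk₂ k (interInvAux M M' N N')
      (fun m₁ m₂ m' => blin_ext fun n n' => by
        simp only [LinearMap.add_apply, interInvAux_btmul, map_add])
      (fun c m m' => blin_ext fun n n' => by
        simp only [LinearMap.smul_apply, interInvAux_btmul, map_smul])
      (fun m m₁ m₂ => blin_ext fun n n' => by
        simp only [LinearMap.add_apply, interInvAux_btmul, map_add])
      (fun c m m' => blin_ext fun n n' => by
        simp only [LinearMap.smul_apply, interInvAux_btmul, map_smul]))
    (fun b m n => blin_ext fun m' n' => by
      change interInvAux M M' N N' _ _ _ = interInvAux M M' N N' _ _ _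
      rw [interInvAux_btmul, interInvAux_btmul, tmul_bal, M'.compat_right, ← ract_tmul, btmul_bal,
        lact_tmul])

/-- The linear map `(m ⊗ n) ⊗ (m' ⊗ n') ↦ (m ⊗ m') ⊗ (n ⊗ n')`. -/
def interInv : ((M.box N).tensor (M'.box N')).carrier →ₗ[k]
    ((M.tensor M').box (N.tensor N')).carrier :=
  lift (interInvAux₂ M M' N N') (fun x s t => by
      induction s using box_induction with
      | h0 => simp only [map_zero, LinearMap.zero_apply]
      | h2 x y hx hy => simp only [map_add, LinearMap.add_apply, hx, hy]
      | h1 m n =>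
      induction t using box_induction with
      | h0 => simp only [map_zero]
      | h2 x y hx hy => simp only [map_add, hx, hy]
      | h1 m' n' =>
      refine CentralAlg.alg_induction (P := fun x =>
        interInvAux₂ M M' N N' ((M.box N).ract (op x) (btmul M N m n)) (btmul M' N' m' n') =
        interInvAux₂ M M' N N' (btmul M N m n) ((M'.box N').lact x (btmul M' N' m' n'))) x
        ?_ (fun d e => ?_) (fun x y hx hy => ?_)
      · simp only [MulOpposite.op_zero, map_zero, LinearMap.zero_apply]
      · change btmul _ _ (tmul M M' (M.ract (op d) m) m') (tmul N N' (N.ract (op e) n) n') =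
          btmul _ _ (tmul M M' m (M'.lact d m')) (tmul N N' n (N'.lact e n'))
        rw [tmul_bal, tmul_bal]
      · simp only [MulOpposite.op_add, map_add, LinearMap.add_apply, hx, hy])

/-- The isomorphism `(m ⊗ m') ⊗ (n ⊗ n') ↦ (m ⊗ n) ⊗ (m' ⊗ n')`, where the tensor products on the
left are over `D'`, `B`, `E'` and those on the right are over `B`, `D' ⊗_B E'`, `B`. -/
def interchange : (M.tensor M').box (N.tensor N') ≅ (M.box N).tensor (M'.box N') :=
  isoOfInv (interHom M M' N N') (interInv M M' N N')
    (fun x => by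
      induction x using box_induction with
      | h0 => simp only [map_zero]
      | h2 x y hx hy => simp only [map_add, hx, hy]
      | h1 s t =>
      induction s using tensor_induction with
      | h0 => simp only [map_zero, LinearMap.zero_apply]
      | h2 x y hx hy => simp only [map_add, LinearMap.add_apply, hx, hy]
      | h1 m m' =>
      induction t using tensor_induction with
      | h0 => simp only [map_zero]
      | h2 x y hx hy => simp only [map_add, hx, hy]
      | h1 n n' => rfl)
    (fun x => by
      induction x using tensor_induction with
      | h0 => simp only [map_zero]
      | h2 x y hx hy => simp only [map_add, hx, hy]
      | h1 s t =>
      induction s using box_induction with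
      | h0 => simp only [map_zero, LinearMap.zero_apply]
      | h2 x y hx hy => simp only [map_add, LinearMap.add_apply, hx, hy]
      | h1 m m' =>
      induction t using box_induction with
      | h0 => simp only [map_zero]
      | h2 x y hx hy => simp only [map_add, hx, hy]
      | h1 n n' => rfl)

lemma interchange_hom_apply (m : M.carrier) (m' : M'.carrier) (n : N.carrier) (n' : N'.carrier) :
    (interchange M M' N N').hom.toLin (btmul _ _ (tmul M M' m m') (tmul N N' n n')) =
      tmul (M.box N) (M'.box N') (btmul M N m n) (btmul M' N' m' n') := rfl

variable {M M' N N'} in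
lemma boxTensor_ext {Q : CompatBimod (D.tensor E) (D''.tensor E'')}
    {f g : (M.tensor M').box (N.tensor N') ⟶ Q}
    (h : ∀ (m : M.carrier) (m' : M'.carrier) (n : N.carrier) (n' : N'.carrier),
      f.toLin (btmul (M.tensor M') (N.tensor N') (tmul M M' m m') (tmul N N' n n')) =
        g.toLin (btmul (M.tensor M') (N.tensor N') (tmul M M' m m') (tmul N N' n n'))) :
    f = g :=
  box_ext fun s t => by
    induction s using tensor_induction with
    | h0 => simp only [map_zero, LinearMap.zero_apply]
    | h2 x y hx hy => simp only [map_add, LinearMap.add_apply, hx, hy]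
    | h1 m m' =>
    induction t using tensor_induction with
    | h0 => simp only [map_zero]
    | h2 x y hx hy => simp only [map_add, hx, hy]
    | h1 n n' => exact h m m' n n'

end interchange

end

end CompatBimod

open CompatBimod in
/-- The composition functor `⊗_B : T(A, B) × T(B, C) → T(A, C)`. -/
def tensorFunctor (A B C : CommAlgCat.{v} k) :
    CentralAlg A B × CentralAlg B C ⥤ᵖ CentralAlg A C where
  obj X := X.1.tensor X.2
  map f := CompatBimod.box f.1 f.2
  map₂ η := boxMap η.1 η.2
  map₂_id _ := box_ext fun _ _ => rfl
  map₂_comp _ _ := box_ext fun _ _ => rfl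
  mapId X := boxId X.1 X.2
  mapComp f g := interchange f.1 g.1 f.2 g.2
  map₂_whisker_left f g h η := by
    rw [← Category.assoc, Iso.eq_comp_inv]
    exact boxTensor_ext fun _ _ _ _ => rfl
  map₂_whisker_right η h := by
    rw [← Category.assoc, Iso.eq_comp_inv]
    exact boxTensor_ext fun _ _ _ _ => rfl
  map₂_associator f g h := by
    refine boxTensor_ext (M := f.1.tensor g.1) (M' := h.1) (N := f.2.tensor g.2) (N' := h.2)
      fun s m t n => ?_
    induction s using tensor_induction with
    | h0 => simp only [map_zero, LinearMap.zero_apply]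
    | h2 x y hx hy => simp only [map_add, LinearMap.add_apply, hx, hy]
    | h1 m m' =>
    induction t using tensor_induction with
    | h0 => simp only [map_zero, LinearMap.zero_apply]
    | h2 x y hx hy => simp only [map_add, LinearMap.add_apply, hx, hy]
    | h1 n n' => rfl
  map₂_left_unitor f := boxTensor_ext fun d m e n => (lact_btmul (M := f.1) (N := f.2) d e m n).symm
  map₂_right_unitor f := boxTensor_ext fun m d n e =>
    (ract_btmul (M := f.1) (N := f.2) d e m n).symm

end Composition

/-! ### Tricategories -/

section Tricategories

universe w₁ w₂ w₃ w₄

open scoped Pseudofunctor.StrongTrans CategoryTheory.Prod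

section Generalities

variable {B : Type*} [Bicategory B] {C : Type*} [Bicategory C] {D : Type*} [Bicategory D]

/-- The unit bicategory, with one object, one 1-cell and one 2-cell. -/
abbrev UnitBicat : Type := LocallyDiscrete (Discrete PUnit.{1})

/-- The object of the unit bicategory. -/
abbrev UnitBicat.pt : UnitBicat := ⟨⟨PUnit.unit⟩⟩

/-- The constant pseudofunctor at an object, with identity 1-cells and 2-cells as values. -/
def constFunctor (B : Type*) [Bicategory B] (c : C) : B ⥤ᵖ C where
  obj _ := c
  map _ := 𝟙 c
  map₂ _ := 𝟙 _
  mapId _ := Iso.refl _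
  mapComp _ _ := (λ_ (𝟙 c)).symm
  map₂_whisker_left _ _ _ _ := by simp
  map₂_whisker_right _ _ := by simp
  map₂_associator _ _ _ := by simp
  map₂_left_unitor _ := by simp
  map₂_right_unitor _ := by simp

/-- The pseudofunctor `(F, G) : B → C × D`. -/
def pairFunctor (F : B ⥤ᵖ C) (G : B ⥤ᵖ D) : B ⥤ᵖ C × D where
  obj b := (F.obj b, G.obj b)
  map f := F.map f ×ₘ G.map f
  map₂ η := F.map₂ η ×ₘ G.map₂ η
  map₂_id _ := Prod.ext (F.map₂_id _) (G.map₂_id _)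
  map₂_comp _ _ := Prod.ext (F.map₂_comp _ _) (G.map₂_comp _ _)
  mapId b := Iso.prod (F.mapId b) (G.mapId b)
  mapComp f g := Iso.prod (F.mapComp f g) (G.mapComp f g)
  map₂_whisker_left _ _ _ _ := Prod.ext (F.map₂_whisker_left _ _) (G.map₂_whisker_left _ _)
  map₂_whisker_right _ _ := Prod.ext (F.map₂_whisker_right _ _) (G.map₂_whisker_right _ _)
  map₂_associator _ _ _ := Prod.ext (F.map₂_associator _ _ _) (G.map₂_associator _ _ _)
  map₂_left_unitor _ := Prod.ext (F.map₂_left_unitor _) (G.map₂_left_unitor _)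
  map₂_right_unitor _ := Prod.ext (F.map₂_right_unitor _) (G.map₂_right_unitor _)

/-- The first projection. -/
def fstFunctor (B C : Type*) [Bicategory B] [Bicategory C] : B × C ⥤ᵖ B :=
  (Bicategory.Prod.fst B C).toPseudofunctor

/-- The second projection. -/
def sndFunctor (B C : Type*) [Bicategory B] [Bicategory C] : B × C ⥤ᵖ C :=
  (Bicategory.Prod.snd B C).toPseudofunctor

/-- The square filled by the unitors with identities on two sides. -/
def sqId {x x' : B} (u : x ⟶ x') : u ≫ 𝟙 x' ≅ 𝟙 x ≫ u := ρ_ u ≪≫ (λ_ u).symm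

/-- The pasting of two squares. -/
def sqPaste {x y z x' y' z' : B} {p : x ⟶ y} {q : y ⟶ z} {p' : x' ⟶ y'} {q' : y' ⟶ z'}
    {u : x ⟶ x'} {v : y ⟶ y'} {w : z ⟶ z'} (σ : u ≫ p' ≅ p ≫ v) (τ : v ≫ q' ≅ q ≫ w) :
    u ≫ p' ≫ q' ≅ (p ≫ q) ≫ w :=
  (α_ _ _ _).symm ≪≫ whiskerRightIso σ q' ≪≫ α_ _ _ _ ≪≫ whiskerLeftIso p τ ≪≫ (α_ _ _ _).symm

/-- The image of a pair of squares under a pseudofunctor of two variables. -/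
def sqMap (F : B × C ⥤ᵖ D) {x y x' y' : B} {p : x ⟶ y} {p' : x' ⟶ y'} {u : x ⟶ x'} {v : y ⟶ y'}
    {z t z' t' : C} {q : z ⟶ t} {q' : z' ⟶ t'} {r : z ⟶ z'} {s : t ⟶ t'}
    (σ : u ≫ p' ≅ p ≫ v) (τ : r ≫ q' ≅ q ≫ s) :
    F.map (u ×ₘ r) ≫ F.map (p' ×ₘ q') ≅ F.map (p ×ₘ q) ≫ F.map (v ×ₘ s) :=
  (F.mapComp (u ×ₘ r) (p' ×ₘ q')).symm ≪≫ F.map₂Iso (Iso.prod σ τ) ≪≫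
    F.mapComp (p ×ₘ q) (v ×ₘ s)

end Generalities

/-- The objects, hom bicategories, composition functors and unit functors of a tricategory.
As everywhere here, composition is written in diagrammatic order: the composite of `f` in
`Hom a b` and `g` in `Hom b c` is `comp.obj (f, g)`. -/
structure TricategoryBase (Obj : Type w₁) where
  Hom : Obj → Obj → Type w₂
  [bicategory : ∀ a b, Bicategory.{w₄, w₃} (Hom a b)]
  comp : ∀ a b c, Hom a b × Hom b c ⥤ᵖ Hom a c
  unit : ∀ a, UnitBicat ⥤ᵖ Hom a a

namespace TricategoryBase

attribute [instance] bicategory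

variable {Obj : Type w₁} (X : TricategoryBase.{w₁, w₂, w₃, w₄} Obj) {a b c d e : Obj}

/-- The functor `⊗ ∘ (⊗ × 1)`. -/
def assocL (a b c d : Obj) : (X.Hom a b × X.Hom b c) × X.Hom c d ⥤ᵖ X.Hom a d :=
  (pairFunctor ((fstFunctor _ _).comp (X.comp a b c)) (sndFunctor _ _)).comp (X.comp a c d)

/-- The functor `⊗ ∘ (1 × ⊗)`. -/
def assocR (a b c d : Obj) : (X.Hom a b × X.Hom b c) × X.Hom c d ⥤ᵖ X.Hom a d :=
  (pairFunctor ((fstFunctor _ _).comp (fstFunctor _ _))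
    ((pairFunctor ((fstFunctor _ _).comp (sndFunctor _ _)) (sndFunctor _ _)).comp
      (X.comp b c d))).comp (X.comp a b d)

/-- The functor `⊗ ∘ (I × 1)`. -/
def unitL (a b : Obj) : X.Hom a b ⥤ᵖ X.Hom a b :=
  (pairFunctor ((constFunctor _ UnitBicat.pt).comp (X.unit a)) (Pseudofunctor.id _)).comp
    (X.comp a a b)

/-- The functor `⊗ ∘ (1 × I)`. -/
def unitR (a b : Obj) : X.Hom a b ⥤ᵖ X.Hom a b :=
  (pairFunctor (Pseudofunctor.id _) ((constFunctor _ UnitBicat.pt).comp (X.unit b))).comp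
    (X.comp a b b)

/-- The composite `f ⊗ g` of 1-cells of the tricategory. -/
abbrev ten₀ (f : X.Hom a b) (g : X.Hom b c) : X.Hom a c := (X.comp a b c).obj (f, g)

/-- The composite `u ⊗ v` of 2-cells of the tricategory. -/
abbrev ten₁ {f f' : X.Hom a b} {g g' : X.Hom b c} (u : f ⟶ f') (v : g ⟶ g') :
    X.ten₀ f g ⟶ X.ten₀ f' g' := (X.comp a b c).map (u ×ₘ v)

/-- The composite `θ ⊗ κ` of 3-cells of the tricategory. -/
abbrev ten₂ {f f' : X.Hom a b} {g g' : X.Hom b c} {u u' : f ⟶ f'} {v v' : g ⟶ g'} (θ : u ⟶ u')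
    (κ : v ⟶ v') : X.ten₁ u v ⟶ X.ten₁ u' v' := (X.comp a b c).map₂ (θ ×ₘ κ)

/-- The composite of invertible 3-cells. -/
abbrev tenIso {f f' : X.Hom a b} {g g' : X.Hom b c} {u u' : f ⟶ f'} {v v' : g ⟶ g'} (θ : u ≅ u')
    (κ : v ≅ v') : X.ten₁ u v ≅ X.ten₁ u' v' := (X.comp a b c).map₂Iso (Iso.prod θ κ)

/-- The constraint `1 ⊗ 1 ≅ 1` of the composition functor. -/
abbrev tenId (f : X.Hom a b) (g : X.Hom b c) : X.ten₁ (𝟙 f) (𝟙 g) ≅ 𝟙 (X.ten₀ f g) :=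
  (X.comp a b c).mapId (f, g)

/-- The unit 1-cell of an object. -/
abbrev I (a : Obj) : X.Hom a a := (X.unit a).obj UnitBicat.pt

/-- The value of the unit functor at the 1-cell of the unit bicategory. -/
abbrev ι (a : Obj) : X.I a ⟶ X.I a := (X.unit a).map (𝟙 UnitBicat.pt)

/-- `(u u') ⊗ 1 ≅ (u ⊗ 1) (u' ⊗ 1)`. -/
def tenR₂ {f f' f'' : X.Hom a b} (u : f ⟶ f') (u' : f' ⟶ f'') (g : X.Hom b c) :
    X.ten₁ (u ≫ u') (𝟙 g) ≅ X.ten₁ u (𝟙 g) ≫ X.ten₁ u' (𝟙 g) :=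
  X.tenIso (Iso.refl _) (λ_ (𝟙 g)).symm ≪≫ (X.comp a b c).mapComp (u ×ₘ 𝟙 g) (u' ×ₘ 𝟙 g)

/-- `1 ⊗ (v v') ≅ (1 ⊗ v) (1 ⊗ v')`. -/
def tenL₂ (f : X.Hom a b) {g g' g'' : X.Hom b c} (v : g ⟶ g') (v' : g' ⟶ g'') :
    X.ten₁ (𝟙 f) (v ≫ v') ≅ X.ten₁ (𝟙 f) v ≫ X.ten₁ (𝟙 f) v' :=
  X.tenIso (λ_ (𝟙 f)).symm (Iso.refl _) ≪≫ (X.comp a b c).mapComp (𝟙 f ×ₘ v) (𝟙 f ×ₘ v')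

/-- `(u u' u'') ⊗ 1 ≅ (u ⊗ 1) (u' ⊗ 1) (u'' ⊗ 1)`. -/
def tenR₃ {f f' f'' f''' : X.Hom a b} (u : f ⟶ f') (u' : f' ⟶ f'') (u'' : f'' ⟶ f''')
    (g : X.Hom b c) : X.ten₁ (u ≫ u' ≫ u'') (𝟙 g) ≅
      X.ten₁ u (𝟙 g) ≫ X.ten₁ u' (𝟙 g) ≫ X.ten₁ u'' (𝟙 g) :=
  X.tenR₂ u (u' ≫ u'') g ≪≫ whiskerLeftIso _ (X.tenR₂ u' u'' g)

/-- `1 ⊗ (v v' v'') ≅ (1 ⊗ v) (1 ⊗ v') (1 ⊗ v'')`. -/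
def tenL₃ (f : X.Hom a b) {g g' g'' g''' : X.Hom b c} (v : g ⟶ g') (v' : g' ⟶ g'')
    (v'' : g'' ⟶ g''') : X.ten₁ (𝟙 f) (v ≫ v' ≫ v'') ≅
      X.ten₁ (𝟙 f) v ≫ X.ten₁ (𝟙 f) v' ≫ X.ten₁ (𝟙 f) v'' :=
  X.tenL₂ f v (v' ≫ v'') ≪≫ whiskerLeftIso _ (X.tenL₂ f v' v'')

end TricategoryBase

/-- The adjoint equivalences of a tricategory.  An equivalence in a bicategory comes with an adjoint
inverse, a unit and a counit; here the bicategories are those of pseudofunctors, strong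
transformations and modifications. -/
structure TricategoryEquivs {Obj : Type w₁} (X : TricategoryBase.{w₁, w₂, w₃, w₄} Obj) where
  assoc : ∀ a b c d, X.assocL a b c d ≌ X.assocR a b c d
  lUnitor : ∀ a b, X.unitL a b ≌ Pseudofunctor.id (X.Hom a b)
  rUnitor : ∀ a b, X.unitR a b ≌ Pseudofunctor.id (X.Hom a b)

namespace TricategoryEquivs

variable {Obj : Type w₁} {X : TricategoryBase.{w₁, w₂, w₃, w₄} Obj} (T : TricategoryEquivs X)
  {a b c d e : Obj}

/-- The associator `a : (f ⊗ g) ⊗ h → f ⊗ (g ⊗ h)`. -/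
abbrev as (f : X.Hom a b) (g : X.Hom b c) (h : X.Hom c d) :
    X.ten₀ (X.ten₀ f g) h ⟶ X.ten₀ f (X.ten₀ g h) := (T.assoc a b c d).hom.app ((f, g), h)

/-- The adjoint inverse `a* : f ⊗ (g ⊗ h) → (f ⊗ g) ⊗ h`. -/
abbrev as' (f : X.Hom a b) (g : X.Hom b c) (h : X.Hom c d) :
    X.ten₀ f (X.ten₀ g h) ⟶ X.ten₀ (X.ten₀ f g) h := (T.assoc a b c d).inv.app ((f, g), h)

/-- The left unitor `l : I ⊗ f → f`. -/
abbrev lu (f : X.Hom a b) : X.ten₀ (X.I a) f ⟶ f := (T.lUnitor a b).hom.app f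

/-- The adjoint inverse `l* : f → I ⊗ f`. -/
abbrev lu' (f : X.Hom a b) : f ⟶ X.ten₀ (X.I a) f := (T.lUnitor a b).inv.app f

/-- The right unitor `r : f ⊗ I → f`. -/
abbrev ru (f : X.Hom a b) : X.ten₀ f (X.I b) ⟶ f := (T.rUnitor a b).hom.app f

/-- The adjoint inverse `r* : f → f ⊗ I`. -/
abbrev ru' (f : X.Hom a b) : f ⟶ X.ten₀ f (X.I b) := (T.rUnitor a b).inv.app f

variable {f f' : X.Hom a b} {g g' : X.Hom b c} {h h' : X.Hom c d}

/-- The naturality constraint of `a`. -/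
abbrev asNat (u : f ⟶ f') (v : g ⟶ g') (w : h ⟶ h') :
    X.ten₁ (X.ten₁ u v) w ≫ T.as f' g' h' ≅ T.as f g h ≫ X.ten₁ u (X.ten₁ v w) :=
  (T.assoc a b c d).hom.naturality ((u ×ₘ v) ×ₘ w)

/-- The naturality constraint of `a*`. -/
abbrev asNat' (u : f ⟶ f') (v : g ⟶ g') (w : h ⟶ h') :
    X.ten₁ u (X.ten₁ v w) ≫ T.as' f' g' h' ≅ T.as' f g h ≫ X.ten₁ (X.ten₁ u v) w :=
  (T.assoc a b c d).inv.naturality ((u ×ₘ v) ×ₘ w)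

/-- The naturality constraint of `l`. -/
abbrev luNat (u : f ⟶ f') : X.ten₁ (X.ι a) u ≫ T.lu f' ≅ T.lu f ≫ u :=
  (T.lUnitor a b).hom.naturality u

/-- The naturality constraint of `l*`. -/
abbrev luNat' (u : f ⟶ f') : u ≫ T.lu' f' ≅ T.lu' f ≫ X.ten₁ (X.ι a) u :=
  (T.lUnitor a b).inv.naturality u

/-- The naturality constraint of `r`. -/
abbrev ruNat (u : f ⟶ f') : X.ten₁ u (X.ι b) ≫ T.ru f' ≅ T.ru f ≫ u :=
  (T.rUnitor a b).hom.naturality u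

/-- The naturality constraint of `r*`. -/
abbrev ruNat' (u : f ⟶ f') : u ≫ T.ru' f' ≅ T.ru' f ≫ X.ten₁ u (X.ι b) :=
  (T.rUnitor a b).inv.naturality u

/-- The component `1 ≅ a a*` of the unit of the adjoint equivalence. -/
abbrev asUnit (f : X.Hom a b) (g : X.Hom b c) (h : X.Hom c d) :
    𝟙 (X.ten₀ (X.ten₀ f g) h) ⟶ T.as f g h ≫ T.as' f g h :=
  (T.assoc a b c d).unit.hom.as.app ((f, g), h)

/-- The component `a* a ≅ 1` of the counit of the adjoint equivalence. -/
abbrev asCounit (f : X.Hom a b) (g : X.Hom b c) (h : X.Hom c d) :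
    T.as' f g h ≫ T.as f g h ⟶ 𝟙 (X.ten₀ f (X.ten₀ g h)) :=
  (T.assoc a b c d).counit.hom.as.app ((f, g), h)

/-- The component `1 ≅ l l*` of the unit of the adjoint equivalence. -/
abbrev luUnit (f : X.Hom a b) : 𝟙 (X.ten₀ (X.I a) f) ⟶ T.lu f ≫ T.lu' f :=
  (T.lUnitor a b).unit.hom.as.app f

/-- The component `l* l ≅ 1` of the counit of the adjoint equivalence. -/
abbrev luCounit (f : X.Hom a b) : T.lu' f ≫ T.lu f ⟶ 𝟙 f :=
  (T.lUnitor a b).counit.hom.as.app f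

/-- The component `1 ≅ r r*` of the unit of the adjoint equivalence. -/
abbrev ruUnit (f : X.Hom a b) : 𝟙 (X.ten₀ f (X.I b)) ⟶ T.ru f ≫ T.ru' f :=
  (T.rUnitor a b).unit.hom.as.app f

/-- The component `r* r ≅ 1` of the counit of the adjoint equivalence. -/
abbrev ruCounit (f : X.Hom a b) : T.ru' f ≫ T.ru f ⟶ 𝟙 f :=
  (T.rUnitor a b).counit.hom.as.app f

/-- The naturality constraint of `a` in the first variable. -/
def asNat₁ (u : f ⟶ f') (g : X.Hom b c) (h : X.Hom c d) :
    X.ten₁ (X.ten₁ u (𝟙 g)) (𝟙 h) ≫ T.as f' g h ≅ T.as f g h ≫ X.ten₁ u (𝟙 (X.ten₀ g h)) :=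
  T.asNat u (𝟙 g) (𝟙 h) ≪≫ whiskerLeftIso _ (X.tenIso (Iso.refl u) (X.tenId g h))

/-- The naturality constraint of `a` in the second variable. -/
def asNat₂ (f : X.Hom a b) (v : g ⟶ g') (h : X.Hom c d) :
    X.ten₁ (X.ten₁ (𝟙 f) v) (𝟙 h) ≫ T.as f g' h ≅ T.as f g h ≫ X.ten₁ (𝟙 f) (X.ten₁ v (𝟙 h)) :=
  T.asNat (𝟙 f) v (𝟙 h)

/-- The naturality constraint of `a` in the third variable. -/
def asNat₃ (f : X.Hom a b) (g : X.Hom b c) (w : h ⟶ h') :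
    X.ten₁ (𝟙 (X.ten₀ f g)) w ≫ T.as f g h' ≅ T.as f g h ≫ X.ten₁ (𝟙 f) (X.ten₁ (𝟙 g) w) :=
  whiskerRightIso (X.tenIso (X.tenId f g).symm (Iso.refl w)) _ ≪≫ T.asNat (𝟙 f) (𝟙 g) w

end TricategoryEquivs

/-- The four families of invertible modifications of a tricategory, given by their components and the
modification axiom. -/
structure TricategoryModifications {Obj : Type w₁} {X : TricategoryBase.{w₁, w₂, w₃, w₄} Obj}
    (T : TricategoryEquivs X) where
  /-- The pentagonator. -/
  π : ∀ {a b c d e : Obj} (f : X.Hom a b) (g : X.Hom b c) (h : X.Hom c d) (j : X.Hom d e),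
    X.ten₁ (T.as f g h) (𝟙 j) ≫ T.as f (X.ten₀ g h) j ≫
        X.ten₁ (𝟙 f) (T.as g h j) ≅
      T.as (X.ten₀ f g) h j ≫ T.as f g (X.ten₀ h j)
  π_naturality : ∀ {a b c d e : Obj} {f f' : X.Hom a b} {g g' : X.Hom b c} {h h' : X.Hom c d}
    {j j' : X.Hom d e} (u : f ⟶ f') (v : g ⟶ g') (w : h ⟶ h') (x : j ⟶ j'),
    X.ten₁ (X.ten₁ (X.ten₁ u v) w) x ◁ (π f' g' h' j').hom ≫
        (sqPaste (T.asNat (X.ten₁ u v) w x)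
          (T.asNat u v (X.ten₁ w x))).hom =
      (sqPaste (sqMap (X.comp a d e) (T.asNat u v w) (sqId x))
        (sqPaste (T.asNat u (X.ten₁ v w) x)
          (sqMap (X.comp a b e) (sqId u) (T.asNat v w x)))).hom ≫
        (π f g h j).hom ▷ X.ten₁ u (X.ten₁ v (X.ten₁ w x))
  /-- The middle unit modification. -/
  μ : ∀ {a b c : Obj} (f : X.Hom a b) (g : X.Hom b c),
    X.ten₁ (T.ru' f) (𝟙 g) ≫ T.as f (X.I b) g ≫
        X.ten₁ (𝟙 f) (T.lu g) ≅ 𝟙 (X.ten₀ f g)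
  μ_naturality : ∀ {a b c : Obj} {f f' : X.Hom a b} {g g' : X.Hom b c} (u : f ⟶ f') (v : g ⟶ g'),
    X.ten₁ u v ◁ (μ f' g').hom ≫ (sqId (X.ten₁ u v)).hom =
      (sqPaste (sqMap (X.comp a b c) (T.ruNat' u) (sqId v))
        (sqPaste (T.asNat u (X.ι b) v)
          (sqMap (X.comp a b c) (sqId u) (T.luNat v)))).hom ≫
        (μ f g).hom ▷ X.ten₁ u v
  /-- The left unit modification. -/
  lam : ∀ {a b c : Obj} (f : X.Hom a b) (g : X.Hom b c),
    X.ten₁ (T.lu f) (𝟙 g) ≅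
      T.as (X.I a) f g ≫ T.lu (X.ten₀ f g)
  lam_naturality : ∀ {a b c : Obj} {f f' : X.Hom a b} {g g' : X.Hom b c} (u : f ⟶ f') (v : g ⟶ g'),
    X.ten₁ (X.ten₁ (X.ι a) u) v ◁ (lam f' g').hom ≫
        (sqPaste (T.asNat (X.ι a) u v)
          (T.luNat (X.ten₁ u v))).hom =
      (sqMap (X.comp a b c) (T.luNat u) (sqId v)).hom ≫
        (lam f g).hom ▷ X.ten₁ u v
  /-- The right unit modification. -/
  rho : ∀ {a b c : Obj} (f : X.Hom a b) (g : X.Hom b c),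
    X.ten₁ (𝟙 f) (T.ru' g) ≅
      T.ru' (X.ten₀ f g) ≫ T.as f g (X.I c)
  rho_naturality : ∀ {a b c : Obj} {f f' : X.Hom a b} {g g' : X.Hom b c} (u : f ⟶ f') (v : g ⟶ g'),
    X.ten₁ u v ◁ (rho f' g').hom ≫
        (sqPaste (T.ruNat' (X.ten₁ u v))
          (T.asNat u v (X.ι c))).hom =
      (sqMap (X.comp a b c) (sqId u) (T.ruNat' v)).hom ≫
        (rho f g).hom ▷ X.ten₁ u (X.ten₁ v (X.ι c))

namespace TricategoryModifications

variable {Obj : Type w₁} {X : TricategoryBase.{w₁, w₂, w₃, w₄} Obj} {T : TricategoryEquivs X}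
  (P : TricategoryModifications T)

/-- The nonabelian 4-cocycle condition: the two pasted 3-cells between the two extreme composites
`(((f g) h) j) l → f (g (h (j l)))` are equal. -/
def Cocycle : Prop :=
  ∀ {a b c d e z : Obj} (f : X.Hom a b) (g : X.Hom b c) (h : X.Hom c d) (j : X.Hom d e)
  (l : X.Hom e z),
  𝟙 (X.ten₁ (X.ten₁ (T.as f g h) (𝟙 j)) (𝟙 l) ≫ X.ten₁ (T.as f (X.ten₀ g h) j) (𝟙 l) ≫
        X.ten₁ (X.ten₁ (𝟙 f) (T.as g h j)) (𝟙 l) ≫ T.as f (X.ten₀ g (X.ten₀ h j)) l ≫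
        X.ten₁ (𝟙 f) (T.as g (X.ten₀ h j) l) ≫ X.ten₁ (𝟙 f) (X.ten₁ (𝟙 g) (T.as h j l))) ⊗≫
      ((X.tenR₃ (X.ten₁ (T.as f g h) (𝟙 j)) (T.as f (X.ten₀ g h) j) (X.ten₁ (𝟙 f) (T.as g h j)) l).inv ≫
        X.ten₂ (P.π f g h j).hom (𝟙 (𝟙 l)) ≫
        (X.tenR₂ (T.as (X.ten₀ f g) h j) (T.as f g (X.ten₀ h j)) l).hom) ▷
          (T.as f (X.ten₀ g (X.ten₀ h j)) l ≫ X.ten₁ (𝟙 f) (T.as g (X.ten₀ h j) l) ≫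
            X.ten₁ (𝟙 f) (X.ten₁ (𝟙 g) (T.as h j l))) ⊗≫
      X.ten₁ (T.as (X.ten₀ f g) h j) (𝟙 l) ◁ (P.π f g (X.ten₀ h j) l).hom ▷
          X.ten₁ (𝟙 f) (X.ten₁ (𝟙 g) (T.as h j l)) ⊗≫
      X.ten₁ (T.as (X.ten₀ f g) h j) (𝟙 l) ◁ T.as (X.ten₀ f g) (X.ten₀ h j) l ◁
          (T.asNat₃ f g (T.as h j l)).inv ⊗≫
      (P.π (X.ten₀ f g) h j l).hom ▷ T.as f g (X.ten₀ h (X.ten₀ j l)) ⊗≫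
      𝟙 (T.as (X.ten₀ (X.ten₀ f g) h) j l ≫ T.as (X.ten₀ f g) h (X.ten₀ j l) ≫
        T.as f g (X.ten₀ h (X.ten₀ j l))) =
    𝟙 (X.ten₁ (X.ten₁ (T.as f g h) (𝟙 j)) (𝟙 l) ≫ X.ten₁ (T.as f (X.ten₀ g h) j) (𝟙 l) ≫
        X.ten₁ (X.ten₁ (𝟙 f) (T.as g h j)) (𝟙 l) ≫ T.as f (X.ten₀ g (X.ten₀ h j)) l ≫
        X.ten₁ (𝟙 f) (T.as g (X.ten₀ h j) l) ≫ X.ten₁ (𝟙 f) (X.ten₁ (𝟙 g) (T.as h j l))) ⊗≫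
      (X.ten₁ (X.ten₁ (T.as f g h) (𝟙 j)) (𝟙 l) ≫ X.ten₁ (T.as f (X.ten₀ g h) j) (𝟙 l)) ◁
        (T.asNat₂ f (T.as g h j) l).hom ▷
          (X.ten₁ (𝟙 f) (T.as g (X.ten₀ h j) l) ≫ X.ten₁ (𝟙 f) (X.ten₁ (𝟙 g) (T.as h j l))) ⊗≫
      (X.ten₁ (X.ten₁ (T.as f g h) (𝟙 j)) (𝟙 l) ≫ X.ten₁ (T.as f (X.ten₀ g h) j) (𝟙 l) ≫
          T.as f (X.ten₀ (X.ten₀ g h) j) l) ◁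
        ((X.tenL₃ f (X.ten₁ (T.as g h j) (𝟙 l)) (T.as g (X.ten₀ h j) l)
            (X.ten₁ (𝟙 g) (T.as h j l))).inv ≫
          X.ten₂ (𝟙 (𝟙 f)) (P.π g h j l).hom ≫
          (X.tenL₂ f (T.as (X.ten₀ g h) j l) (T.as g h (X.ten₀ j l))).hom) ⊗≫
      X.ten₁ (X.ten₁ (T.as f g h) (𝟙 j)) (𝟙 l) ◁ (P.π f (X.ten₀ g h) j l).hom ▷
        X.ten₁ (𝟙 f) (T.as g h (X.ten₀ j l)) ⊗≫
      (T.asNat₁ (T.as f g h) j l).hom ▷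
        (T.as f (X.ten₀ g h) (X.ten₀ j l) ≫ X.ten₁ (𝟙 f) (T.as g h (X.ten₀ j l))) ⊗≫
      T.as (X.ten₀ (X.ten₀ f g) h) j l ◁ (P.π f g h (X.ten₀ j l)).hom ⊗≫
      𝟙 (T.as (X.ten₀ (X.ten₀ f g) h) j l ≫ T.as (X.ten₀ f g) h (X.ten₀ j l) ≫
        T.as f g (X.ten₀ h (X.ten₀ j l)))

/-- The left normalization condition. -/
def LeftNormalization : Prop :=
  ∀ {a b c d : Obj} (f : X.Hom a b) (g : X.Hom b c) (h : X.Hom c d),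
    𝟙 (X.ten₁ (X.ten₁ (T.ru' f) (𝟙 g)) (𝟙 h) ≫ X.ten₁ (T.as f (X.I b) g) (𝟙 h) ≫
          X.ten₁ (X.ten₁ (𝟙 f) (T.lu g)) (𝟙 h) ≫ T.as f g h) ⊗≫
        ((X.tenR₃ (X.ten₁ (T.ru' f) (𝟙 g)) (T.as f (X.I b) g) (X.ten₁ (𝟙 f) (T.lu g)) h).inv ≫
          X.ten₂ (P.μ f g).hom (𝟙 (𝟙 h)) ≫ (X.tenId (X.ten₀ f g) h).hom) ▷ T.as f g h ⊗≫
        𝟙 (T.as f g h) =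
      𝟙 (X.ten₁ (X.ten₁ (T.ru' f) (𝟙 g)) (𝟙 h) ≫ X.ten₁ (T.as f (X.I b) g) (𝟙 h) ≫
          X.ten₁ (X.ten₁ (𝟙 f) (T.lu g)) (𝟙 h) ≫ T.as f g h) ⊗≫
        (X.ten₁ (X.ten₁ (T.ru' f) (𝟙 g)) (𝟙 h) ≫ X.ten₁ (T.as f (X.I b) g) (𝟙 h)) ◁
          (T.asNat₂ f (T.lu g) h).hom ⊗≫
        (X.ten₁ (X.ten₁ (T.ru' f) (𝟙 g)) (𝟙 h) ≫ X.ten₁ (T.as f (X.I b) g) (𝟙 h) ≫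
            T.as f (X.ten₀ (X.I b) g) h) ◁
          (X.ten₂ (𝟙 (𝟙 f)) (P.lam g h).hom ≫
            (X.tenL₂ f (T.as (X.I b) g h) (T.lu (X.ten₀ g h))).hom) ⊗≫
        X.ten₁ (X.ten₁ (T.ru' f) (𝟙 g)) (𝟙 h) ◁ (P.π f (X.I b) g h).hom ▷
          X.ten₁ (𝟙 f) (T.lu (X.ten₀ g h)) ⊗≫
        (T.asNat₁ (T.ru' f) g h).hom ▷
          (T.as f (X.I b) (X.ten₀ g h) ≫ X.ten₁ (𝟙 f) (T.lu (X.ten₀ g h))) ⊗≫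
        T.as f g h ◁ (P.μ f (X.ten₀ g h)).hom ⊗≫
        𝟙 (T.as f g h)

/-- The right normalization condition. -/
def RightNormalization : Prop :=
  ∀ {a b c d : Obj} (f : X.Hom a b) (g : X.Hom b c) (h : X.Hom c d),
    𝟙 (T.as f g h ≫ X.ten₁ (𝟙 f) (X.ten₁ (T.ru' g) (𝟙 h)) ≫
          X.ten₁ (𝟙 f) (T.as g (X.I c) h) ≫ X.ten₁ (𝟙 f) (X.ten₁ (𝟙 g) (T.lu h))) ⊗≫
        T.as f g h ◁
          ((X.tenL₃ f (X.ten₁ (T.ru' g) (𝟙 h)) (T.as g (X.I c) h) (X.ten₁ (𝟙 g) (T.lu h))).inv ≫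
            X.ten₂ (𝟙 (𝟙 f)) (P.μ g h).hom ≫ (X.tenId f (X.ten₀ g h)).hom) ⊗≫
        𝟙 (T.as f g h) =
      𝟙 (T.as f g h ≫ X.ten₁ (𝟙 f) (X.ten₁ (T.ru' g) (𝟙 h)) ≫
          X.ten₁ (𝟙 f) (T.as g (X.I c) h) ≫ X.ten₁ (𝟙 f) (X.ten₁ (𝟙 g) (T.lu h))) ⊗≫
        (T.asNat₂ f (T.ru' g) h).inv ▷
          (X.ten₁ (𝟙 f) (T.as g (X.I c) h) ≫ X.ten₁ (𝟙 f) (X.ten₁ (𝟙 g) (T.lu h))) ⊗≫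
        (X.ten₂ (P.rho f g).hom (𝟙 (𝟙 h)) ≫
            (X.tenR₂ (T.ru' (X.ten₀ f g)) (T.as f g (X.I c)) h).hom) ▷
          (T.as f (X.ten₀ g (X.I c)) h ≫ X.ten₁ (𝟙 f) (T.as g (X.I c) h) ≫
            X.ten₁ (𝟙 f) (X.ten₁ (𝟙 g) (T.lu h))) ⊗≫
        X.ten₁ (T.ru' (X.ten₀ f g)) (𝟙 h) ◁ (P.π f g (X.I c) h).hom ▷
          X.ten₁ (𝟙 f) (X.ten₁ (𝟙 g) (T.lu h)) ⊗≫
        (X.ten₁ (T.ru' (X.ten₀ f g)) (𝟙 h) ≫ T.as (X.ten₀ f g) (X.I c) h) ◁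
          (T.asNat₃ f g (T.lu h)).inv ⊗≫
        (P.μ (X.ten₀ f g) h).hom ▷ T.as f g h ⊗≫
        𝟙 (T.as f g h)

end TricategoryModifications

/-- A tricategory with the given objects, hom bicategories, composition functors and units: adjoint
equivalences `a`, `l`, `r` and invertible modifications `π`, `μ`, `lam`, `rho` which satisfy the
nonabelian 4-cocycle condition and the two normalization conditions. -/
structure Tricategory {Obj : Type w₁} (X : TricategoryBase.{w₁, w₂, w₃, w₄} Obj) extends
    TricategoryEquivs X where
  modifications : TricategoryModifications toTricategoryEquivs
  cocycle : TricategoryModifications.Cocycle modifications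
  left_normalization : modifications.LeftNormalization
  right_normalization : modifications.RightNormalization

end Tricategories

/-! ### The canonical bimodules `a`, `l` and `r` -/

section Canonical

variable {k : Type u} [Field k] {A B C A₁ A₂ A₃ A₄ : CommAlgCat.{v} k}

namespace CentralAlg

/-- Homomorphisms of algebras over `A ⊗ B`. -/
structure StrHom (D D' : CentralAlg A B) where
  toAlgHom : D →ₐ[k] D'
  map_str : ∀ x, toAlgHom (D.str x : D) = (D'.str x : D')

section

variable (D : CentralAlg A B) (E : CentralAlg B C)

/-- `d ↦ d ⊗ 1`, with values in the object `D ⊗_B E`. -/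
def toL : D →ₐ[k] D.tensor E := inl D E

/-- `e ↦ 1 ⊗ e`, with values in the object `D ⊗_B E`. -/
def toR : E →ₐ[k] D.tensor E := inr D E

lemma toL_apply (d : D) : toL D E d = pure d (1 : E) := rfl
lemma toR_apply (e : E) : toR D E e = pure (1 : D) e := rfl

lemma pure_mul_pure (d d' : D) (e e' : E) : pure d e * pure d' e' = pure (d * d') (e * e') := rfl

lemma toL_comm_toR (d : D) (e : E) : toL D E d * toR D E e = toR D E e * toL D E d :=
  inl_comm_inr D E d e

lemma toL_mul_toR (d : D) (e : E) : toL D E d * toR D E e = pure d e := inl_mul_inr D E d e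

lemma toL_right (b : B) : toL D E (D.right b) = toR D E (E.left b) := inl_right D E b

lemma tensor_left' (a : A) : (D.tensor E).left a = toL D E (D.left a) := tensor_left D E a

lemma tensor_right' (c : C) : (D.tensor E).right c = toR D E (E.right c) := tensor_right D E c

lemma tensor_str (a : A) (c : C) :
    ((D.tensor E).str (a ⊗ₜ c) : D.tensor E) = pure (D.left a) (E.right c) :=
  tensorStr_tmul D E a c

lemma str_tmul (a : A) (b : B) : (D.str (a ⊗ₜ b) : D) = D.left a * D.right b := by
  have h : (a ⊗ₜ[k] b : A ⊗[k] B) = (a ⊗ₜ 1) * (1 ⊗ₜ b) := by simp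
  rw [h, map_mul]
  rfl

variable {R : Type v} [Ring R] [Algebra k R] (f : D →ₐ[k] R) (g : E →ₐ[k] R)
    (hc : ∀ d e, f d * g e = g e * f d) (hb : ∀ b, f (D.right b) = g (E.left b))

/-- Algebra homomorphisms out of `D ⊗_B E`: `d ⊗ e ↦ f d * g e`. -/
def desc : D.tensor E →ₐ[k] R := liftAlg D E f g hc hb

lemma desc_pure (d : D) (e : E) : desc D E f g hc hb (pure d e) = f d * g e := rfl

lemma desc_toL (d : D) : desc D E f g hc hb (toL D E d) = f d :=
  (desc_pure D E f g hc hb d 1).trans (by rw [map_one, mul_one])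

lemma desc_toR (e : E) : desc D E f g hc hb (toR D E e) = g e :=
  (desc_pure D E f g hc hb 1 e).trans (by rw [map_one, one_mul])

/-- If the images of `f` and `g` commute with `x`, so does the image of `desc`. -/
lemma desc_comm (x : R) (hf : ∀ d, f d * x = x * f d) (hg : ∀ e, g e * x = x * g e)
    (t : D.tensor E) : desc D E f g hc hb t * x = x * desc D E f g hc hb t := by
  induction t using alg_induction with
  | h0 => rw [map_zero, zero_mul, mul_zero]
  | h2 y z hy hz => rw [map_add, add_mul, mul_add, hy, hz]
  | h1 d e => rw [desc_pure, mul_assoc, hg, ← mul_assoc, hf, mul_assoc]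

end

/-- To be a homomorphism over `A ⊗ B` it suffices to be one over `A` and over `B`. -/
def StrHom.mk' {D D' : CentralAlg A B} (f : D →ₐ[k] D') (hl : ∀ a, f (D.left a) = D'.left a)
    (hr : ∀ b, f (D.right b) = D'.right b) : StrHom D D' where
  toAlgHom := f
  map_str x := by
    induction x using TensorProduct.induction_on with
    | zero => simp only [map_zero, ZeroMemClass.coe_zero]
    | add x y hx hy => simp only [map_add, Subalgebra.coe_add, hx, hy]
    | tmul a b => rw [str_tmul, str_tmul, map_mul, hl, hr]

section

variable (D : CentralAlg A₁ A₂) (E : CentralAlg A₂ A₃) (F : CentralAlg A₃ A₄)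

/-- `e ↦ 1 ⊗ (e ⊗ 1)`. -/
def midR : E →ₐ[k] D.tensor (E.tensor F) := (toR D (E.tensor F)).comp (toL E F)

/-- `f ↦ 1 ⊗ (1 ⊗ f)`. -/
def lastR : F →ₐ[k] D.tensor (E.tensor F) := (toR D (E.tensor F)).comp (toR E F)

lemma toL_midR (d : D) (e : E) :
    toL D (E.tensor F) d * midR D E F e = midR D E F e * toL D (E.tensor F) d :=
  toL_comm_toR D (E.tensor F) d (toL E F e)

lemma right_midR (b : A₂) : toL D (E.tensor F) (D.right b) = midR D E F (E.left b) :=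
  (toL_right D (E.tensor F) b).trans (congrArg (toR D (E.tensor F)) (tensor_left' E F b))

lemma toL_lastR (d : D) (f : F) :
    toL D (E.tensor F) d * lastR D E F f = lastR D E F f * toL D (E.tensor F) d :=
  toL_comm_toR D (E.tensor F) d (toR E F f)

lemma midR_lastR (e : E) (f : F) :
    midR D E F e * lastR D E F f = lastR D E F f * midR D E F e := by
  change toR D (E.tensor F) (toL E F e) * toR D (E.tensor F) (toR E F f) =
    toR D (E.tensor F) (toR E F f) * toR D (E.tensor F) (toL E F e)
  rw [← map_mul, toL_comm_toR, map_mul]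

lemma midR_right (b : A₃) : midR D E F (E.right b) = lastR D E F (F.left b) :=
  congrArg (toR D (E.tensor F)) (toL_right E F b)

/-- `d ⊗ e ↦ d ⊗ (e ⊗ 1)`. -/
def firstR : D.tensor E →ₐ[k] D.tensor (E.tensor F) :=
  desc D E (toL D (E.tensor F)) (midR D E F) (toL_midR D E F) (right_midR D E F)

lemma firstR_lastR (t : D.tensor E) (f : F) :
    firstR D E F t * lastR D E F f = lastR D E F f * firstR D E F t :=
  desc_comm D E _ _ _ _ _ (fun d => toL_lastR D E F d f) (fun e => midR_lastR D E F e f) t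

lemma firstR_right (b : A₃) : firstR D E F ((D.tensor E).right b) = lastR D E F (F.left b) := by
  rw [tensor_right', firstR, desc_toR, midR_right]

/-- The isomorphism of algebras `(d ⊗ e) ⊗ f ↦ d ⊗ (e ⊗ f)`. -/
def assocHom : StrHom ((D.tensor E).tensor F) (D.tensor (E.tensor F)) :=
  StrHom.mk'
    (desc (D.tensor E) F (firstR D E F) (lastR D E F) (firstR_lastR D E F) (firstR_right D E F))
    (fun a => by rw [tensor_left', desc_toL, tensor_left', firstR, desc_toL, tensor_left'])
    (fun b => by
      rw [tensor_right', desc_toR, tensor_right', tensor_right']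
      rfl)

lemma assocHom_pure (d : D) (e : E) (f : F) :
    (assocHom D E F).toAlgHom (pure (pure d e) f) = pure d (pure e f) := by
  change (pure d 1 * pure 1 (pure e 1)) * pure 1 (pure 1 f) = pure d (pure e f)
  simp only [pure_mul_pure, one_mul, mul_one]

/-- `d ↦ (d ⊗ 1) ⊗ 1`. -/
def firstL : D →ₐ[k] (D.tensor E).tensor F := (toL (D.tensor E) F).comp (toL D E)

/-- `e ↦ (1 ⊗ e) ⊗ 1`. -/
def midL : E →ₐ[k] (D.tensor E).tensor F := (toL (D.tensor E) F).comp (toR D E)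

lemma midL_toR (e : E) (f : F) :
    midL D E F e * toR (D.tensor E) F f = toR (D.tensor E) F f * midL D E F e :=
  toL_comm_toR (D.tensor E) F (toR D E e) f

lemma midL_right (b : A₃) : midL D E F (E.right b) = toR (D.tensor E) F (F.left b) :=
  (congrArg (toL (D.tensor E) F) (tensor_right' D E b)).symm.trans (toL_right (D.tensor E) F b)

lemma firstL_midL (d : D) (e : E) :
    midL D E F e * firstL D E F d = firstL D E F d * midL D E F e := by
  change toL (D.tensor E) F (toR D E e) * toL (D.tensor E) F (toL D E d) =
    toL (D.tensor E) F (toL D E d) * toL (D.tensor E) F (toR D E e)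
  rw [← map_mul, ← toL_comm_toR, map_mul]

lemma firstL_toR (d : D) (f : F) :
    toR (D.tensor E) F f * firstL D E F d = firstL D E F d * toR (D.tensor E) F f :=
  (toL_comm_toR (D.tensor E) F (toL D E d) f).symm

/-- `e ⊗ f ↦ (1 ⊗ e) ⊗ f`. -/
def lastL : E.tensor F →ₐ[k] (D.tensor E).tensor F :=
  desc E F (midL D E F) (toR (D.tensor E) F) (midL_toR D E F) (midL_right D E F)

lemma firstL_lastL (d : D) (t : E.tensor F) :
    firstL D E F d * lastL D E F t = lastL D E F t * firstL D E F d :=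
  (desc_comm E F _ _ _ _ _ (firstL_midL D E F d) (firstL_toR D E F d) t).symm

lemma firstL_right (b : A₂) : firstL D E F (D.right b) = lastL D E F ((E.tensor F).left b) := by
  rw [tensor_left', lastL, desc_toL]
  exact congrArg (toL (D.tensor E) F) (toL_right D E b)

/-- The isomorphism of algebras `d ⊗ (e ⊗ f) ↦ (d ⊗ e) ⊗ f`. -/
def assocInv : StrHom (D.tensor (E.tensor F)) ((D.tensor E).tensor F) :=
  StrHom.mk'
    (desc D (E.tensor F) (firstL D E F) (lastL D E F) (firstL_lastL D E F) (firstL_right D E F))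
    (fun a => by
      rw [tensor_left', desc_toL, tensor_left', tensor_left']
      rfl)
    (fun b => by rw [tensor_right', desc_toR, tensor_right', lastL, desc_toR, tensor_right'])

lemma assocInv_pure (d : D) (e : E) (f : F) :
    (assocInv D E F).toAlgHom (pure d (pure e f)) = pure (pure d e) f := by
  change pure (pure d 1) 1 * (pure (pure 1 e) 1 * pure 1 f) = pure (pure d e) f
  simp only [pure_mul_pure, one_mul, mul_one]

end

section

variable (D : CentralAlg A B)

/-- `a ↦ α(a ⊗ 1)`, as a homomorphism on the unit of `T(A, A)`. -/
def leftU : unit A →ₐ[k] D := D.left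

/-- `b ↦ α(1 ⊗ b)`, as a homomorphism on the unit of `T(B, B)`. -/
def rightU : unit B →ₐ[k] D := D.right

lemma leftU_comm (a : unit A) (d : D) :
    D.leftU a * AlgHom.id k D d = AlgHom.id k D d * D.leftU a := D.left_comm a d

lemma leftU_right (a : A) : D.leftU ((unit A).right a) = AlgHom.id k D (D.left a) :=
  congrArg D.left (unit_right a)

lemma leftU_left (a : A) : D.leftU ((unit A).left a) = D.left a := congrArg D.left (unit_left a)

lemma rightU_comm (d : D) (b : unit B) :
    AlgHom.id k D d * D.rightU b = D.rightU b * AlgHom.id k D d := (D.right_comm b d).symm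

lemma rightU_left (b : B) : AlgHom.id k D (D.right b) = D.rightU ((unit B).left b) :=
  (congrArg D.right (unit_left b)).symm

lemma rightU_right (b : B) : D.rightU ((unit B).right b) = D.right b :=
  congrArg D.right (unit_right b)

/-- The isomorphism of algebras `A ⊗_A D → D`, `a ⊗ d ↦ α(a ⊗ 1) d`. -/
def lunitHom : StrHom ((unit A).tensor D) D :=
  StrHom.mk' (desc (unit A) D D.leftU (AlgHom.id k D) D.leftU_comm D.leftU_right)
    (fun a => by rw [tensor_left', desc_toL, leftU_left])
    (fun b => by rw [tensor_right', desc_toR, AlgHom.id_apply])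

lemma lunitHom_pure (a : A) (d : D) :
    (lunitHom D).toAlgHom (pure (D := unit A) a d) = D.left a * d := rfl

/-- The isomorphism of algebras `D ⊗_B B → D`, `d ⊗ b ↦ d α(1 ⊗ b)`. -/
def runitHom : StrHom (D.tensor (unit B)) D :=
  StrHom.mk' (desc D (unit B) (AlgHom.id k D) D.rightU D.rightU_comm D.rightU_left)
    (fun a => by rw [tensor_left', desc_toL, AlgHom.id_apply])
    (fun b => by rw [tensor_right', desc_toR, rightU_right])

lemma runitHom_pure (d : D) (b : B) :
    (runitHom D).toAlgHom (pure (E := unit B) d b) = d * D.right b := rfl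

end

end CentralAlg

namespace CompatBimod

open CentralAlg (StrHom)

/-- For `φ : D' → D`, the `D`-`D'` bimodule `D`, with right action `m · d' = m φ(d')`. -/
def twistR {D D' : CentralAlg A B} (φ : StrHom D' D) : CompatBimod D D' where
  carrier := D
  lact := Algebra.lmul k D
  ract := (regular D).ract.comp (AlgHom.op φ.toAlgHom)
  lact_ract d _ m := (regular D).lact_ract d _ m
  compat x m := ((regular D).compat x m).trans
    (congrArg (fun d => (regular D).ract (op d) m) (φ.map_str x).symm)

/-- For `φ : D' → D`, the `D'`-`D` bimodule `D`, with left action `d' · m = φ(d') m`. -/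
def twistL {D D' : CentralAlg A B} (φ : StrHom D' D) : CompatBimod D' D where
  carrier := D
  lact := (Algebra.lmul k D).comp φ.toAlgHom
  ract := (regular D).ract
  lact_ract _ e m := (regular D).lact_ract _ e m
  compat x m := (congrArg (fun d => (regular D).lact d m) (φ.map_str x)).trans
    ((regular D).compat x m)

lemma twistR_lact {D D' : CentralAlg A B} (φ : StrHom D' D) (d m : D) :
    (twistR φ).lact d m = d * m := rfl
lemma twistR_ract {D D' : CentralAlg A B} (φ : StrHom D' D) (d : D') (m : D) :
    (twistR φ).ract (op d) m = m * φ.toAlgHom d := rfl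
lemma twistL_lact {D D' : CentralAlg A B} (φ : StrHom D' D) (d : D') (m : D) :
    (twistL φ).lact d m = φ.toAlgHom d * m := rfl
lemma twistL_ract {D D' : CentralAlg A B} (φ : StrHom D' D) (d m : D) :
    (twistL φ).ract (op d) m = m * d := rfl

section

variable (D : CentralAlg A₁ A₂) (E : CentralAlg A₂ A₃) (F : CentralAlg A₃ A₄)

/-- The algebra `(D ⊗ E) ⊗ F` as a bimodule from `(D ⊗ E) ⊗ F` to `D ⊗ (E ⊗ F)`. -/
def assocBimod : (D.tensor E).tensor F ⟶ D.tensor (E.tensor F) :=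
  twistR (CentralAlg.assocInv D E F)

/-- The algebra `D ⊗ (E ⊗ F)` as a bimodule from `D ⊗ (E ⊗ F)` to `(D ⊗ E) ⊗ F`. -/
def assocBimod' : D.tensor (E.tensor F) ⟶ (D.tensor E).tensor F :=
  twistR (CentralAlg.assocHom D E F)

end

section

variable (D : CentralAlg A B)

/-- The algebra `D` as a bimodule from `A ⊗_A D` to `D`. -/
def lunitBimod : (CentralAlg.unit A).tensor D ⟶ D := twistL (CentralAlg.lunitHom D)

/-- The algebra `D` as a bimodule from `D` to `A ⊗_A D`. -/
def lunitBimod' : D ⟶ (CentralAlg.unit A).tensor D := twistR (CentralAlg.lunitHom D)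

/-- The algebra `D` as a bimodule from `D ⊗_B B` to `D`. -/
def runitBimod : D.tensor (CentralAlg.unit B) ⟶ D := twistL (CentralAlg.runitHom D)

/-- The algebra `D` as a bimodule from `D` to `D ⊗_B B`. -/
def runitBimod' : D ⟶ D.tensor (CentralAlg.unit B) := twistR (CentralAlg.runitHom D)

end

end CompatBimod

/-- The objects, the hom bicategories `T(A, B)`, the composition functors `⊗_B` and the units
`(A, μ)` of `ComAlgebra`. -/
abbrev comAlgBase (k : Type u) [Field k] : TricategoryBase (CommAlgCat.{v} k) where
  Hom A B := CentralAlg A B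
  comp A B C := tensorFunctor A B C
  unit A := constFunctor UnitBicat (CentralAlg.unit A)

namespace ComAlg

open CompatBimod

/-- Transport of elements along an equality of bimodules. -/
def ofEq {D E : CentralAlg A B} {M N : CompatBimod D E} (h : M = N) (x : N.carrier) : M.carrier :=
  h ▸ x

/-- The components of the associator, the unitors and their adjoint inverses are the algebras
`(D ⊗ E) ⊗ F`, `D ⊗ (E ⊗ F)` and `D` with their canonical bimodule structures. -/
structure HasCanonicalOneCells (T : TricategoryEquivs (comAlgBase.{u, v} k)) : Prop where
  as_eq : ∀ {A₁ A₂ A₃ A₄ : CommAlgCat.{v} k} (D : CentralAlg A₁ A₂) (E : CentralAlg A₂ A₃)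
    (F : CentralAlg A₃ A₄), T.as D E F = assocBimod D E F
  as_eq' : ∀ {A₁ A₂ A₃ A₄ : CommAlgCat.{v} k} (D : CentralAlg A₁ A₂) (E : CentralAlg A₂ A₃)
    (F : CentralAlg A₃ A₄), T.as' D E F = assocBimod' D E F
  lu_eq : ∀ {A B : CommAlgCat.{v} k} (D : CentralAlg A B), T.lu D = lunitBimod D
  lu_eq' : ∀ {A B : CommAlgCat.{v} k} (D : CentralAlg A B), T.lu' D = lunitBimod' D
  ru_eq : ∀ {A B : CommAlgCat.{v} k} (D : CentralAlg A B), T.ru D = runitBimod D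
  ru_eq' : ∀ {A B : CommAlgCat.{v} k} (D : CentralAlg A B), T.ru' D = runitBimod' D

namespace HasCanonicalOneCells

variable {T : TricategoryEquivs (comAlgBase.{u, v} k)} (H : HasCanonicalOneCells T)

section

variable (D : CentralAlg A₁ A₂) (E : CentralAlg A₂ A₃) (F : CentralAlg A₃ A₄)

/-- The element `1` of the algebra `(D ⊗ E) ⊗ F`, as an element of the bimodule `a`. -/
def a₁ : CompatBimod.carrier (T.as D E F) :=
  ofEq (H.as_eq D E F) (1 : (D.tensor E).tensor F)

/-- The element `1` of the algebra `D ⊗ (E ⊗ F)`, as an element of the bimodule `a*`. -/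
def a₁' : CompatBimod.carrier (T.as' D E F) :=
  ofEq (H.as_eq' D E F) (1 : D.tensor (E.tensor F))

end

section

variable (D : CentralAlg A B)

/-- The element `1` of the algebra `D`, as an element of the bimodule `l`. -/
def l₁ : CompatBimod.carrier (T.lu D) := ofEq (H.lu_eq D) (1 : D)

/-- The element `1` of the algebra `D`, as an element of the bimodule `l*`. -/
def l₁' : CompatBimod.carrier (T.lu' D) := ofEq (H.lu_eq' D) (1 : D)

/-- The element `1` of the algebra `D`, as an element of the bimodule `r`. -/
def r₁ : CompatBimod.carrier (T.ru D) := ofEq (H.ru_eq D) (1 : D)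

/-- The element `1` of the algebra `D`, as an element of the bimodule `r*`. -/
def r₁' : CompatBimod.carrier (T.ru' D) := ofEq (H.ru_eq' D) (1 : D)

end

end HasCanonicalOneCells

/-- The value at `m` of the bimodule homomorphism `φ`. -/
def app {D E : CentralAlg A B} {M N : CompatBimod D E} (φ : M ⟶ N) (m : M.carrier) : N.carrier :=
  φ.toLin m

/-- The element `1` of an algebra, as an element of the identity bimodule. -/
def one (D : CentralAlg A B) : (𝟙 D : CompatBimod D D).carrier := (1 : D)

/-- All the coherence data of the tricategory are the canonical ones: the constraints of the adjoint
equivalences and the modifications are the bimodule isomorphisms given by the evident formulas on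
generating elements. -/
structure IsCanonical (T : Tricategory (comAlgBase.{u, v} k))
    extends H : HasCanonicalOneCells T.toTricategoryEquivs where
  asNat : ∀ {A₁ A₂ A₃ A₄ : CommAlgCat.{v} k} {D D' : CentralAlg A₁ A₂} {E E' : CentralAlg A₂ A₃}
    {F F' : CentralAlg A₃ A₄} (M : CompatBimod D D') (N : CompatBimod E E') (P : CompatBimod F F')
    (m : M.carrier) (n : N.carrier) (p : P.carrier),
    app (T.asNat M N P).hom (tmul ((M.box N).box P) (T.as D' E' F')
        (btmul (M.box N) P (btmul M N m n) p) (H.a₁ D' E' F')) =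
      tmul (T.as D E F) (M.box (N.box P)) (H.a₁ D E F) (btmul M (N.box P) m (btmul N P n p))
  asNat' : ∀ {A₁ A₂ A₃ A₄ : CommAlgCat.{v} k} {D D' : CentralAlg A₁ A₂} {E E' : CentralAlg A₂ A₃}
    {F F' : CentralAlg A₃ A₄} (M : CompatBimod D D') (N : CompatBimod E E') (P : CompatBimod F F')
    (m : M.carrier) (n : N.carrier) (p : P.carrier),
    app (T.asNat' M N P).hom (tmul (M.box (N.box P)) (T.as' D' E' F')
        (btmul M (N.box P) m (btmul N P n p)) (H.a₁' D' E' F')) =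
      tmul (T.as' D E F) ((M.box N).box P) (H.a₁' D E F)
        (btmul (M.box N) P (btmul M N m n) p)
  luNat : ∀ {A B : CommAlgCat.{v} k} {D D' : CentralAlg A B} (M : CompatBimod D D')
    (m : M.carrier),
    app (T.luNat M).hom (tmul (box (𝟙 (CentralAlg.unit A)) M) (T.lu D')
        (btmul (𝟙 (CentralAlg.unit A)) M (one _) m) (H.l₁ D')) =
      tmul (T.lu D) M (H.l₁ D) m
  luNat' : ∀ {A B : CommAlgCat.{v} k} {D D' : CentralAlg A B} (M : CompatBimod D D')
    (m : M.carrier),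
    app (T.luNat' M).hom (tmul M (T.lu' D') m (H.l₁' D')) =
      tmul (T.lu' D) (box (𝟙 (CentralAlg.unit A)) M) (H.l₁' D)
        (btmul (𝟙 (CentralAlg.unit A)) M (one _) m)
  ruNat : ∀ {A B : CommAlgCat.{v} k} {D D' : CentralAlg A B} (M : CompatBimod D D')
    (m : M.carrier),
    app (T.ruNat M).hom (tmul (box M (𝟙 (CentralAlg.unit B))) (T.ru D')
        (btmul M (𝟙 (CentralAlg.unit B)) m (one _)) (H.r₁ D')) =
      tmul (T.ru D) M (H.r₁ D) m
  ruNat' : ∀ {A B : CommAlgCat.{v} k} {D D' : CentralAlg A B} (M : CompatBimod D D')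
    (m : M.carrier),
    app (T.ruNat' M).hom (tmul M (T.ru' D') m (H.r₁' D')) =
      tmul (T.ru' D) (box M (𝟙 (CentralAlg.unit B))) (H.r₁' D)
        (btmul M (𝟙 (CentralAlg.unit B)) m (one _))
  asUnit : ∀ {A₁ A₂ A₃ A₄ : CommAlgCat.{v} k} (D : CentralAlg A₁ A₂) (E : CentralAlg A₂ A₃)
    (F : CentralAlg A₃ A₄),
    app (T.asUnit D E F) (one ((D.tensor E).tensor F)) =
      tmul (T.as D E F) (T.as' D E F) (H.a₁ D E F) (H.a₁' D E F)
  asCounit : ∀ {A₁ A₂ A₃ A₄ : CommAlgCat.{v} k} (D : CentralAlg A₁ A₂) (E : CentralAlg A₂ A₃)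
    (F : CentralAlg A₃ A₄),
    app (T.asCounit D E F) (tmul (T.as' D E F) (T.as D E F) (H.a₁' D E F) (H.a₁ D E F)) =
      one (D.tensor (E.tensor F))
  luUnit : ∀ {A B : CommAlgCat.{v} k} (D : CentralAlg A B),
    app (T.luUnit D) (one ((CentralAlg.unit A).tensor D)) =
      tmul (T.lu D) (T.lu' D) (H.l₁ D) (H.l₁' D)
  luCounit : ∀ {A B : CommAlgCat.{v} k} (D : CentralAlg A B),
    app (T.luCounit D) (tmul (T.lu' D) (T.lu D) (H.l₁' D) (H.l₁ D)) = one D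
  ruUnit : ∀ {A B : CommAlgCat.{v} k} (D : CentralAlg A B),
    app (T.ruUnit D) (one (D.tensor (CentralAlg.unit B))) =
      tmul (T.ru D) (T.ru' D) (H.r₁ D) (H.r₁' D)
  ruCounit : ∀ {A B : CommAlgCat.{v} k} (D : CentralAlg A B),
    app (T.ruCounit D) (tmul (T.ru' D) (T.ru D) (H.r₁' D) (H.r₁ D)) = one D
  π : ∀ {A₁ A₂ A₃ A₄ A₅ : CommAlgCat.{v} k} (D : CentralAlg A₁ A₂) (E : CentralAlg A₂ A₃)
    (F : CentralAlg A₃ A₄) (G : CentralAlg A₄ A₅),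
    app (T.modifications.π D E F G).hom
        (tmul (box (T.as D E F) (𝟙 G))
          (CompatBimod.tensor (T.as D (E.tensor F) G) (box (𝟙 D) (T.as E F G)))
          (btmul (T.as D E F) (𝟙 G) (H.a₁ D E F) (one G))
          (tmul (T.as D (E.tensor F) G) (box (𝟙 D) (T.as E F G)) (H.a₁ D (E.tensor F) G)
            (btmul (𝟙 D) (T.as E F G) (one D) (H.a₁ E F G)))) =
      tmul (T.as (D.tensor E) F G) (T.as D E (F.tensor G)) (H.a₁ (D.tensor E) F G)
        (H.a₁ D E (F.tensor G))
  μ : ∀ {A B C : CommAlgCat.{v} k} (D : CentralAlg A B) (E : CentralAlg B C),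
    app (T.modifications.μ D E).hom
        (tmul (box (T.ru' D) (𝟙 E))
          (CompatBimod.tensor (T.as D (CentralAlg.unit B) E) (box (𝟙 D) (T.lu E)))
          (btmul (T.ru' D) (𝟙 E) (H.r₁' D) (one E))
          (tmul (T.as D (CentralAlg.unit B) E) (box (𝟙 D) (T.lu E)) (H.a₁ D (CentralAlg.unit B) E)
            (btmul (𝟙 D) (T.lu E) (one D) (H.l₁ E)))) =
      one (D.tensor E)
  lam : ∀ {A B C : CommAlgCat.{v} k} (D : CentralAlg A B) (E : CentralAlg B C),
    app (T.modifications.lam D E).hom (btmul (T.lu D) (𝟙 E) (H.l₁ D) (one E)) =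
      tmul (T.as (CentralAlg.unit A) D E) (T.lu (D.tensor E)) (H.a₁ (CentralAlg.unit A) D E)
        (H.l₁ (D.tensor E))
  rho : ∀ {A B C : CommAlgCat.{v} k} (D : CentralAlg A B) (E : CentralAlg B C),
    app (T.modifications.rho D E).hom (btmul (𝟙 D) (T.ru' E) (one D) (H.r₁' E)) =
      tmul (T.ru' (D.tensor E)) (T.as D E (CentralAlg.unit C)) (H.r₁' (D.tensor E))
        (H.a₁ D E (CentralAlg.unit C))

end ComAlg

end Canonical

/-! Every coherence cell of `ComAlgebra` is pinned down by very few values. A bimodule homomorphism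
is left linear, so it is determined on any set that generates its source as a left module, and each
of the bimodules `a`, `l`, `r` and their adjoint inverses is generated by the single element `u`.
Generating sets are stable under both tensor products, the one over the middle algebra and the one
over the commutative algebra. Hence the source of each pasting in the 4-cocycle and normalization
conditions is generated by one iterated tensor of elements `u` and `1`. Every cell in those pastings
carries such a canonical tensor to the canonical tensor of its target, so the two pastings agree on
a generator and are equal. The modification axioms follow in the same way, with arbitrary elements
of the 1-cells in the variable slots. This argument uses only formal properties of elements,
collected in `BicategoryElements` and `TricategoryBaseElements`; its outcome is
`TricategoryModificationsElements.tricategory`, where 3-cells with prescribed values at generators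
already give a tricategory.

It remains to produce cells with the prescribed values. The tool is `IsCompanion`: a bimodule `U`,
free of rank one on `u` as a left module, with `d · u = u · φ(d)` for an isomorphism of algebras
`φ`. Companions compose (`IsCompanion.tensor`), can be tensored over the commutative algebra
(`IsCompanion.box`), and two companions of the same `φ` are identified by an isomorphism matching
the generators (`IsCompanion.iso`). So `π`, `μ`, `λ`, `ρ` exist as soon as the corresponding
composites of algebra isomorphisms agree, and these identities (`assocEquiv_pentagon`,
`runitEquiv_triangle`, `lunitEquiv_tensor`, `runitEquiv_symm_tensor`) are checked on pure tensors.

For the adjoint equivalences, rebracketing `(m ⊗ n) ⊗ p ↦ m ⊗ (n ⊗ p)` is not a map between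
bimodules over the same algebras; it is semilinear along the rebracketing of algebras. Such
semilinear families, compatible with 2-cells and with the pseudofunctor constraints, are the
transformations one would have in the double category of algebras, algebra isomorphisms and
bimodules (`SemilinearTrans`). Companions turn a semilinear family `θ` into a strong transformation
with naturality cell `m ⊗ u ↦ u ⊗ θ(m)`, turn its inverse into the adjoint inverse, and supply the
unit and counit (`SemilinearTrans.equivalence`). -/

/-! ### Elements of 1-cells -/

section Elements

universe t w₁ w₂ w₃ w₄

open scoped Pseudofunctor.StrongTrans CategoryTheory.Prod

/-- A notion of elements of the 1-cells of a bicategory on which the 2-cells act, together with a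
class of generating sets of elements on which the 2-cells are determined. -/
class BicategoryElements (C : Type w₂) [Bicategory.{w₄, w₃} C] where
  El : ∀ {a b : C}, (a ⟶ b) → Type t
  ev : ∀ {a b : C} {f g : a ⟶ b}, (f ⟶ g) → El f → El g
  pair : ∀ {a b c : C} {f : a ⟶ b} {g : b ⟶ c}, El f → El g → El (f ≫ g)
  one : ∀ a : C, El (𝟙 a)
  ev_id : ∀ {a b : C} {f : a ⟶ b} (x : El f), ev (𝟙 f) x = x
  ev_comp : ∀ {a b : C} {f g h : a ⟶ b} (θ : f ⟶ g) (κ : g ⟶ h) (x : El f),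
    ev (θ ≫ κ) x = ev κ (ev θ x)
  ev_whiskerLeft : ∀ {a b c : C} (f : a ⟶ b) {g g' : b ⟶ c} (θ : g ⟶ g') (x : El f) (y : El g),
    ev (f ◁ θ) (pair x y) = pair x (ev θ y)
  ev_whiskerRight : ∀ {a b c : C} {f f' : a ⟶ b} (θ : f ⟶ f') (g : b ⟶ c) (x : El f) (y : El g),
    ev (θ ▷ g) (pair x y) = pair (ev θ x) y
  ev_associator_hom : ∀ {a b c d : C} {f : a ⟶ b} {g : b ⟶ c} {h : c ⟶ d} (x : El f) (y : El g)
    (z : El h), ev (α_ f g h).hom (pair (pair x y) z) = pair x (pair y z)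
  ev_leftUnitor_hom : ∀ {a b : C} {f : a ⟶ b} (x : El f), ev (λ_ f).hom (pair (one a) x) = x
  ev_rightUnitor_hom : ∀ {a b : C} {f : a ⟶ b} (x : El f), ev (ρ_ f).hom (pair x (one b)) = x
  IsGen : ∀ {a b : C} {f : a ⟶ b}, Set (El f) → Prop
  isGen_univ : ∀ {a b : C} (f : a ⟶ b), IsGen (Set.univ : Set (El f))
  isGen_one : ∀ a, IsGen {one a}
  isGen_image2_pair : ∀ {a b c : C} {f : a ⟶ b} {g : b ⟶ c} {S : Set (El f)} {T : Set (El g)},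
    IsGen S → IsGen T → IsGen (Set.image2 pair S T)
  hom_ext : ∀ {a b : C} {f g : a ⟶ b} {S : Set (El f)}, IsGen S → ∀ {θ κ : f ⟶ g},
    (∀ x ∈ S, ev θ x = ev κ x) → θ = κ

namespace BicategoryElements

attribute [simp] ev_id ev_comp ev_whiskerLeft ev_whiskerRight ev_associator_hom ev_leftUnitor_hom
  ev_rightUnitor_hom

variable {C : Type w₂} [Bicategory.{w₄, w₃} C] [BicategoryElements.{t} C]

/-- Evaluation is functorial, so a value of an isomorphism can be read backwards. For this reason
only the forward constraints need to be specified in the classes of elements. -/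
lemma ev_inv {a b : C} {f g : a ⟶ b} (θ : f ≅ g) {x : El.{t} f} {y : El.{t} g}
    (h : ev θ.hom x = y) : ev θ.inv y = x := by
  rw [← h, ← ev_comp, θ.hom_inv_id, ev_id]

@[simp]
lemma ev_associator_inv {a b c d : C} {f : a ⟶ b} {g : b ⟶ c} {h : c ⟶ d} (x : El.{t} f)
    (y : El.{t} g) (z : El.{t} h) : ev (α_ f g h).inv (pair x (pair y z)) = pair (pair x y) z :=
  ev_inv _ (ev_associator_hom x y z)

@[simp]
lemma ev_leftUnitor_inv {a b : C} {f : a ⟶ b} (x : El.{t} f) :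
    ev (λ_ f).inv x = pair (one a) x :=
  ev_inv _ (ev_leftUnitor_hom x)

@[simp]
lemma ev_rightUnitor_inv {a b : C} {f : a ⟶ b} (x : El.{t} f) :
    ev (ρ_ f).inv x = pair x (one b) :=
  ev_inv _ (ev_rightUnitor_hom x)

/-- The singleton case of stability under composition. It is what lets an equation between pasted
cells be tested on one element. -/
lemma isGen_pair {a b c : C} {f : a ⟶ b} {g : b ⟶ c} {x : El.{t} f} {y : El.{t} g}
    (hx : IsGen {x}) (hy : IsGen {y}) : IsGen {pair x y} := by
  simpa using isGen_image2_pair hx hy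

lemma hom_ext_of_isGen {a b : C} {f g : a ⟶ b} {x : El.{t} f} (hx : IsGen {x}) {θ κ : f ⟶ g}
    (h : ev θ x = ev κ x) : θ = κ :=
  hom_ext hx fun _ hy => by rw [Set.mem_singleton_iff.1 hy, h]

lemma ev_sqId {x x' : C} {u : x ⟶ x'} (m : El.{t} u) :
    ev (sqId u).hom (pair m (one x')) = pair (one x) m := by
  simp [sqId]

/-- An element `m` of the left edge is moved past `s'` by the first square, becoming `n`, and then
past `r'` by the second, becoming `o`. The remaining factors of the pasting only rebracket. -/
lemma ev_sqPaste {x y z x' y' z' : C} {p : x ⟶ y} {q : y ⟶ z} {p' : x' ⟶ y'} {q' : y' ⟶ z'}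
    {u : x ⟶ x'} {v : y ⟶ y'} {w : z ⟶ z'} (σ : u ≫ p' ≅ p ≫ v) (τ : v ≫ q' ≅ q ≫ w)
    {m : El.{t} u} {n : El.{t} v} {o : El.{t} w} {s : El.{t} p} {s' : El.{t} p'} {r : El.{t} q}
    {r' : El.{t} q'} (hσ : ev σ.hom (pair m s') = pair s n)
    (hτ : ev τ.hom (pair n r') = pair r o) :
    ev (sqPaste σ τ).hom (pair m (pair s' r')) = pair (pair s r) o := by
  simp [sqPaste, hσ, hτ]

end BicategoryElements

open BicategoryElements

/-- Elements of the 2-cells of a tricategory, compatible with the composition of 1-cells. -/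
class TricategoryBaseElements {Obj : Type w₁} (X : TricategoryBase.{w₁, w₂, w₃, w₄} Obj) where
  [hom : ∀ a b, BicategoryElements.{t} (X.Hom a b)]
  ten : ∀ {a b c : Obj} {f f' : X.Hom a b} {g g' : X.Hom b c} {u : f ⟶ f'} {v : g ⟶ g'},
    El.{t} u → El.{t} v → El.{t} (X.ten₁ u v)
  ev_ten₂ : ∀ {a b c : Obj} {f f' : X.Hom a b} {g g' : X.Hom b c} {u u' : f ⟶ f'} {v v' : g ⟶ g'}
    (θ : u ⟶ u') (κ : v ⟶ v') (x : El.{t} u) (y : El.{t} v),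
    ev (X.ten₂ θ κ) (ten x y) = ten (ev θ x) (ev κ y)
  ev_tenId_hom : ∀ {a b c : Obj} (f : X.Hom a b) (g : X.Hom b c),
    ev (X.tenId f g).hom (ten (one f) (one g)) = one (X.ten₀ f g)
  ev_mapComp_hom : ∀ {a b c : Obj} {f f' f'' : X.Hom a b} {g g' g'' : X.Hom b c} {u : f ⟶ f'}
    {u' : f' ⟶ f''} {v : g ⟶ g'} {v' : g' ⟶ g''} (x : El.{t} u) (x' : El.{t} u') (y : El.{t} v)
    (y' : El.{t} v'),
    ev ((X.comp a b c).mapComp (u ×ₘ v) (u' ×ₘ v')).hom (ten (pair x x') (pair y y')) =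
      pair (ten x y) (ten x' y')
  isGen_image2_ten : ∀ {a b c : Obj} {f f' : X.Hom a b} {g g' : X.Hom b c} {u : f ⟶ f'}
    {v : g ⟶ g'} {S : Set (El.{t} u)} {S' : Set (El.{t} v)}, IsGen S → IsGen S' →
    IsGen (Set.image2 ten S S')

namespace TricategoryBaseElements

attribute [instance, reducible] hom
attribute [simp] ev_ten₂ ev_tenId_hom

variable {Obj : Type w₁} {X : TricategoryBase.{w₁, w₂, w₃, w₄} Obj}
  [TricategoryBaseElements.{t} X] {a b c d e : Obj}

lemma isGen_ten {f f' : X.Hom a b} {g g' : X.Hom b c} {u : f ⟶ f'} {v : g ⟶ g'} {x : El.{t} u}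
    {y : El.{t} v} (hx : IsGen {x}) (hy : IsGen {y}) : IsGen {(ten x y : El.{t} (X.ten₁ u v))} := by
  simpa using isGen_image2_ten (X := X) hx hy

lemma ev_mapComp_inv {f f' f'' : X.Hom a b} {g g' g'' : X.Hom b c} {u : f ⟶ f'} {u' : f' ⟶ f''}
    {v : g ⟶ g'} {v' : g' ⟶ g''} (x : El.{t} u) (x' : El.{t} u') (y : El.{t} v) (y' : El.{t} v') :
    ev ((X.comp a b c).mapComp (u ×ₘ v) (u' ×ₘ v')).inv (pair (ten x y) (ten x' y')) =
      ten (pair x x') (pair y y') :=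
  ev_inv _ (ev_mapComp_hom x x' y y')

@[simp]
lemma ev_tenId_inv (f : X.Hom a b) (g : X.Hom b c) :
    ev (X.tenId f g).inv (one (X.ten₀ f g)) = ten (one.{t} f) (one g) :=
  ev_inv _ (ev_tenId_hom f g)

@[simp]
lemma ev_tenIso_hom {f f' : X.Hom a b} {g g' : X.Hom b c} {u u' : f ⟶ f'} {v v' : g ⟶ g'}
    (θ : u ≅ u') (κ : v ≅ v') (x : El.{t} u) (y : El.{t} v) :
    ev (X.tenIso θ κ).hom (ten x y) = ten (ev θ.hom x) (ev κ.hom y) :=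
  ev_ten₂ θ.hom κ.hom x y

@[simp]
lemma ev_tenR₂_hom {f f' f'' : X.Hom a b} (u : f ⟶ f') (u' : f' ⟶ f'') (g : X.Hom b c)
    (x : El.{t} u) (x' : El.{t} u') :
    ev (X.tenR₂ u u' g).hom (ten (pair x x') (one g)) = pair (ten x (one g)) (ten x' (one g)) := by
  refine (ev_comp _ _ _).trans ?_
  rw [ev_tenIso_hom]
  simp only [Iso.refl_hom, ev_id, Iso.symm_hom, ev_leftUnitor_inv]
  exact ev_mapComp_hom x x' (one g) (one g)

@[simp]
lemma ev_tenL₂_hom (f : X.Hom a b) {g g' g'' : X.Hom b c} (v : g ⟶ g') (v' : g' ⟶ g'')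
    (y : El.{t} v) (y' : El.{t} v') :
    ev (X.tenL₂ f v v').hom (ten (one f) (pair y y')) = pair (ten (one f) y) (ten (one f) y') := by
  refine (ev_comp _ _ _).trans ?_
  rw [ev_tenIso_hom]
  simp only [Iso.refl_hom, ev_id, Iso.symm_hom, ev_leftUnitor_inv]
  exact ev_mapComp_hom (one f) (one f) y y'

@[simp]
lemma ev_tenR₃_inv {f f' f'' f''' : X.Hom a b} (u : f ⟶ f') (u' : f' ⟶ f'') (u'' : f'' ⟶ f''')
    (g : X.Hom b c) (x : El.{t} u) (x' : El.{t} u') (x'' : El.{t} u'') :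
    ev (X.tenR₃ u u' u'' g).inv
        (pair (ten x (one g)) (pair (ten x' (one g)) (ten x'' (one g)))) =
      ten (pair x (pair x' x'')) (one g) :=
  ev_inv _ (by simp [TricategoryBase.tenR₃])

@[simp]
lemma ev_tenL₃_inv (f : X.Hom a b) {g g' g'' g''' : X.Hom b c} (v : g ⟶ g') (v' : g' ⟶ g'')
    (v'' : g'' ⟶ g''') (y : El.{t} v) (y' : El.{t} v') (y'' : El.{t} v'') :
    ev (X.tenL₃ f v v' v'').inv
        (pair (ten (one f) y) (pair (ten (one f) y') (ten (one f) y''))) =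
      ten (one f) (pair y (pair y' y'')) :=
  ev_inv _ (by simp [TricategoryBase.tenL₃])

/-- The composition constraint shuffles a pair of tensors into a tensor of pairs; there each square
acts in its own factor, and the constraint shuffles back. -/
lemma ev_sqMap {f f' h h' : X.Hom a b} {p : f ⟶ f'} {p' : h ⟶ h'} {u : f ⟶ h} {v : f' ⟶ h'}
    {g g' j j' : X.Hom b c} {q : g ⟶ g'} {q' : j ⟶ j'} {r : g ⟶ j} {s : g' ⟶ j'}
    (σ : u ≫ p' ≅ p ≫ v) (τ : r ≫ q' ≅ q ≫ s) {m : El.{t} u} {m' : El.{t} p'} {n : El.{t} p}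
    {n' : El.{t} v} {x : El.{t} r} {x' : El.{t} q'} {y : El.{t} q} {y' : El.{t} s}
    (hσ : ev σ.hom (pair m m') = pair n n') (hτ : ev τ.hom (pair x x') = pair y y') :
    ev (sqMap (X.comp a b c) σ τ).hom (pair (ten m x) (ten m' x')) =
      pair (ten n y) (ten n' y') := by
  refine (ev_comp _ _ _).trans ?_
  refine (congrArg _ (ev_mapComp_inv m m' x x')).trans ((ev_comp _ _ _).trans ?_)
  refine (congrArg _ (ev_ten₂ σ.hom τ.hom (pair m m') (pair x x'))).trans ?_
  rw [hσ, hτ]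
  exact ev_mapComp_hom n n' y y'

section

variable {f f' f'' : X.Hom a b} {g g' g'' : X.Hom b c} {h h' h'' : X.Hom c d}

lemma ev_assocL_map₂ {u u' : f ⟶ f'} {v v' : g ⟶ g'} {w w' : h ⟶ h'} (θ : u ⟶ u') (κ : v ⟶ v')
    (τ : w ⟶ w') (x : El.{t} u) (y : El.{t} v) (z : El.{t} w) :
    ev ((X.assocL a b c d).map₂ (f := (u ×ₘ v) ×ₘ w) (g := (u' ×ₘ v') ×ₘ w') ((θ ×ₘ κ) ×ₘ τ))
      (ten (ten x y) z) = ten (ten (ev θ x) (ev κ y)) (ev τ z) :=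
  (ev_ten₂ (X.ten₂ θ κ) τ (ten x y) z).trans (congrArg (ten · (ev τ z)) (ev_ten₂ θ κ x y))

lemma ev_assocR_map₂ {u u' : f ⟶ f'} {v v' : g ⟶ g'} {w w' : h ⟶ h'} (θ : u ⟶ u') (κ : v ⟶ v')
    (τ : w ⟶ w') (x : El.{t} u) (y : El.{t} v) (z : El.{t} w) :
    ev ((X.assocR a b c d).map₂ (f := (u ×ₘ v) ×ₘ w) (g := (u' ×ₘ v') ×ₘ w') ((θ ×ₘ κ) ×ₘ τ))
      (ten x (ten y z)) = ten (ev θ x) (ten (ev κ y) (ev τ z)) :=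
  (ev_ten₂ θ (X.ten₂ κ τ) x (ten y z)).trans (congrArg (ten (ev θ x)) (ev_ten₂ κ τ y z))

/-- The constraints of the two triple composites are evaluated in the inverse direction, since that
is the one which starts at `one` or at a `pair`, as the axioms of `SemilinearTrans` do. -/
lemma ev_assocL_mapId_inv (f : X.Hom a b) (g : X.Hom b c) (h : X.Hom c d) :
    ev ((X.assocL a b c d).mapId ((f, g), h)).inv (one (X.ten₀ (X.ten₀ f g) h)) =
      (ten (ten (one.{t} f) (one g)) (one h) : El (X.ten₁ (X.ten₁ (𝟙 f) (𝟙 g)) (𝟙 h))) := by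
  refine (ev_comp _ _ _).trans ((congrArg _ (ev_tenId_inv (X.ten₀ f g) h)).trans ?_)
  refine (ev_ten₂ (((fstFunctor _ _).comp (X.comp a b c)).mapId ((f, g), h)).inv
    ((sndFunctor _ _).mapId ((f, g), h)).inv _ _).trans (congrArg₂ _ ?_ (ev_id _))
  refine (ev_comp _ _ _).trans ((congrArg _ (ev_tenId_inv f g)).trans ?_)
  exact (ev_ten₂ (𝟙 (𝟙 f)) (𝟙 (𝟙 g)) _ _).trans (congrArg₂ _ (ev_id _) (ev_id _))

lemma ev_assocR_mapId_inv (f : X.Hom a b) (g : X.Hom b c) (h : X.Hom c d) :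
    ev ((X.assocR a b c d).mapId ((f, g), h)).inv (one (X.ten₀ f (X.ten₀ g h))) =
      (ten (one.{t} f) (ten (one g) (one h)) : El (X.ten₁ (𝟙 f) (X.ten₁ (𝟙 g) (𝟙 h)))) := by
  refine (ev_comp _ _ _).trans ((congrArg _ (ev_tenId_inv f (X.ten₀ g h))).trans ?_)
  refine (ev_ten₂ (((fstFunctor _ _).comp (fstFunctor _ _)).mapId ((f, g), h)).inv
    (((pairFunctor ((fstFunctor _ _).comp (sndFunctor _ _)) (sndFunctor _ _)).comp
      (X.comp b c d)).mapId ((f, g), h)).inv _ _).trans (congrArg₂ _ ?_ ?_)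
  -- The projections are strict, so the constraint of a composite of two of them is a composite of
  -- two identities.
  · exact (ev_comp _ _ _).trans ((ev_id _).trans (ev_id _))
  refine (ev_comp _ _ _).trans ((congrArg _ (ev_tenId_inv g h)).trans ?_)
  refine (ev_ten₂ (((fstFunctor _ _).comp (sndFunctor _ _)).mapId ((f, g), h)).inv
    (𝟙 (𝟙 h)) _ _).trans (congrArg₂ _ ?_ (ev_id _))
  exact (ev_comp _ _ _).trans ((ev_id _).trans (ev_id _))

lemma ev_assocL_mapComp_inv {u : f ⟶ f'} {v : g ⟶ g'} {w : h ⟶ h'} {u' : f' ⟶ f''}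
    {v' : g' ⟶ g''} {w' : h' ⟶ h''} (x : El.{t} u) (y : El.{t} v) (z : El.{t} w) (x' : El.{t} u')
    (y' : El.{t} v') (z' : El.{t} w') :
    ev ((X.assocL a b c d).mapComp ((u ×ₘ v) ×ₘ w) ((u' ×ₘ v') ×ₘ w')).inv
      (pair (ten (ten x y) z) (ten (ten x' y') z')) =
        (ten (ten (pair x x') (pair y y')) (pair z z') :
          El (X.ten₁ (X.ten₁ (u ≫ u') (v ≫ v')) (w ≫ w'))) := by
  -- The constraint of a composite pseudofunctor has two layers: the outer tensor is shuffled here,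
  -- and the inner one, sitting in the first factor, below.
  refine (ev_comp _ _ _).trans ((congrArg _ (ev_mapComp_inv (ten x y) (ten x' y') z z')).trans ?_)
  refine (ev_ten₂ (((fstFunctor _ _).comp (X.comp a b c)).mapComp ((u ×ₘ v) ×ₘ w)
    ((u' ×ₘ v') ×ₘ w')).inv (𝟙 (w ≫ w')) _ _).trans (congrArg₂ _ ?_ (ev_id _))
  refine (ev_comp _ _ _).trans ((congrArg _ (ev_mapComp_inv x x' y y')).trans ?_)
  exact (ev_ten₂ (𝟙 (u ≫ u')) (𝟙 (v ≫ v')) _ _).trans (congrArg₂ _ (ev_id _) (ev_id _))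

lemma ev_assocR_mapComp_inv {u : f ⟶ f'} {v : g ⟶ g'} {w : h ⟶ h'} {u' : f' ⟶ f''}
    {v' : g' ⟶ g''} {w' : h' ⟶ h''} (x : El.{t} u) (y : El.{t} v) (z : El.{t} w) (x' : El.{t} u')
    (y' : El.{t} v') (z' : El.{t} w') :
    ev ((X.assocR a b c d).mapComp ((u ×ₘ v) ×ₘ w) ((u' ×ₘ v') ×ₘ w')).inv
      (pair (ten x (ten y z)) (ten x' (ten y' z'))) =
        (ten (pair x x') (ten (pair y y') (pair z z')) :
          El (X.ten₁ (u ≫ u') (X.ten₁ (v ≫ v') (w ≫ w')))) := by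
  refine (ev_comp _ _ _).trans ((congrArg _ (ev_mapComp_inv x x' (ten y z) (ten y' z'))).trans ?_)
  refine (ev_ten₂ (((fstFunctor _ _).comp (fstFunctor _ _)).mapComp ((u ×ₘ v) ×ₘ w)
    ((u' ×ₘ v') ×ₘ w')).inv
    (((pairFunctor ((fstFunctor _ _).comp (sndFunctor _ _)) (sndFunctor _ _)).comp
      (X.comp b c d)).mapComp ((u ×ₘ v) ×ₘ w) ((u' ×ₘ v') ×ₘ w')).inv _ _).trans
    (congrArg₂ _ ?_ ?_)
  · exact (ev_comp _ _ _).trans ((ev_id _).trans (ev_id _))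
  refine (ev_comp _ _ _).trans ((congrArg _ (ev_mapComp_inv y y' z z')).trans ?_)
  refine (ev_ten₂ (((fstFunctor _ _).comp (sndFunctor _ _)).mapComp ((u ×ₘ v) ×ₘ w)
    ((u' ×ₘ v') ×ₘ w')).inv (𝟙 (w ≫ w')) _ _).trans (congrArg₂ _ ?_ (ev_id _))
  exact (ev_comp _ _ _).trans ((ev_id _).trans (ev_id _))

end

end TricategoryBaseElements

end Elements

/-! ### From values at generators to the tricategory axioms -/

section Coherence

universe t w₁ w₂ w₃ w₄

open scoped Pseudofunctor.StrongTrans CategoryTheory.Prod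

open BicategoryElements TricategoryBaseElements

variable {Obj : Type w₁} {X : TricategoryBase.{w₁, w₂, w₃, w₄} Obj}
  [TricategoryBaseElements.{t} X]

/-- Generating elements of the associators and unitors which the naturality constraints move past
any element. -/
structure TricategoryEquivsElements (T : TricategoryEquivs X) where
  a₁ : ∀ {a b c d : Obj} (f : X.Hom a b) (g : X.Hom b c) (h : X.Hom c d), El.{t} (T.as f g h)
  l₁ : ∀ {a b : Obj} (f : X.Hom a b), El.{t} (T.lu f)
  r₁' : ∀ {a b : Obj} (f : X.Hom a b), El.{t} (T.ru' f)
  ι₁ : ∀ a : Obj, El.{t} (X.ι a)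
  isGen_a₁ : ∀ {a b c d : Obj} (f : X.Hom a b) (g : X.Hom b c) (h : X.Hom c d), IsGen {a₁ f g h}
  isGen_l₁ : ∀ {a b : Obj} (f : X.Hom a b), IsGen {l₁ f}
  isGen_r₁' : ∀ {a b : Obj} (f : X.Hom a b), IsGen {r₁' f}
  isGen_ι₁ : ∀ {a : Obj}, IsGen {ι₁ a}
  ev_asNat_hom : ∀ {a b c d : Obj} {f f' : X.Hom a b} {g g' : X.Hom b c} {h h' : X.Hom c d}
    {u : f ⟶ f'} {v : g ⟶ g'} {w : h ⟶ h'} (x : El.{t} u) (y : El.{t} v) (z : El.{t} w),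
    ev (T.asNat u v w).hom (pair (ten (ten x y) z) (a₁ f' g' h')) =
      pair (a₁ f g h) (ten x (ten y z))
  ev_luNat_hom : ∀ {a b : Obj} {f f' : X.Hom a b} {u : f ⟶ f'} (x : El.{t} u),
    ev (T.luNat u).hom (pair (ten (ι₁ a) x) (l₁ f')) = pair (l₁ f) x
  ev_ruNat'_hom : ∀ {a b : Obj} {f f' : X.Hom a b} {u : f ⟶ f'} (x : El.{t} u),
    ev (T.ruNat' u).hom (pair x (r₁' f')) = pair (r₁' f) (ten x (ι₁ b))

namespace TricategoryEquivsElements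

attribute [simp] ev_asNat_hom ev_luNat_hom ev_ruNat'_hom

variable {T : TricategoryEquivs X} (U : TricategoryEquivsElements.{t} T) {a b c d e : Obj}
  {f f' : X.Hom a b} {g g' : X.Hom b c} {h h' : X.Hom c d} {j j' : X.Hom d e}

include U

-- The constraint in one variable incorporates `1 ⊗ 1 ≅ 1`, so the untouched variables contribute
-- the generator of a single identity 1-cell instead of a tensor of two generators.
@[simp]
lemma ev_asNat₁_hom {u : f ⟶ f'} (x : El.{t} u) (g : X.Hom b c) (h : X.Hom c d) :
    ev (T.asNat₁ u g h).hom (pair (ten (ten x (one g)) (one h)) (U.a₁ f' g h)) =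
      pair (U.a₁ f g h) (ten x (one (X.ten₀ g h))) := by
  simp only [TricategoryEquivs.asNat₁, Iso.trans_hom, ev_comp, ev_asNat_hom, whiskerLeftIso_hom,
    ev_whiskerLeft, ev_tenIso_hom, ev_tenId_hom, Iso.refl_hom, ev_id]

@[simp]
lemma ev_asNat₂_hom (f : X.Hom a b) {v : g ⟶ g'} (y : El.{t} v) (h : X.Hom c d) :
    ev (T.asNat₂ f v h).hom (pair (ten (ten (one f) y) (one h)) (U.a₁ f g' h)) =
      pair (U.a₁ f g h) (ten (one f) (ten y (one h))) :=
  U.ev_asNat_hom (one f) y (one h)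

@[simp]
lemma ev_asNat₂_inv (f : X.Hom a b) {v : g ⟶ g'} (y : El.{t} v) (h : X.Hom c d) :
    ev (T.asNat₂ f v h).inv (pair (U.a₁ f g h) (ten (one f) (ten y (one h)))) =
      pair (ten (ten (one f) y) (one h)) (U.a₁ f g' h) :=
  ev_inv _ (U.ev_asNat₂_hom f y h)

@[simp]
lemma ev_asNat₃_inv (f : X.Hom a b) (g : X.Hom b c) {w : h ⟶ h'} (z : El.{t} w) :
    ev (T.asNat₃ f g w).inv (pair (U.a₁ f g h) (ten (one f) (ten (one g) z))) =
      pair (ten (one (X.ten₀ f g)) z) (U.a₁ f g h') :=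
  ev_inv _ (by
    simp only [TricategoryEquivs.asNat₃, Iso.trans_hom, ev_comp, ev_asNat_hom, whiskerRightIso_hom,
      ev_whiskerRight, ev_tenIso_hom, Iso.symm_hom, ev_tenId_inv, Iso.refl_hom, ev_id])

end TricategoryEquivsElements

/-- Invertible 3-cells which preserve the canonical elements. -/
structure TricategoryModificationsElements {T : TricategoryEquivs X}
    (U : TricategoryEquivsElements.{t} T) where
  π : ∀ {a b c d e : Obj} (f : X.Hom a b) (g : X.Hom b c) (h : X.Hom c d) (j : X.Hom d e),
    X.ten₁ (T.as f g h) (𝟙 j) ≫ T.as f (X.ten₀ g h) j ≫ X.ten₁ (𝟙 f) (T.as g h j) ≅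
      T.as (X.ten₀ f g) h j ≫ T.as f g (X.ten₀ h j)
  μ : ∀ {a b c : Obj} (f : X.Hom a b) (g : X.Hom b c),
    X.ten₁ (T.ru' f) (𝟙 g) ≫ T.as f (X.I b) g ≫ X.ten₁ (𝟙 f) (T.lu g) ≅ 𝟙 (X.ten₀ f g)
  lam : ∀ {a b c : Obj} (f : X.Hom a b) (g : X.Hom b c),
    X.ten₁ (T.lu f) (𝟙 g) ≅ T.as (X.I a) f g ≫ T.lu (X.ten₀ f g)
  rho : ∀ {a b c : Obj} (f : X.Hom a b) (g : X.Hom b c),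
    X.ten₁ (𝟙 f) (T.ru' g) ≅ T.ru' (X.ten₀ f g) ≫ T.as f g (X.I c)
  ev_π : ∀ {a b c d e : Obj} (f : X.Hom a b) (g : X.Hom b c) (h : X.Hom c d) (j : X.Hom d e),
    ev (π f g h j).hom (pair (ten (U.a₁ f g h) (one j)) (pair (U.a₁ f (X.ten₀ g h) j)
        (ten (one f) (U.a₁ g h j)))) =
      pair (U.a₁ (X.ten₀ f g) h j) (U.a₁ f g (X.ten₀ h j))
  ev_μ : ∀ {a b c : Obj} (f : X.Hom a b) (g : X.Hom b c),
    ev (μ f g).hom (pair (ten (U.r₁' f) (one g)) (pair (U.a₁ f (X.I b) g)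
        (ten (one f) (U.l₁ g)))) = one (X.ten₀ f g)
  ev_lam : ∀ {a b c : Obj} (f : X.Hom a b) (g : X.Hom b c),
    ev (lam f g).hom (ten (U.l₁ f) (one g)) = pair (U.a₁ (X.I a) f g) (U.l₁ (X.ten₀ f g))
  ev_rho : ∀ {a b c : Obj} (f : X.Hom a b) (g : X.Hom b c),
    ev (rho f g).hom (ten (one f) (U.r₁' g)) = pair (U.r₁' (X.ten₀ f g)) (U.a₁ f g (X.I c))

namespace TricategoryModificationsElements

variable {T : TricategoryEquivs X} {U : TricategoryEquivsElements.{t} T}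
  (P : TricategoryModificationsElements U)

/-- Invertible 3-cells which preserve the canonical elements are modifications. -/
def modifications : TricategoryModifications T where
  π := P.π
  π_naturality {a b c d e f f' g g' h h' j j'} u v w x := by
    -- The common source is generated by the elements `(((m ⊗ n) ⊗ p) ⊗ q) ⊗ w`, where `m`, `n`,
    -- `p`, `q` are arbitrary and `w` is the canonical generator of the source of the pentagonator.
    -- On these, both sides give the canonical generator of the target followed by the rebracketed
    -- tensor.
    refine hom_ext (isGen_image2_pair (isGen_image2_ten (isGen_image2_ten (isGen_image2_ten
      (isGen_univ u) (isGen_univ v)) (isGen_univ w)) (isGen_univ x)) (isGen_pair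
      (isGen_ten (U.isGen_a₁ f' g' h') (isGen_one j')) (isGen_pair (U.isGen_a₁ f' _ j')
        (isGen_ten (isGen_one f') (U.isGen_a₁ g' h' j'))))) ?_
    rintro _ ⟨_, ⟨_, ⟨_, ⟨m, -, n, -, rfl⟩, p, -, rfl⟩, q, -, rfl⟩, _, rfl, rfl⟩
    rw [ev_comp, ev_comp, ev_whiskerLeft, P.ev_π, ev_sqPaste _ _ (U.ev_asNat_hom (ten m n) p q)
      (U.ev_asNat_hom m n (ten p q)), ev_sqPaste _ _
      (ev_sqMap _ _ (U.ev_asNat_hom m n p) (ev_sqId q)) (ev_sqPaste _ _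
        (U.ev_asNat_hom m (ten n p) q) (ev_sqMap _ _ (ev_sqId m) (U.ev_asNat_hom n p q))),
      ev_whiskerRight, P.ev_π]
  μ := P.μ
  μ_naturality {a b c f f' g g'} u v := by
    refine hom_ext (isGen_image2_pair (isGen_image2_ten (isGen_univ u) (isGen_univ v)) (isGen_pair
      (isGen_ten (U.isGen_r₁' f') (isGen_one g')) (isGen_pair (U.isGen_a₁ f' _ g')
        (isGen_ten (isGen_one f') (U.isGen_l₁ g'))))) ?_
    rintro _ ⟨_, ⟨m, -, n, -, rfl⟩, _, rfl, rfl⟩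
    rw [ev_comp, ev_comp, ev_whiskerLeft, P.ev_μ, ev_sqId, ev_sqPaste _ _
      (ev_sqMap _ _ (U.ev_ruNat'_hom m) (ev_sqId n)) (ev_sqPaste _ _
        (U.ev_asNat_hom m (U.ι₁ b) n) (ev_sqMap _ _ (ev_sqId m) (U.ev_luNat_hom n))),
      ev_whiskerRight, P.ev_μ]
  lam := P.lam
  lam_naturality {a b c f f' g g'} u v := by
    -- In the slot of the unit 1-cell the one generator `ι₁` suffices. This matters because the
    -- constraint of `l` is prescribed only on that element.
    refine hom_ext (isGen_image2_pair (isGen_image2_ten (isGen_image2_ten U.isGen_ι₁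
      (isGen_univ u)) (isGen_univ v)) (isGen_ten (U.isGen_l₁ f') (isGen_one g'))) ?_
    rintro _ ⟨_, ⟨_, ⟨_, rfl, m, -, rfl⟩, n, -, rfl⟩, _, rfl, rfl⟩
    rw [ev_comp, ev_comp, ev_whiskerLeft, P.ev_lam, ev_sqPaste _ _
      (U.ev_asNat_hom (U.ι₁ a) m n) (U.ev_luNat_hom (ten m n)),
      ev_sqMap _ _ (U.ev_luNat_hom m) (ev_sqId n), ev_whiskerRight, P.ev_lam]
  rho := P.rho
  rho_naturality {a b c f f' g g'} u v := by
    refine hom_ext (isGen_image2_pair (isGen_image2_ten (isGen_univ u) (isGen_univ v))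
      (isGen_ten (isGen_one f') (U.isGen_r₁' g'))) ?_
    rintro _ ⟨_, ⟨m, -, n, -, rfl⟩, _, rfl, rfl⟩
    rw [ev_comp, ev_comp, ev_whiskerLeft, P.ev_rho, ev_sqPaste _ _
      (U.ev_ruNat'_hom (ten m n)) (U.ev_asNat_hom m n (U.ι₁ c)),
      ev_sqMap _ _ (ev_sqId m) (U.ev_ruNat'_hom n), ev_whiskerRight, P.ev_rho]

/-- The source is generated by the single canonical tensor of the six associators. Each 3-cell in
either pasting preserves canonical tensors, so both pastings send it to the canonical tensor of the
three associators of the target. -/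
theorem cocycle : P.modifications.Cocycle := by
  intro a b c d e z f g h j l
  refine hom_ext_of_isGen (x := pair (ten (ten (U.a₁ f g h) (one j)) (one l))
    (pair (ten (U.a₁ f (X.ten₀ g h) j) (one l)) (pair (ten (ten (one f) (U.a₁ g h j)) (one l))
      (pair (U.a₁ f (X.ten₀ g (X.ten₀ h j)) l) (pair (ten (one f) (U.a₁ g (X.ten₀ h j) l))
        (ten (one f) (ten (one g) (U.a₁ h j l)))))))) ?_ ?_
  · repeat' first | apply isGen_pair | apply isGen_ten | apply isGen_one | apply U.isGen_a₁
  -- Unfolding `⊗≫` exposes associators and unitors, which act on tensors of elements by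
  -- rebracketing and by inserting or deleting `1`.
  · simp [bicategoricalComp, modifications, P.ev_π]

/-- The same principle: on the canonical generator each side ends at the generator of `a`, the `1`
produced by `μ` being absorbed by a unitor. -/
theorem leftNormalization : P.modifications.LeftNormalization := by
  intro a b c d f g h
  refine hom_ext_of_isGen (x := pair (ten (ten (U.r₁' f) (one g)) (one h))
    (pair (ten (U.a₁ f (X.I b) g) (one h)) (pair (ten (ten (one f) (U.l₁ g)) (one h))
      (U.a₁ f g h)))) ?_ ?_
  · repeat' first | apply isGen_pair | apply isGen_ten | apply isGen_one | apply U.isGen_a₁ |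
      apply U.isGen_l₁ | apply U.isGen_r₁'
  · simp [bicategoricalComp, modifications, P.ev_π, P.ev_μ, P.ev_lam]

theorem rightNormalization : P.modifications.RightNormalization := by
  intro a b c d f g h
  refine hom_ext_of_isGen (x := pair (U.a₁ f g h) (pair (ten (one f) (ten (U.r₁' g) (one h)))
    (pair (ten (one f) (U.a₁ g (X.I c) h)) (ten (one f) (ten (one g) (U.l₁ h)))))) ?_ ?_
  · repeat' first | apply isGen_pair | apply isGen_ten | apply isGen_one | apply U.isGen_a₁ |
      apply U.isGen_l₁ | apply U.isGen_r₁'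
  · simp [bicategoricalComp, modifications, P.ev_π, P.ev_μ, P.ev_rho]

/-- The tricategory determined by 3-cells which preserve the canonical elements. -/
def tricategory : Tricategory X where
  __ := T
  modifications := P.modifications
  cocycle := P.cocycle
  left_normalization := P.leftNormalization
  right_normalization := P.rightNormalization

end TricategoryModificationsElements

end Coherence

/-! ### Generating sets of bimodules and the elements of `T(A, B)` -/

section BimoduleElements

variable {k : Type u} [Field k] {A B C : CommAlgCat.{v} k}

open scoped CategoryTheory.Prod

namespace CompatBimod

/-- The elements `d · x` for `x` in a set of elements of a bimodule. -/
def lactSet {D E : CentralAlg A B} {M : CompatBimod D E} (S : Set M.carrier) : Set M.carrier :=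
  {y | ∃ (d : D), ∃ x ∈ S, M.lact d x = y}

/-- A set of elements generates a bimodule as a left module. -/
def Generates {D E : CentralAlg A B} {M : CompatBimod D E} (S : Set M.carrier) : Prop :=
  Submodule.span k (lactSet S) = ⊤

variable {D E F : CentralAlg A B}

lemma generates_of_surjective {M : CompatBimod D E} {x : M.carrier}
    (h : Function.Surjective fun d : D => M.lact d x) : Generates {x} :=
  eq_top_iff.2 fun y _ => by
    obtain ⟨d, rfl⟩ := h y
    exact Submodule.subset_span ⟨d, x, rfl, rfl⟩

lemma generates_univ (M : CompatBimod D E) : Generates (Set.univ : Set M.carrier) :=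
  eq_top_iff.2 fun y _ => Submodule.subset_span
    ⟨1, y, trivial, congrArg (fun f : Module.End k M.carrier => f y) (map_one M.lact)⟩

/-- Linearity over `k` and over the left algebra already determines a bimodule homomorphism; the
right action plays no role. -/
lemma Generates.hom_ext {M N : CompatBimod D E} {S : Set M.carrier} (hS : Generates S)
    {f g : M ⟶ N} (h : ∀ x ∈ S, f.toLin x = g.toLin x) : f = g :=
  hom_ext' <| LinearMap.ext_on hS <| by
    rintro _ ⟨d, x, hx, rfl⟩
    rw [f.map_lact, g.map_lact, h x hx]

/-- One has `m ⊗ (e · t) = (m · e) ⊗ t`, so the second factor can be taken in `T`. The element `m ·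
e` is then expanded in multiples `d · s`, whose scalars act on the whole tensor. Thus one-sided
generation survives the tensor product over a noncommutative middle algebra. -/
lemma Generates.image2_tmul {M : CompatBimod D E} {N : CompatBimod E F} {S : Set M.carrier}
    {T : Set N.carrier} (hS : Generates S) (hT : Generates T) :
    Generates (M := M.tensor N) (Set.image2 (fun x y => tmul M N x y) S T) := by
  have h₁ (m : M.carrier) (t : N.carrier) (ht : t ∈ T) : tmul M N m t ∈ Submodule.span k
      (lactSet (M := M.tensor N) (Set.image2 (fun x y => tmul M N x y) S T)) := by
    have hm : m ∈ Submodule.span k (lactSet S) := hS ▸ Submodule.mem_top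
    induction hm using Submodule.span_induction with
    | zero => simp only [map_zero, LinearMap.zero_apply, zero_mem]
    | add x y _ _ hx hy => simpa only [map_add, LinearMap.add_apply] using add_mem hx hy
    | smul c x _ hx =>
      simpa only [map_smul, LinearMap.smul_apply] using Submodule.smul_mem _ c hx
    | mem x hx =>
      obtain ⟨d, s, hs, rfl⟩ := hx
      exact Submodule.subset_span ⟨d, _, ⟨s, hs, t, ht, rfl⟩, rfl⟩
  refine Submodule.eq_top_iff'.2 fun z => ?_
  induction z using tensor_induction with
  | h0 => exact zero_mem _
  | h2 x y hx hy => exact add_mem hx hy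
  | h1 m n =>
  have hn : n ∈ Submodule.span k (lactSet T) := hT ▸ Submodule.mem_top
  induction hn using Submodule.span_induction with
  | zero => simp only [map_zero, zero_mem]
  | add x y _ _ hx hy => simpa only [map_add] using add_mem hx hy
  | smul c x _ hx => simpa only [map_smul] using Submodule.smul_mem _ c hx
  | mem x hx =>
    obtain ⟨e, t, ht, rfl⟩ := hx
    rw [← tmul_bal]
    exact h₁ _ t ht

/-- Here both factors keep their left actions, and `(d · s) ⊗ (e · t) = (d ⊗ e) · (s ⊗ t)`. -/
lemma Generates.image2_btmul {D D' : CentralAlg A B} {E E' : CentralAlg B C}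
    {M : CompatBimod D D'} {N : CompatBimod E E'} {S : Set M.carrier}
    {T : Set N.carrier} (hS : Generates S) (hT : Generates T) :
    Generates (M := M.box N) (Set.image2 (fun x y => btmul M N x y) S T) := by
  refine Submodule.eq_top_iff'.2 fun z => ?_
  induction z using box_induction with
  | h0 => exact zero_mem _
  | h2 x y hx hy => exact add_mem hx hy
  | h1 m n =>
  have hm : m ∈ Submodule.span k (lactSet S) := hS ▸ Submodule.mem_top
  have hn : n ∈ Submodule.span k (lactSet T) := hT ▸ Submodule.mem_top
  induction hm using Submodule.span_induction with
  | zero => simp only [map_zero, LinearMap.zero_apply, zero_mem]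
  | add x y _ _ hx hy => simpa only [map_add, LinearMap.add_apply] using add_mem hx hy
  | smul c x _ hx => simpa only [map_smul, LinearMap.smul_apply] using Submodule.smul_mem _ c hx
  | mem x hx =>
  induction hn using Submodule.span_induction with
  | zero => simp only [map_zero, zero_mem]
  | add x y _ _ hx hy => simpa only [map_add] using add_mem hx hy
  | smul c x _ hx => simpa only [map_smul] using Submodule.smul_mem _ c hx
  | mem y hy =>
    obtain ⟨d, s, hs, rfl⟩ := hx
    obtain ⟨e, t, ht, rfl⟩ := hy
    exact Submodule.subset_span ⟨CentralAlg.pure d e, _, ⟨s, hs, t, ht, rfl⟩, rfl⟩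

end CompatBimod

open CompatBimod in
/-- The elements of the 1-cells of `T(A, B)` are the elements of the bimodules. -/
instance CentralAlg.bicategoryElements (A B : CommAlgCat.{v} k) :
    BicategoryElements.{v} (CentralAlg A B) where
  El M := CompatBimod.carrier M
  ev θ x := ComAlg.app θ x
  pair {_ E _ M N} x y := CompatBimod.tmul (E := E) M N x y
  one D := ComAlg.one D
  ev_id _ := rfl
  ev_comp _ _ _ := rfl
  ev_whiskerLeft _ _ _ _ _ _ := rfl
  ev_whiskerRight _ _ _ _ := rfl
  ev_associator_hom _ _ _ := rfl
  ev_leftUnitor_hom {_ _ M} x := congrArg (fun f : Module.End k M.carrier => f x) (map_one M.lact)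
  ev_rightUnitor_hom {_ _ M} x := congrArg (fun f : Module.End k M.carrier => f x) (map_one M.ract)
  IsGen S := Generates S
  isGen_univ M := generates_univ M
  isGen_one D := generates_of_surjective (M := regular D) fun d => ⟨d, mul_one (M := D.carrier) d⟩
  isGen_image2_pair hS hT := Generates.image2_tmul hS hT
  hom_ext hS _ _ h := Generates.hom_ext hS h

/-- The elements `m ⊗ n` of the composites of bimodules. -/
instance comAlgBase.elements (k : Type u) [Field k] :
    TricategoryBaseElements.{v} (comAlgBase.{u, v} k) where
  hom A B := CentralAlg.bicategoryElements A B
  ten {_ _ _ D D' E E' M N} x y :=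
    CompatBimod.btmul (D := D) (D' := D') (E := E) (E' := E') M N x y
  ev_ten₂ _ _ _ _ := rfl
  ev_tenId_hom _ _ := rfl
  ev_mapComp_hom _ _ _ _ := rfl
  isGen_image2_ten hS hT := CompatBimod.Generates.image2_btmul hS hT

end BimoduleElements

/-! ### Companions of algebra isomorphisms and semilinear maps -/

section Companions

variable {k : Type u} [Field k] {A B C : CommAlgCat.{v} k}

namespace CompatBimod

lemma lact_one {D E : CentralAlg A B} (M : CompatBimod D E) (m : M.carrier) : M.lact 1 m = m :=
  congrArg (fun f : Module.End k M.carrier => f m) (map_one M.lact)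

lemma ract_one {D E : CentralAlg A B} (M : CompatBimod D E) (m : M.carrier) :
    M.ract (op 1) m = m :=
  congrArg (fun f : Module.End k M.carrier => f m) (map_one M.ract)

lemma lact_mul {D E : CentralAlg A B} (M : CompatBimod D E) (d d' : D) (m : M.carrier) :
    M.lact (d * d') m = M.lact d (M.lact d' m) :=
  congrArg (fun f : Module.End k M.carrier => f m) (map_mul M.lact d d')

lemma ract_mul {D E : CentralAlg A B} (M : CompatBimod D E) (e e' : E) (m : M.carrier) :
    M.ract (op (e * e')) m = M.ract (op e') (M.ract (op e) m) :=
  congrArg (fun f : Module.End k M.carrier => f m) (map_mul M.ract (op e') (op e))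

/-- The bimodule `U` is free on `u` as a left module, and `d · u = u · φ(d)` for an isomorphism
of algebras `φ`. -/
structure IsCompanion {D E : CentralAlg A B} (U : CompatBimod D E) (φ : D ≃ₐ[k] E)
    (u : U.carrier) : Prop where
  comm : ∀ d, U.lact d u = U.ract (op (φ d)) u
  bij : Function.Bijective fun d : D => U.lact d u

namespace IsCompanion

variable {D E F : CentralAlg A B} {U : CompatBimod D E} {φ : D ≃ₐ[k] E} {u : U.carrier}

section

variable (hU : IsCompanion U φ u)

include hU

lemma generates : Generates {u} := generates_of_surjective hU.bij.2

/-- On the generator the right action is a left action. Thus, in the coordinate `d ↦ d · u`, the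
bimodule is `D` with its right action twisted by the inverse of `φ`. -/
lemma ract_eq (e : E) : U.ract (op e) u = U.lact (φ.symm e) u := by
  rw [hU.comm, φ.apply_symm_apply]

/-- The linear isomorphism `d ↦ d · u`. -/
noncomputable def lactEquiv : D ≃ₗ[k] U.carrier :=
  LinearEquiv.ofBijective (U.lact.toLinearMap.flip u) hU.bij

lemma lactEquiv_apply (d : D) : hU.lactEquiv d = U.lact d u := rfl

lemma lactEquiv_symm_lact (d : D) (x : U.carrier) :
    hU.lactEquiv.symm (U.lact d x) = d * hU.lactEquiv.symm x := by
  rw [LinearEquiv.symm_apply_eq, lactEquiv_apply, lact_mul, ← lactEquiv_apply hU,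
    LinearEquiv.apply_symm_apply]

lemma lactEquiv_symm_ract (e : E) (x : U.carrier) :
    hU.lactEquiv.symm (U.ract (op e) x) = hU.lactEquiv.symm x * φ.symm e := by
  rw [LinearEquiv.symm_apply_eq, lactEquiv_apply, lact_mul, ← ract_eq hU, U.lact_ract,
    ← lactEquiv_apply hU, LinearEquiv.apply_symm_apply]

/-- The linear isomorphism `n ↦ u ⊗ n`. -/
noncomputable def tmulLeftEquiv (N : CompatBimod E F) : N.carrier ≃ₗ[k] (U.tensor N).carrier :=
  LinearEquiv.ofLinearMap (tmul U N u)
    -- The inverse is `(d · u) ⊗ n ↦ φ(d) · n`, as forced by `d · u = u · φ(d)`. Balancing holds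
    -- because right multiplication by `e` replaces `d` by `d φ⁻¹(e)`.
    (lift (N.lact.toLinearMap ∘ₗ φ.toLinearMap ∘ₗ hU.lactEquiv.symm.toLinearMap) fun e m n => by
      change N.lact (φ (hU.lactEquiv.symm _)) n = N.lact (φ (hU.lactEquiv.symm m)) (N.lact e n)
      rw [lactEquiv_symm_ract, map_mul, φ.apply_symm_apply, lact_mul])
    (lin_ext fun m n => by
      obtain ⟨d, rfl⟩ := hU.lactEquiv.surjective m
      change tmul U N u (N.lact (φ (hU.lactEquiv.symm _)) n) = _
      rw [LinearEquiv.symm_apply_apply, ← tmul_bal, ← hU.comm]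
      rfl)
    (LinearMap.ext fun n => by
      change N.lact (φ (hU.lactEquiv.symm u)) n = n
      have : hU.lactEquiv.symm u = 1 := by
        rw [LinearEquiv.symm_apply_eq, lactEquiv_apply, lact_one]
      rw [this, map_one, lact_one])

/-- The linear isomorphism `m ↦ m ⊗ u`. -/
noncomputable def tmulRightEquiv (M : CompatBimod F D) : M.carrier ≃ₗ[k] (M.tensor U).carrier :=
  LinearEquiv.ofLinearMap ((tmul M U).flip u)
    -- The inverse is `m ⊗ (d · u) ↦ m · d`; only freeness of `U` on the left is used, not `φ`.
    (lift ((M.ract.toLinearMap ∘ₗ (MulOpposite.opLinearEquiv k).toLinearMap ∘ₗ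
        hU.lactEquiv.symm.toLinearMap).flip) fun e m n => by
      change M.ract (op (hU.lactEquiv.symm n)) (M.ract (op e) m) =
        M.ract (op (hU.lactEquiv.symm (U.lact e n))) m
      rw [lactEquiv_symm_lact, ract_mul])
    (lin_ext fun m n => by
      obtain ⟨d, rfl⟩ := hU.lactEquiv.surjective n
      change tmul M U (M.ract (op (hU.lactEquiv.symm _)) m) u = _
      rw [LinearEquiv.symm_apply_apply, tmul_bal]
      rfl)
    (LinearMap.ext fun n => by
      change M.ract (op (hU.lactEquiv.symm u)) n = n
      have : hU.lactEquiv.symm u = 1 := by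
        rw [LinearEquiv.symm_apply_eq, lactEquiv_apply, lact_one]
      rw [this, ract_one])

lemma tmulRightEquiv_apply (M : CompatBimod F D) (m : M.carrier) :
    hU.tmulRightEquiv M m = tmul M U m u := rfl

lemma tmulRightEquiv_symm_tmul (M : CompatBimod F D) (m : M.carrier) :
    (hU.tmulRightEquiv M).symm (tmul M U m u) = m :=
  (hU.tmulRightEquiv M).symm_apply_apply m

/-- Scalars pass through both generators: `d · u ⊗ v = u ⊗ φ(d) · v = u ⊗ v · ψ(φ(d))`. The orbit
map of `u ⊗ v` is therefore the composite of the bijections `φ`, `e ↦ e · v` and `n ↦ u ⊗ n`. -/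
lemma tensor {V : CompatBimod E F} {ψ : E ≃ₐ[k] F} {v : V.carrier} (hV : IsCompanion V ψ v) :
    IsCompanion (U.tensor V) (φ.trans ψ) (tmul U V u v) where
  comm d := by
    rw [lact_tmul, hU.comm, tmul_bal, hV.comm]
    rfl
  bij := by
    have : (fun d : D => (U.tensor V).lact d (tmul U V u v)) =
        (hU.tmulLeftEquiv V) ∘ hV.lactEquiv ∘ φ := by
      funext d
      rw [lact_tmul, hU.comm, tmul_bal]
      rfl
    rw [this]
    exact (LinearEquiv.bijective _).comp ((LinearEquiv.bijective _).comp φ.bijective)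

end

lemma regular (D : CentralAlg A B) : IsCompanion (regular D) AlgEquiv.refl (reg 1) where
  comm d := (mul_one (M := D.carrier) d).trans (one_mul (M := D.carrier) d).symm
  bij := by
    have : (fun d : D => (CompatBimod.regular D).lact d (reg 1)) = id :=
      funext fun d => mul_one (M := D.carrier) d
    rw [this]
    exact Function.bijective_id

/-- The isomorphism between two companions of the same isomorphism of algebras. -/
noncomputable def iso {V : CompatBimod D E} {ψ : D ≃ₐ[k] E} {v : V.carrier}
    (hU : IsCompanion U φ u) (hV : IsCompanion V ψ v) (h : ∀ d, φ d = ψ d) : U ≅ V :=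
  isoOfInv
    (M := U) (N := V)
    { toLin := (hU.lactEquiv.symm ≪≫ₗ hV.lactEquiv).toLinearMap
      map_lact := fun d x => by
        change V.lact (hU.lactEquiv.symm (U.lact d x)) v = V.lact d (V.lact _ v)
        rw [lactEquiv_symm_lact, lact_mul]
        rfl
      map_ract := fun e x => by
        obtain ⟨e, rfl⟩ := op_surjective e
        change V.lact (hU.lactEquiv.symm (U.ract (op e) x)) v = V.ract (op e) (V.lact _ v)
        -- Matching `d · u` with `d · v` is left linear in any case. Right linearity is where the
        -- two algebra isomorphisms have to agree.
        rw [lactEquiv_symm_ract, lact_mul, hV.comm, ← h, φ.apply_symm_apply, V.lact_ract]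
        rfl }
    (hV.lactEquiv.symm ≪≫ₗ hU.lactEquiv).toLinearMap (fun x => by simp) (fun x => by simp)

/-- The case `d = 1` of `d · u ↦ d · v`. All the prescribed values of the modifications, units and
counits come from this. -/
lemma iso_hom_apply {V : CompatBimod D E} {ψ : D ≃ₐ[k] E} {v : V.carrier}
    (hU : IsCompanion U φ u) (hV : IsCompanion V ψ v) (h : ∀ d, φ d = ψ d) :
    (iso hU hV h).hom.toLin u = v := by
  change V.lact (hU.lactEquiv.symm u) v = v
  have : hU.lactEquiv.symm u = 1 := by
    rw [LinearEquiv.symm_apply_eq, lactEquiv_apply, lact_one]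
  rw [this, lact_one]

end IsCompanion

/-- Linear isomorphisms between bimodules which are semilinear with respect to isomorphisms of
algebras. -/
structure SemilinearEquiv {D D' E E' : CentralAlg A B} (φ : D ≃ₐ[k] E) (ψ : D' ≃ₐ[k] E')
    (M : CompatBimod D D') (N : CompatBimod E E') where
  toEquiv : M.carrier ≃ₗ[k] N.carrier
  map_lact : ∀ d m, toEquiv (M.lact d m) = N.lact (φ d) (toEquiv m)
  map_ract : ∀ d m, toEquiv (M.ract (op d) m) = N.ract (op (ψ d)) (toEquiv m)

namespace SemilinearEquiv

variable {D D' E E' : CentralAlg A B} {φ : D ≃ₐ[k] E} {ψ : D' ≃ₐ[k] E'} {M : CompatBimod D D'}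
  {N : CompatBimod E E'}

/-- The inverse semilinear isomorphism. -/
def symm (θ : SemilinearEquiv φ ψ M N) : SemilinearEquiv φ.symm ψ.symm N M where
  toEquiv := θ.toEquiv.symm
  map_lact d m := by
    rw [LinearEquiv.symm_apply_eq, θ.map_lact, φ.apply_symm_apply, LinearEquiv.apply_symm_apply]
  map_ract d m := by
    rw [LinearEquiv.symm_apply_eq, θ.map_ract, ψ.apply_symm_apply, LinearEquiv.apply_symm_apply]

/-- The isomorphism `m ⊗ v ↦ u ⊗ θ(m)` between composites with companions. -/
noncomputable def square (θ : SemilinearEquiv φ ψ M N) {U : CompatBimod D E} {u : U.carrier}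
    (hU : IsCompanion U φ u) {V : CompatBimod D' E'} {v : V.carrier} (hV : IsCompanion V ψ v) :
    M.tensor V ≅ U.tensor N :=
  isoOfInv (M := M.tensor V) (N := U.tensor N)
    { toLin := ((hV.tmulRightEquiv M).symm ≪≫ₗ θ.toEquiv ≪≫ₗ hU.tmulLeftEquiv N).toLinearMap
      map_lact := fun d t => by
        obtain ⟨m, rfl⟩ := (hV.tmulRightEquiv M).surjective t
        rw [IsCompanion.tmulRightEquiv_apply, lact_tmul]
        change tmul U N u (θ.toEquiv ((hV.tmulRightEquiv M).symm (tmul M V _ v))) =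
          tmul U N (U.lact d u) (θ.toEquiv ((hV.tmulRightEquiv M).symm (tmul M V m v)))
        -- Semilinearity of `θ` yields a factor `φ(d)` behind `u`, which moves to the front as `d`:
        -- `u ⊗ φ(d) · θ(m) = d · u ⊗ θ(m)`.
        rw [hV.tmulRightEquiv_symm_tmul, hV.tmulRightEquiv_symm_tmul, θ.map_lact, hU.comm,
          tmul_bal]
      map_ract := fun e t => by
        obtain ⟨e, rfl⟩ := op_surjective e
        obtain ⟨m, rfl⟩ := (hV.tmulRightEquiv M).surjective t
        -- The scalar `e` is first moved across `v`, so that `m ⊗ v · e = m · ψ⁻¹(e) ⊗ v`;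
        -- semilinearity of `θ` then restores `e`.
        rw [IsCompanion.tmulRightEquiv_apply, ract_tmul, hV.ract_eq, ← tmul_bal]
        change tmul U N u (θ.toEquiv ((hV.tmulRightEquiv M).symm (tmul M V _ v))) =
          tmul U N u (N.ract (op e) (θ.toEquiv ((hV.tmulRightEquiv M).symm (tmul M V m v))))
        rw [hV.tmulRightEquiv_symm_tmul, hV.tmulRightEquiv_symm_tmul, θ.map_ract,
          ψ.apply_symm_apply] }
    ((hU.tmulLeftEquiv N).symm ≪≫ₗ θ.toEquiv.symm ≪≫ₗ hV.tmulRightEquiv M).toLinearMap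
    (fun x => by simp) (fun x => by simp)

lemma square_hom_tmul (θ : SemilinearEquiv φ ψ M N) {U : CompatBimod D E} {u : U.carrier}
    (hU : IsCompanion U φ u) {V : CompatBimod D' E'} {v : V.carrier} (hV : IsCompanion V ψ v)
    (m : M.carrier) :
    (θ.square hU hV).hom.toLin (tmul M V m v) = tmul U N u (θ.toEquiv m) := by
  change hU.tmulLeftEquiv N (θ.toEquiv ((hV.tmulRightEquiv M).symm (hV.tmulRightEquiv M m))) = _
  rw [LinearEquiv.symm_apply_apply]
  rfl

end SemilinearEquiv

end CompatBimod

end Companions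

/-! ### From semilinear transformations to adjoint equivalences of pseudofunctors -/

section SemilinearTransformations

universe w₁ w₂ w₃

variable {k : Type u} [Field k] {A B : CommAlgCat.{v} k} {X : Type w₁} [Bicategory.{w₃, w₂} X]

open CompatBimod BicategoryElements
open scoped Pseudofunctor.StrongTrans

/-- Since `f` is onto and left linear, it carries generators to generators. The purpose is to
generate the value of a pseudofunctor at an identity or at a composite by transport along its
inverse constraints. -/
lemma CompatBimod.Generates.image {D E : CentralAlg A B} {M N : CompatBimod D E} (f : M ≅ N)
    {S : Set M.carrier} (hS : Generates S) : Generates (f.hom.toLin '' S) := by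
  refine Submodule.eq_top_iff'.2 fun y => ?_
  obtain ⟨x, rfl⟩ : ∃ x, f.hom.toLin x = y :=
    ⟨f.inv.toLin y, by rw [← comp_apply, f.inv_hom_id, id_apply]⟩
  have hx : x ∈ Submodule.span k (lactSet S) := hS ▸ Submodule.mem_top
  induction hx using Submodule.span_induction with
  | zero => simp only [map_zero, zero_mem]
  | add x y _ _ hx hy => simpa only [map_add] using add_mem hx hy
  | smul c x _ hx => simpa only [map_smul] using Submodule.smul_mem _ c hx
  | mem x hx =>
    obtain ⟨d, s, hs, rfl⟩ := hx
    exact Submodule.subset_span ⟨d, _, ⟨s, hs, rfl⟩, (f.hom.map_lact d s).symm⟩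

lemma BicategoryElements.isGen_image {D E : CentralAlg A B} {M N : D ⟶ E} (f : M ≅ N)
    {S : Set (El M)} (hS : IsGen S) : IsGen (ev f.hom '' S) :=
  Generates.image f hS

/-- An isomorphism between pseudofunctors with values in `T(A, B)`, given by isomorphisms of
algebras and by semilinear isomorphisms of bimodules. -/
structure SemilinearTrans (F G : X ⥤ᵖ CentralAlg A B) where
  equiv : ∀ x, F.obj x ≃ₐ[k] G.obj x
  semilinear : ∀ {x y} (f : x ⟶ y), SemilinearEquiv (equiv x) (equiv y) (F.map f) (G.map f)
  map₂ : ∀ {x y} {f g : x ⟶ y} (η : f ⟶ g) (m : El (F.map f)),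
    (semilinear g).toEquiv (ev (F.map₂ η) m) = ev (G.map₂ η) ((semilinear f).toEquiv m)
  mapId : ∀ x, (semilinear (𝟙 x)).toEquiv (ev (F.mapId x).inv (one (F.obj x))) =
    ev (G.mapId x).inv (one (G.obj x))
  mapComp : ∀ {x y z} (f : x ⟶ y) (g : y ⟶ z) (m : El (F.map f)) (n : El (F.map g)),
    (semilinear (f ≫ g)).toEquiv (ev (F.mapComp f g).inv (pair m n)) =
      ev (G.mapComp f g).inv (pair (f := G.map f) (g := G.map g)
        ((semilinear f).toEquiv m) ((semilinear g).toEquiv n))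

/-- Companions of a family of isomorphisms of algebras. -/
structure CompanionFamily {F G : X → CentralAlg A B} (φ : ∀ x, F x ≃ₐ[k] G x) where
  cell : ∀ x, F x ⟶ G x
  gen : ∀ x, El (cell x)
  isCompanion : ∀ x, IsCompanion (cell x) (φ x) (gen x)

namespace SemilinearTrans

variable {F G : X ⥤ᵖ CentralAlg A B}

/-- The action of the transformation on elements. -/
def onEl (Φ : SemilinearTrans F G) {x y : X} (f : x ⟶ y) (m : El (F.map f)) : El (G.map f) :=
  (Φ.semilinear f).toEquiv m

/-- A semilinear transformation is determined by its values on linear generators, and it suffices to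
check its axioms on those. -/
def ofSpan (equiv : ∀ x, F.obj x ≃ₐ[k] G.obj x)
    (semilinear : ∀ {x y} (f : x ⟶ y), SemilinearEquiv (equiv x) (equiv y) (F.map f) (G.map f))
    (S : ∀ {x y} (f : x ⟶ y), Set (CompatBimod.carrier (F.map f)))
    (hS : ∀ {x y} (f : x ⟶ y), Submodule.span k (S f) = ⊤)
    (map₂ : ∀ {x y : X} {f g : x ⟶ y} (η : f ⟶ g), ∀ m ∈ S f,
      (semilinear g).toEquiv (ev (F.map₂ η) m) = ev (G.map₂ η) ((semilinear f).toEquiv m))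
    (mapId : ∀ x, (semilinear (𝟙 x)).toEquiv (ev (F.mapId x).inv (one (F.obj x))) =
      ev (G.mapId x).inv (one (G.obj x)))
    (mapComp : ∀ {x y z} (f : x ⟶ y) (g : y ⟶ z), ∀ m ∈ S f, ∀ n ∈ S g,
      (semilinear (f ≫ g)).toEquiv (ev (F.mapComp f g).inv (pair m n)) =
        ev (G.mapComp f g).inv (pair (f := G.map f) (g := G.map g)
          ((semilinear f).toEquiv m) ((semilinear g).toEquiv n))) : SemilinearTrans F G where
  equiv := equiv
  semilinear := semilinear
  map₂ {_ _ f g} η m := LinearMap.congr_fun (LinearMap.ext_on (hS f)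
    (f := (semilinear g).toEquiv.toLinearMap ∘ₗ (F.map₂ η).toLin)
    (g := (G.map₂ η).toLin ∘ₗ (semilinear f).toEquiv.toLinearMap) (map₂ η)) m
  mapId := mapId
  -- Both sides are `k`-bilinear in `m` and `n`, so agreement on spanning sets is extended in one
  -- variable after the other.
  mapComp f g m n := LinearMap.congr_fun₂ (LinearMap.ext_on (hS f)
    (f := ((CompatBimod.tmul (F.map f) (F.map g)).compr₂ (F.mapComp f g).inv.toLin).compr₂
      (semilinear (f ≫ g)).toEquiv.toLinearMap)
    (g := ((CompatBimod.tmul (G.map f) (G.map g)).compr₂ (G.mapComp f g).inv.toLin).compl₁₂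
      (semilinear f).toEquiv.toLinearMap (semilinear g).toEquiv.toLinearMap)
    fun m hm => LinearMap.ext_on (hS g) fun n hn => mapComp f g m hm n hn) m n

/-- The inverse of an isomorphism of pseudofunctors. -/
def symm (Φ : SemilinearTrans F G) : SemilinearTrans G F where
  equiv x := (Φ.equiv x).symm
  semilinear f := (Φ.semilinear f).symm
  map₂ {x y f g} η m := by
    obtain ⟨m, rfl⟩ := (Φ.semilinear f).toEquiv.surjective m
    exact ((Φ.semilinear g).toEquiv.symm_apply_eq.2 (Φ.map₂ η m).symm).trans
      (congrArg (ev (F.map₂ η)) ((Φ.semilinear f).toEquiv.symm_apply_apply m).symm)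
  mapId x := (Φ.semilinear (𝟙 x)).toEquiv.symm_apply_eq.2 (Φ.mapId x).symm
  mapComp f g m n := by
    obtain ⟨m, rfl⟩ := (Φ.semilinear f).toEquiv.surjective m
    obtain ⟨n, rfl⟩ := (Φ.semilinear g).toEquiv.surjective n
    refine ((Φ.semilinear (f ≫ g)).toEquiv.symm_apply_eq.2 (Φ.mapComp f g m n).symm).trans ?_
    exact congrArg₂ (fun m n => ev (F.mapComp f g).inv (pair m n))
      ((Φ.semilinear f).toEquiv.symm_apply_apply m).symm
      ((Φ.semilinear g).toEquiv.symm_apply_apply n).symm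

variable (Φ : SemilinearTrans F G) (c : CompanionFamily Φ.equiv)

/-- The naturality constraint `m ⊗ u ↦ u ⊗ θ(m)`. -/
noncomputable def square {x y : X} (f : x ⟶ y) : F.map f ≫ c.cell y ≅ c.cell x ≫ G.map f :=
  (Φ.semilinear f).square (c.isCompanion x) (c.isCompanion y)

@[simp]
lemma ev_square_hom {x y : X} (f : x ⟶ y) (m : El (F.map f)) :
    ev (Φ.square c f).hom (pair m (c.gen y)) = pair (c.gen x) (Φ.onEl f m) :=
  (Φ.semilinear f).square_hom_tmul (c.isCompanion x) (c.isCompanion y) m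

lemma isGen_gen {φ : ∀ x, F.obj x ≃ₐ[k] G.obj x} (c : CompanionFamily φ) (x : X) :
    IsGen {c.gen x} := (c.isCompanion x).generates

/-- The strong transformation with companions as components. -/
noncomputable def strongTrans : F ⟶ G where
  app x := c.cell x
  naturality f := Φ.square c f
  naturality_naturality {x y f g} η := by
    refine hom_ext (isGen_image2_pair (isGen_univ _) (isGen_gen c y)) ?_
    rintro _ ⟨m, -, _, rfl, rfl⟩
    rw [ev_comp, ev_comp, ev_whiskerRight, ev_square_hom, ev_square_hom, ev_whiskerLeft]
    exact congrArg (pair _) (Φ.map₂ η m)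
  naturality_id x := by
    -- The value of `F` at the identity is generated by the preimage of `1` under the unit
    -- constraint, and on this element the constraint simply cancels.
    refine hom_ext (isGen_image2_pair (isGen_image (F.mapId x).symm (isGen_one _))
      (isGen_gen c x)) ?_
    rintro _ ⟨_, ⟨_, rfl, rfl⟩, _, rfl, rfl⟩
    have h : Φ.onEl (𝟙 x) (ev (F.mapId x).inv (one (F.obj x))) =
      ev (G.mapId x).inv (one (G.obj x)) := Φ.mapId x
    simp only [ev_comp, ev_square_hom, Iso.symm_hom, h, ev_whiskerLeft, ev_whiskerRight,
      ev_leftUnitor_hom, ev_rightUnitor_inv, ← ev_comp _ _ (one _), Iso.inv_hom_id, ev_id]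
  naturality_comp {x y z} f g := by
    -- Likewise, the value of `F` at a composite is generated by the preimages of the tensors `m ⊗
    -- n`, for which the compatibility of the semilinear maps with the composition constraints is
    -- available.
    refine hom_ext (isGen_image2_pair (isGen_image (F.mapComp f g).symm
      (isGen_image2_pair (isGen_univ _) (isGen_univ _))) (isGen_gen c z)) ?_
    rintro _ ⟨_, ⟨_, ⟨m, -, n, -, rfl⟩, rfl⟩, _, rfl, rfl⟩
    have h : Φ.onEl (f ≫ g) (ev (F.mapComp f g).inv (pair m n)) =
      ev (G.mapComp f g).inv (pair (Φ.onEl f m) (Φ.onEl g n)) := Φ.mapComp f g m n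
    simp only [ev_comp, ev_square_hom, Iso.symm_hom, h, ev_whiskerLeft, ev_whiskerRight,
      ev_associator_hom, ev_associator_inv, ← ev_comp _ _ (pair _ _), Iso.inv_hom_id, ev_id]

variable (c' : CompanionFamily Φ.symm.equiv)

/-- The isomorphism `1 ↦ u ⊗ u'`. -/
noncomputable def unitIso (x : X) : 𝟙 (F.obj x) ≅ c.cell x ≫ c'.cell x :=
  (IsCompanion.regular (F.obj x)).iso ((c.isCompanion x).tensor (c'.isCompanion x))
    fun d => ((Φ.equiv x).symm_apply_apply d).symm

@[simp]
lemma ev_unitIso_hom (x : X) :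
    ev (Φ.unitIso c c' x).hom (one (F.obj x)) = pair (c.gen x) (c'.gen x) :=
  IsCompanion.iso_hom_apply _ _ _

/-- The isomorphism `u' ⊗ u ↦ 1`. -/
noncomputable def counitIso (x : X) : c'.cell x ≫ c.cell x ≅ 𝟙 (G.obj x) :=
  ((c'.isCompanion x).tensor (c.isCompanion x)).iso (IsCompanion.regular (G.obj x))
    fun d => (Φ.equiv x).apply_symm_apply d

@[simp]
lemma ev_counitIso_hom (x : X) :
    ev (Φ.counitIso c c' x).hom (pair (c'.gen x) (c.gen x)) = one (G.obj x) :=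
  IsCompanion.iso_hom_apply _ _ _

lemma onEl_symm {x y : X} (f : x ⟶ y) (m : El (F.map f)) :
    Φ.symm.onEl f (Φ.onEl f m) = m :=
  (Φ.semilinear f).toEquiv.symm_apply_apply m

lemma symm_onEl {x y : X} (f : x ⟶ y) (m : El (G.map f)) :
    Φ.onEl f (Φ.symm.onEl f m) = m :=
  (Φ.semilinear f).toEquiv.apply_symm_apply m

/-- After `m ⊗ 1 ↦ m ⊗ (u ⊗ u')`, the element `m` passes `u` and becomes `θ(m)`, then passes `u'`
and becomes `θ⁻¹(θ(m)) = m`. The result is `(u ⊗ u') ⊗ m`, which is also what the other side gives.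
-/
lemma unitIso_naturality {x y : X} (f : x ⟶ y) :
    F.map f ◁ (Φ.unitIso c c' y).hom ≫ (α_ (F.map f) (c.cell y) (c'.cell y)).inv ≫
        (Φ.square c f).hom ▷ c'.cell y ≫ (α_ (c.cell x) (G.map f) (c'.cell y)).hom ≫
          c.cell x ◁ (Φ.symm.square c' f).hom ≫ (α_ (c.cell x) (c'.cell x) (F.map f)).inv =
      ((ρ_ (F.map f)).hom ≫ (λ_ (F.map f)).inv) ≫ (Φ.unitIso c c' x).hom ▷ F.map f := by
  refine hom_ext (isGen_image2_pair (isGen_univ _) (isGen_one _)) ?_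
  rintro _ ⟨m, -, _, rfl, rfl⟩
  simp [onEl_symm]

/-- The mirror image of the argument for the unit: passing `u'` and then `u` applies `θ⁻¹` and then
`θ`, and both sides give `1 ⊗ m`. -/
lemma counitIso_naturality {x y : X} (f : x ⟶ y) :
    G.map f ◁ (Φ.counitIso c c' y).hom ≫ (ρ_ (G.map f)).hom ≫ (λ_ (G.map f)).inv =
      ((α_ (G.map f) (c'.cell y) (c.cell y)).inv ≫ (Φ.symm.square c' f).hom ▷ c.cell y ≫
        (α_ (c'.cell x) (F.map f) (c.cell y)).hom ≫ c'.cell x ◁ (Φ.square c f).hom ≫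
          (α_ (c'.cell x) (c.cell x) (G.map f)).inv) ≫ (Φ.counitIso c c' x).hom ▷ G.map f := by
  refine hom_ext (isGen_image2_pair (isGen_univ _)
    (isGen_pair (isGen_gen c' y) (isGen_gen c y))) ?_
  rintro _ ⟨m, -, _, rfl, rfl⟩
  simp [symm_onEl]

/-- On the generator `1 ⊗ u` the left side runs through `(u ⊗ u') ⊗ u` and `u ⊗ (u' ⊗ u)` to `u ⊗
1`, which is also the value of the unitors. -/
lemma unitIso_counitIso_triangle (x : X) :
    (Φ.unitIso c c' x).hom ▷ c.cell x ≫ (α_ (c.cell x) (c'.cell x) (c.cell x)).hom ≫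
        c.cell x ◁ (Φ.counitIso c c' x).hom =
      (λ_ (c.cell x)).hom ≫ (ρ_ (c.cell x)).inv := by
  refine hom_ext_of_isGen (isGen_pair (isGen_one _) (isGen_gen c x)) ?_
  simp

/-- The adjoint equivalence of pseudofunctors with companions as components. -/
noncomputable def equivalence : F ≌ G where
  hom := Φ.strongTrans c
  inv := Φ.symm.strongTrans c'
  unit := Pseudofunctor.StrongTrans.isoMk (Φ.unitIso c c') (Φ.unitIso_naturality c c')
  counit := Pseudofunctor.StrongTrans.isoMk (Φ.counitIso c c') (Φ.counitIso_naturality c c')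
  left_triangle := by
    -- Unit and counit being invertible, one triangle identity implies the other, and it is checked
    -- on components.
    ext x
    simp [bicategoricalIsoComp]
    exact Φ.unitIso_counitIso_triangle c c' x

end SemilinearTrans

end SemilinearTransformations

/-! ### Canonical algebra isomorphisms and their companion bimodules -/

section CanonicalCompanions

variable {k : Type u} [Field k] {A B C A₁ A₂ A₃ A₄ : CommAlgCat.{v} k}

namespace CentralAlg

/-- The homomorphism of algebras `φ ⊗ ψ`. -/
def tensorMap {D D' : CentralAlg A B} {E E' : CentralAlg B C} (φ : D →ₐ[k] D') (ψ : E →ₐ[k] E')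
    (hφ : ∀ b, φ (D.right b) = D'.right b) (hψ : ∀ b, ψ (E.left b) = E'.left b) :
    D.tensor E →ₐ[k] D'.tensor E' :=
  desc D E ((toL D' E').comp φ) ((toR D' E').comp ψ) (fun d e => toL_comm_toR D' E' (φ d) (ψ e))
    (fun b => by rw [AlgHom.comp_apply, AlgHom.comp_apply, hφ, hψ, toL_right])

lemma tensorMap_pure {D D' : CentralAlg A B} {E E' : CentralAlg B C} (φ : D →ₐ[k] D')
    (ψ : E →ₐ[k] E') (hφ : ∀ b, φ (D.right b) = D'.right b)
    (hψ : ∀ b, ψ (E.left b) = E'.left b) (d : D) (e : E) :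
    tensorMap φ ψ hφ hψ (pure d e) = pure (φ d) (ψ e) :=
  toL_mul_toR D' E' (φ d) (ψ e)

lemma tensorMap_comp_tensorMap {D D' : CentralAlg A B} {E E' : CentralAlg B C} (φ : D →ₐ[k] D')
    (ψ : E →ₐ[k] E') (hφ : ∀ b, φ (D.right b) = D'.right b)
    (hψ : ∀ b, ψ (E.left b) = E'.left b) (φ' : D' →ₐ[k] D) (ψ' : E' →ₐ[k] E)
    (hφ' : ∀ b, φ' (D'.right b) = D.right b) (hψ' : ∀ b, ψ' (E'.left b) = E.left b)
    (h : ∀ d, φ' (φ d) = d) (h' : ∀ e, ψ' (ψ e) = e) :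
    (tensorMap φ' ψ' hφ' hψ').comp (tensorMap φ ψ hφ hψ) = AlgHom.id k _ :=
  AlgHom.ext fun t => by
    induction t using alg_induction with
    | h0 => simp only [map_zero]
    | h2 x y hx hy => simp only [map_add, hx, hy]
    | h1 d e =>
      rw [AlgHom.comp_apply, tensorMap_pure, tensorMap_pure, h, h']
      rfl

/-- The isomorphism of algebras `φ ⊗ ψ`. -/
def tensorEquiv {D D' : CentralAlg A B} {E E' : CentralAlg B C} (φ : D ≃ₐ[k] D') (ψ : E ≃ₐ[k] E')
    (hφ : ∀ b, φ (D.right b) = D'.right b) (hψ : ∀ b, ψ (E.left b) = E'.left b) :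
    D.tensor E ≃ₐ[k] D'.tensor E' :=
  AlgEquiv.ofAlgHom
    (tensorMap φ.toAlgHom ψ.toAlgHom hφ hψ)
    (tensorMap φ.symm.toAlgHom ψ.symm.toAlgHom
      (fun b => φ.symm_apply_eq.2 (hφ b).symm) (fun b => ψ.symm_apply_eq.2 (hψ b).symm))
    (tensorMap_comp_tensorMap _ _ _ _ _ _ _ _ φ.apply_symm_apply ψ.apply_symm_apply)
    (tensorMap_comp_tensorMap _ _ _ _ _ _ _ _ φ.symm_apply_apply ψ.symm_apply_apply)

lemma tensorEquiv_pure {D D' : CentralAlg A B} {E E' : CentralAlg B C} (φ : D ≃ₐ[k] D')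
    (ψ : E ≃ₐ[k] E') (hφ : ∀ b, φ (D.right b) = D'.right b)
    (hψ : ∀ b, ψ (E.left b) = E'.left b) (d : D) (e : E) :
    tensorEquiv φ ψ hφ hψ (pure d e) = pure (φ d) (ψ e) :=
  tensorMap_pure φ.toAlgHom ψ.toAlgHom hφ hψ d e

section

variable (D : CentralAlg A₁ A₂) (E : CentralAlg A₂ A₃) (F : CentralAlg A₃ A₄)

lemma tripleL_induction {D : CentralAlg A₁ A₂} {E : CentralAlg A₂ A₃} {F : CentralAlg A₃ A₄}
    {P : (D.tensor E).tensor F → Prop} (t : (D.tensor E).tensor F) (h0 : P 0)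
    (h1 : ∀ d e f, P (pure (pure d e) f)) (h2 : ∀ x y, P x → P y → P (x + y)) : P t := by
  induction t using alg_induction with
  | h0 => exact h0
  | h2 x y hx hy => exact h2 x y hx hy
  | h1 s f =>
  induction s using alg_induction with
  | h0 => exact (congrArg P ((CentralAlg.tmul (D.tensor E) F).map_zero₂ f)).mpr h0
  | h2 x y hx hy =>
    exact (congrArg P ((CentralAlg.tmul (D.tensor E) F).map_add₂ x y f)).mpr (h2 _ _ hx hy)
  | h1 d e => exact h1 d e f

lemma tripleR_induction {D : CentralAlg A₁ A₂} {E : CentralAlg A₂ A₃} {F : CentralAlg A₃ A₄}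
    {P : D.tensor (E.tensor F) → Prop} (t : D.tensor (E.tensor F)) (h0 : P 0)
    (h1 : ∀ d e f, P (pure d (pure e f))) (h2 : ∀ x y, P x → P y → P (x + y)) : P t := by
  induction t using alg_induction with
  | h0 => exact h0
  | h2 x y hx hy => exact h2 x y hx hy
  | h1 d s =>
  induction s using alg_induction with
  | h0 => exact (congrArg P ((CentralAlg.tmul D (E.tensor F) d).map_zero)).mpr h0
  | h2 x y hx hy =>
    exact (congrArg P ((CentralAlg.tmul D (E.tensor F) d).map_add x y)).mpr (h2 _ _ hx hy)
  | h1 e f => exact h1 d e f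

/-- The isomorphism of algebras `(d ⊗ e) ⊗ f ↦ d ⊗ (e ⊗ f)`. -/
def assocEquiv : (D.tensor E).tensor F ≃ₐ[k] D.tensor (E.tensor F) :=
  AlgEquiv.ofAlgHom (assocHom D E F).toAlgHom (assocInv D E F).toAlgHom
    (AlgHom.ext fun t => by
      induction t using tripleR_induction with
      | h0 => simp only [map_zero]
      | h2 x y hx hy => simp only [map_add, hx, hy]
      | h1 d e f => rw [AlgHom.comp_apply, assocInv_pure, assocHom_pure]; rfl)
    (AlgHom.ext fun t => by
      induction t using tripleL_induction with
      | h0 => simp only [map_zero]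
      | h2 x y hx hy => simp only [map_add, hx, hy]
      | h1 d e f => rw [AlgHom.comp_apply, assocHom_pure, assocInv_pure]; rfl)

lemma assocEquiv_pure (d : D) (e : E) (f : F) :
    assocEquiv D E F (pure (pure d e) f) = pure d (pure e f) := assocHom_pure D E F d e f

end

section

variable (D : CentralAlg A B)

/-- The isomorphism of algebras `a ⊗ d ↦ a · d`. -/
def lunitEquiv : (unit A).tensor D ≃ₐ[k] D :=
  AlgEquiv.ofAlgHom (lunitHom D).toAlgHom (toR (unit A) D)
    (AlgHom.ext fun d => desc_toR (unit A) D D.leftU (AlgHom.id k D) D.leftU_comm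
      D.leftU_right d)
    (AlgHom.ext fun t => by
      induction t using alg_induction with
      | h0 => simp only [map_zero]
      | h2 x y hx hy => simp only [map_add, hx, hy]
      | h1 a d =>
        change toR (unit A) D (D.left a * d) = pure a d
        -- The inverse is `d ↦ 1 ⊗ d`, and `1 ⊗ α(a ⊗ 1) d = (a ⊗ 1)(1 ⊗ d)` because the tensor
        -- product is balanced over `A`.
        exact (map_mul (toR (unit A) D) _ _).trans ((congrArg (· * toR (unit A) D d)
          ((toL_right (unit A) D a).symm.trans (congrArg (toL (unit A) D) (unit_right a)))).trans
          (toL_mul_toR (unit A) D a d)))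

lemma lunitEquiv_pure (a : unit A) (d : D) :
    lunitEquiv D (pure (D := unit A) a d) = D.left a * d := rfl

/-- The isomorphism of algebras `d ⊗ b ↦ d · b`. -/
def runitEquiv : D.tensor (unit B) ≃ₐ[k] D :=
  AlgEquiv.ofAlgHom (runitHom D).toAlgHom (toL D (unit B))
    (AlgHom.ext fun d => desc_toL D (unit B) (AlgHom.id k D) D.rightU D.rightU_comm
      D.rightU_left d)
    (AlgHom.ext fun t => by
      induction t using alg_induction with
      | h0 => simp only [map_zero]
      | h2 x y hx hy => simp only [map_add, hx, hy]
      | h1 d b =>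
        change toL D (unit B) (d * D.right b) = pure d b
        exact (map_mul (toL D (unit B)) _ _).trans ((congrArg (toL D (unit B) d * ·)
          ((toL_right D (unit B) b).trans (congrArg (toR D (unit B)) (unit_left b)))).trans
          (toL_mul_toR D (unit B) d b)))

end

end CentralAlg

namespace CompatBimod

namespace IsCompanion

section

variable {D E : CentralAlg A B} {U : CompatBimod D E} {φ : D ≃ₐ[k] E} {u : U.carrier}
  (hU : IsCompanion U φ u)

include hU

/-- The actions of `B` on the two sides of a 1-cell agree, so the image of `b` in `D` and the
`φ`-preimage of its image in `E` have the same effect on `u`; freeness identifies them. An algebra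
isomorphism with a companion is thus automatically compatible with the structure maps, which is what
forming `φ ⊗ ψ` requires. -/
lemma map_right (b : B) : φ (D.right b) = E.right b := by
  rw [← φ.eq_symm_apply]
  exact hU.bij.1 ((U.compat_right b u).trans (hU.ract_eq _))

lemma map_left (a : A) : φ (D.left a) = E.left a := by
  rw [← φ.eq_symm_apply]
  exact hU.bij.1 ((U.compat_left a u).trans (hU.ract_eq _))

end

/-- Commutation with scalars is checked factor by factor on pure tensors. For freeness, the inverse
of the orbit map reads off coordinates: `(d · u) ⊗ (e · v) ↦ d ⊗ e`. -/
lemma box {D D' : CentralAlg A B} {E E' : CentralAlg B C} {U : CompatBimod D D'}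
    {V : CompatBimod E E'} {φ : D ≃ₐ[k] D'} {ψ : E ≃ₐ[k] E'} {u : U.carrier} {v : V.carrier}
    (hU : IsCompanion U φ u) (hV : IsCompanion V ψ v) :
    IsCompanion (U.box V) (CentralAlg.tensorEquiv φ ψ hU.map_right hV.map_left)
      (btmul U V u v) where
  comm t := by
    induction t using CentralAlg.alg_induction with
    | h0 => simp only [map_zero, MulOpposite.op_zero, LinearMap.zero_apply]
    | h2 x y hx hy => simp only [map_add, MulOpposite.op_add, LinearMap.add_apply, hx, hy]
    | h1 d e => rw [CentralAlg.tensorEquiv_pure, lact_btmul, ract_btmul, hU.comm, hV.comm]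
  bij := by
    let f : D.tensor E →ₗ[k] (U.box V).carrier := (U.box V).lact.toLinearMap.flip (btmul U V u v)
    let g : (U.box V).carrier →ₗ[k] D.tensor E :=
      blift ((CentralAlg.tmul D E).compl₁₂ hU.lactEquiv.symm.toLinearMap
        hV.lactEquiv.symm.toLinearMap) (fun b m n => by
          change CentralAlg.tmul D E (hU.lactEquiv.symm _) (hV.lactEquiv.symm n) =
            CentralAlg.tmul D E (hU.lactEquiv.symm m) (hV.lactEquiv.symm _)
          -- In coordinates the right action of `b` on `U` multiplies by a preimage under `φ`, which
          -- is again the image of `b`; balancing over `B` in `D ⊗_B E` then applies.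
          rw [lactEquiv_symm_ract, lactEquiv_symm_lact, ← hU.map_right, φ.symm_apply_apply]
          exact CentralAlg.tmul_bal D E b _ _)
    refine Function.bijective_iff_has_inverse.2 ⟨g, fun t => ?_, fun t => ?_⟩
    · induction t using CentralAlg.alg_induction with
      | h0 => simp only [map_zero, LinearMap.zero_apply]
      | h2 x y hx hy => simp only [map_add, LinearMap.add_apply, hx, hy]
      | h1 d e =>
        change CentralAlg.pure (hU.lactEquiv.symm (hU.lactEquiv d))
          (hV.lactEquiv.symm (hV.lactEquiv e)) = _
        rw [LinearEquiv.symm_apply_apply, LinearEquiv.symm_apply_apply]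
    · induction t using box_induction with
      | h0 => simp only [map_zero, LinearMap.zero_apply]
      | h2 x y hx hy => simp only [map_add, LinearMap.add_apply, hx, hy]
      | h1 m n =>
        change btmul U V (hU.lactEquiv (hU.lactEquiv.symm m))
          (hV.lactEquiv (hV.lactEquiv.symm n)) = _
        rw [LinearEquiv.apply_symm_apply, LinearEquiv.apply_symm_apply]

/-- Twisting the right action by a homomorphism gives a companion of its inverse, since `d · 1 = d =
1 · ψ(d)` means `φ(ψ(d)) = d`. -/
lemma twistR {D D' : CentralAlg A B} (φ : CentralAlg.StrHom D' D) (ψ : D ≃ₐ[k] D')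
    (h : ∀ d, φ.toAlgHom (ψ d) = d) : IsCompanion (twistR φ) ψ (1 : D) where
  comm d := by
    rw [twistR_lact, twistR_ract, h, mul_one, one_mul]
  bij := by
    have : (fun d : D => (CompatBimod.twistR φ).lact d (1 : D)) = id :=
      funext fun d => mul_one (M := D.carrier) d
    rw [this]
    exact Function.bijective_id

/-- Twisting the left action gives a companion of the homomorphism itself; the orbit map of `1` is
`ψ`, which is bijective. -/
lemma twistL {D D' : CentralAlg A B} (φ : CentralAlg.StrHom D' D) (ψ : D' ≃ₐ[k] D)
    (h : ∀ d, ψ d = φ.toAlgHom d) : IsCompanion (twistL φ) ψ (1 : D) where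
  comm d := by
    rw [twistL_lact, twistL_ract, h, mul_one, one_mul]
  bij := by
    have : (fun d : D' => (CompatBimod.twistL φ).lact d (1 : D)) = ψ :=
      funext fun d => (mul_one (M := D.carrier) _).trans (h d).symm
    rw [this]
    exact ψ.bijective

section

variable (D : CentralAlg A₁ A₂) (E : CentralAlg A₂ A₃) (F : CentralAlg A₃ A₄)

lemma assocBimod : IsCompanion (assocBimod D E F) (CentralAlg.assocEquiv D E F)
    (1 : (D.tensor E).tensor F) :=
  twistR _ _ (CentralAlg.assocEquiv D E F).symm_apply_apply

lemma assocBimod' : IsCompanion (assocBimod' D E F) (CentralAlg.assocEquiv D E F).symm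
    (1 : D.tensor (E.tensor F)) :=
  twistR _ _ (CentralAlg.assocEquiv D E F).apply_symm_apply

end

section

variable (D : CentralAlg A B)

lemma lunitBimod : IsCompanion (lunitBimod D) (CentralAlg.lunitEquiv D) (1 : D) :=
  twistL _ _ fun _ => rfl

lemma lunitBimod' : IsCompanion (lunitBimod' D) (CentralAlg.lunitEquiv D).symm (1 : D) :=
  twistR _ _ (CentralAlg.lunitEquiv D).apply_symm_apply

lemma runitBimod : IsCompanion (runitBimod D) (CentralAlg.runitEquiv D) (1 : D) :=
  twistL _ _ fun _ => rfl

lemma runitBimod' : IsCompanion (runitBimod' D) (CentralAlg.runitEquiv D).symm (1 : D) :=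
  twistR _ _ (CentralAlg.runitEquiv D).apply_symm_apply

end

end IsCompanion

end CompatBimod

end CanonicalCompanions

/-! ### Rebracketing of triple tensor products of bimodules -/

section BoxAssoc

variable {k : Type u} [Field k] {A₁ A₂ A₃ A₄ : CommAlgCat.{v} k}

namespace CompatBimod

variable {D D' : CentralAlg A₁ A₂} {E E' : CentralAlg A₂ A₃} {F F' : CentralAlg A₃ A₄}

section

variable {M : CompatBimod D D'} {N : CompatBimod E E'} {P : CompatBimod F F'}

lemma boxL_induction {Q : ((M.box N).box P).carrier → Prop} (t : ((M.box N).box P).carrier)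
    (h0 : Q 0) (h1 : ∀ m n p, Q (btmul (M.box N) P (btmul M N m n) p))
    (h2 : ∀ x y, Q x → Q y → Q (x + y)) : Q t := by
  induction t using box_induction with
  | h0 => exact h0
  | h2 x y hx hy => exact h2 x y hx hy
  | h1 s p =>
  induction s using box_induction with
  | h0 => simpa only [map_zero, LinearMap.zero_apply] using h0
  | h2 x y hx hy => simpa only [map_add, LinearMap.add_apply] using h2 _ _ hx hy
  | h1 m n => exact h1 m n p

lemma boxR_induction {Q : (M.box (N.box P)).carrier → Prop} (t : (M.box (N.box P)).carrier)
    (h0 : Q 0) (h1 : ∀ m n p, Q (btmul M (N.box P) m (btmul N P n p)))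
    (h2 : ∀ x y, Q x → Q y → Q (x + y)) : Q t := by
  induction t using box_induction with
  | h0 => exact h0
  | h2 x y hx hy => exact h2 x y hx hy
  | h1 m s =>
  induction s using box_induction with
  | h0 => simpa only [map_zero] using h0
  | h2 x y hx hy => simpa only [map_add] using h2 _ _ hx hy
  | h1 n p => exact h1 m n p

/-- The outer commutative algebra acts through the adjacent tensor factor only, so balancing of a
threefold tensor product reduces to balancing of a twofold one. -/
lemma ract_tensor_right (b : A₃) (m : M.carrier) (n : N.carrier) :
    (M.box N).ract (op ((D'.tensor E').right b)) (btmul M N m n) =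
      btmul M N m (N.ract (op (E'.right b)) n) := by
  rw [CentralAlg.tensor_right']
  exact ract_one_pure M N (E'.right b) m n

lemma lact_tensor_left (a : A₁) (m : M.carrier) (n : N.carrier) :
    (M.box N).lact ((D.tensor E).left a) (btmul M N m n) =
      btmul M N (M.lact (D.left a) m) n := by
  rw [CentralAlg.tensor_left']
  exact lact_pure_one M N (D.left a) m n

end

variable (M : CompatBimod D D') (N : CompatBimod E E') (P : CompatBimod F F')

/-- The linear map `(m ⊗ n) ⊗ p ↦ m ⊗ (n ⊗ p)`. -/
def boxAssocLin : ((M.box N).box P).carrier →ₗ[k] (M.box (N.box P)).carrier :=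
  blift (blift
    (LinearMap.mk₂ k (fun m n => (btmul M (N.box P) m).comp (btmul N P n))
      (fun _ _ _ => LinearMap.ext fun _ => by simp)
      (fun _ _ _ => LinearMap.ext fun _ => by simp)
      (fun _ _ _ => LinearMap.ext fun _ => by simp)
      (fun _ _ _ => LinearMap.ext fun _ => by simp))
    (fun b m n => LinearMap.ext fun p => by
      change btmul M (N.box P) (M.ract (op (D'.right b)) m) (btmul N P n p) =
        btmul M (N.box P) m (btmul N P (N.lact (E.left b) n) p)
      rw [btmul_bal, lact_tensor_left]))
    (fun b t p => by
      induction t using box_induction with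
      | h0 => simp only [map_zero, LinearMap.zero_apply]
      | h2 x y hx hy => simp only [map_add, LinearMap.add_apply, hx, hy]
      | h1 m n =>
        rw [ract_tensor_right]
        exact congrArg (btmul M (N.box P) m) (btmul_bal (M := N) (N := P) b n p))

lemma boxAssocLin_btmul (m : M.carrier) (n : N.carrier) (p : P.carrier) :
    boxAssocLin M N P (btmul (M.box N) P (btmul M N m n) p) =
      btmul M (N.box P) m (btmul N P n p) := rfl

/-- The linear map `n ⊗ p ↦ (m ⊗ n) ⊗ p`. -/
def boxAssocInvAux (m : M.carrier) : (N.box P).carrier →ₗ[k] ((M.box N).box P).carrier :=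
  blift ((btmul (M.box N) P).comp (btmul M N m)) (fun b n p => by
    change btmul (M.box N) P (btmul M N m _) p = btmul (M.box N) P (btmul M N m n) _
    rw [← ract_tensor_right, btmul_bal])

lemma boxAssocInvAux_btmul (m : M.carrier) (n : N.carrier) (p : P.carrier) :
    boxAssocInvAux M N P m (btmul N P n p) = btmul (M.box N) P (btmul M N m n) p := rfl

/-- The linear map `m ⊗ (n ⊗ p) ↦ (m ⊗ n) ⊗ p`. -/
def boxAssocInv : (M.box (N.box P)).carrier →ₗ[k] ((M.box N).box P).carrier :=
  blift
    { toFun := boxAssocInvAux M N P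
      map_add' := fun m m' => blin_ext fun n p => by
        simp only [LinearMap.add_apply, boxAssocInvAux_btmul, map_add]
      map_smul' := fun c m => blin_ext fun n p => by
        simp only [LinearMap.smul_apply, boxAssocInvAux_btmul, map_smul, RingHom.id_apply] }
    (fun b m t => by
      induction t using box_induction with
      | h0 => simp only [map_zero]
      | h2 x y hx hy => simp only [map_add, hx, hy]
      | h1 n p =>
        rw [lact_tensor_left]
        exact congrArg (fun x => btmul (M.box N) P x p) (btmul_bal (M := M) (N := N) b m n))

/-- The semilinear isomorphism `(m ⊗ n) ⊗ p ↦ m ⊗ (n ⊗ p)`. -/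
def boxAssoc : SemilinearEquiv (CentralAlg.assocEquiv D E F) (CentralAlg.assocEquiv D' E' F')
    ((M.box N).box P) (M.box (N.box P)) where
  toEquiv := LinearEquiv.ofLinearMap (boxAssocLin M N P) (boxAssocInv M N P)
    (LinearMap.ext fun t => by
      induction t using boxR_induction with
      | h0 => simp only [map_zero]
      | h2 x y hx hy => simp only [map_add, hx, hy]
      | h1 m n p => rfl)
    (LinearMap.ext fun t => by
      induction t using boxL_induction with
      | h0 => simp only [map_zero]
      | h2 x y hx hy => simp only [map_add, hx, hy]
      | h1 m n p => rfl)
  map_lact d t := by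
    change boxAssocLin M N P _ = (M.box (N.box P)).lact _ (boxAssocLin M N P t)
    induction t using boxL_induction with
    | h0 => simp only [map_zero]
    | h2 x y hx hy => simp only [map_add, hx, hy]
    | h1 m n p =>
    induction d using CentralAlg.tripleL_induction with
    | h0 => simp only [map_zero, LinearMap.zero_apply]
    | h2 x y hx hy => simp only [map_add, LinearMap.add_apply, hx, hy]
    | h1 d e f =>
      rw [CentralAlg.assocEquiv_pure, lact_btmul, lact_btmul, boxAssocLin_btmul,
        boxAssocLin_btmul, lact_btmul, lact_btmul]
  map_ract d t := by
    change boxAssocLin M N P _ = (M.box (N.box P)).ract _ (boxAssocLin M N P t)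
    induction t using boxL_induction with
    | h0 => simp only [map_zero]
    | h2 x y hx hy => simp only [map_add, hx, hy]
    | h1 m n p =>
    induction d using CentralAlg.tripleL_induction with
    | h0 => simp only [map_zero, MulOpposite.op_zero, LinearMap.zero_apply]
    | h2 x y hx hy => simp only [map_add, MulOpposite.op_add, LinearMap.add_apply, hx, hy]
    | h1 d e f =>
      rw [CentralAlg.assocEquiv_pure, ract_btmul, ract_btmul, boxAssocLin_btmul,
        boxAssocLin_btmul, ract_btmul, ract_btmul]

/-- It allows the compatibilities of the rebracketing map to be tested on triple tensors, where both
composite functors can be evaluated. -/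
lemma span_btmul_btmul : Submodule.span k
    {t | ∃ m n p, t = btmul (M.box N) P (btmul M N m n) p} = ⊤ :=
  Submodule.eq_top_iff'.2 fun t => by
    induction t using boxL_induction with
    | h0 => exact zero_mem _
    | h2 x y hx hy => exact add_mem hx hy
    | h1 m n p => exact Submodule.subset_span ⟨m, n, p, rfl⟩

end CompatBimod

end BoxAssoc

/-! ### Tensoring a bimodule with the unit algebra -/

section BoxUnit

variable {k : Type u} [Field k] {A B : CommAlgCat.{v} k}

namespace CompatBimod

variable {D D' : CentralAlg A B} {M : CompatBimod D D'}

lemma lact_leftU (a : CentralAlg.unit A) (m : M.carrier) :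
    M.lact (D.leftU a) m = M.ract (op (D'.leftU a)) m := M.compat_left a m

lemma lact_rightU (b : CentralAlg.unit B) (m : M.carrier) :
    M.lact (D.rightU b) m = M.ract (op (D'.rightU b)) m := M.compat_right b m

lemma boxUnitL_induction {Q : ((regular (CentralAlg.unit A)).box M).carrier → Prop}
    (t : ((regular (CentralAlg.unit A)).box M).carrier) (h0 : Q 0)
    (h1 : ∀ (a : CentralAlg.unit A) (m : M.carrier),
      Q (btmul (regular (CentralAlg.unit A)) M (reg a) m))
    (h2 : ∀ x y, Q x → Q y → Q (x + y)) : Q t :=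
  box_induction t h0 h1 h2

lemma boxUnitR_induction {Q : (M.box (regular (CentralAlg.unit B))).carrier → Prop}
    (t : (M.box (regular (CentralAlg.unit B))).carrier) (h0 : Q 0)
    (h1 : ∀ (m : M.carrier) (b : CentralAlg.unit B),
      Q (btmul M (regular (CentralAlg.unit B)) m (reg b)))
    (h2 : ∀ x y, Q x → Q y → Q (x + y)) : Q t :=
  box_induction t h0 h1 h2

/-- Balancing over `A` moves `a` across the tensor sign. Hence every element can be normalized to
the form `1 ⊗ m`, both for inverting `a ⊗ m ↦ a · m` and for finding a spanning set. -/
lemma btmul_one_lact (a : CentralAlg.unit A) (m : M.carrier) :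
    btmul (regular (CentralAlg.unit A)) M (reg 1) (M.lact (D.leftU a) m) =
      btmul (regular (CentralAlg.unit A)) M (reg a) m := by
  refine (btmul_bal (M := regular (CentralAlg.unit A)) (N := M) a (reg 1) m).symm.trans ?_
  refine congrArg (fun x => btmul (regular (CentralAlg.unit A)) M x m) ?_
  exact (one_mul (M := A) _).trans (CentralAlg.unit_right a)

lemma btmul_ract_one (b : CentralAlg.unit B) (m : M.carrier) :
    btmul M (regular (CentralAlg.unit B)) (M.ract (op (D'.rightU b)) m) (reg 1) =
      btmul M (regular (CentralAlg.unit B)) m (reg b) := by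
  refine (btmul_bal (M := M) (N := regular (CentralAlg.unit B)) b m (reg 1)).trans ?_
  refine congrArg (fun x => btmul M (regular (CentralAlg.unit B)) m x) ?_
  exact (mul_one (M := B) _).trans (CentralAlg.unit_left b)

variable (M)

/-- The linear map `a ⊗ m ↦ a · m`. -/
def boxLeftUnitorLin : ((regular (CentralAlg.unit A)).box M).carrier →ₗ[k] M.carrier :=
  blift (M := regular (CentralAlg.unit A)) (N := M) (M.lact.comp D.leftU).toLinearMap
    (fun b (a : CentralAlg.unit A) m => by
      change M.lact (D.leftU (a * (CentralAlg.unit A).right b)) m =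
        M.lact (D.leftU a) (M.lact (D.left b) m)
      rw [map_mul, D.leftU_right, lact_mul]
      rfl)

lemma boxLeftUnitorLin_btmul (a : CentralAlg.unit A) (m : M.carrier) :
    boxLeftUnitorLin M (btmul (regular (CentralAlg.unit A)) M (reg a) m) =
      M.lact (D.leftU a) m := rfl

/-- The linear map `m ⊗ b ↦ m · b`. -/
def boxRightUnitorLin : (M.box (regular (CentralAlg.unit B))).carrier →ₗ[k] M.carrier :=
  blift (M := M) (N := regular (CentralAlg.unit B))
    (M.ract.toLinearMap ∘ₗ (MulOpposite.opLinearEquiv k).toLinearMap ∘ₗ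
      D'.rightU.toLinearMap).flip
    (fun b m (b' : CentralAlg.unit B) => by
      change M.ract (op (D'.rightU b')) (M.ract (op (D'.right b)) m) =
        M.ract (op (D'.rightU ((CentralAlg.unit B).left b * b'))) m
      rw [map_mul, ← D'.rightU_left, ract_mul]
      rfl)

lemma boxRightUnitorLin_btmul (m : M.carrier) (b : CentralAlg.unit B) :
    boxRightUnitorLin M (btmul M (regular (CentralAlg.unit B)) m (reg b)) =
      M.ract (op (D'.rightU b)) m := rfl

/-- The semilinear isomorphism `a ⊗ m ↦ a · m`. -/
def boxLeftUnitor : SemilinearEquiv (CentralAlg.lunitEquiv D) (CentralAlg.lunitEquiv D')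
    ((regular (CentralAlg.unit A)).box M) M where
  toEquiv := LinearEquiv.ofLinearMap (boxLeftUnitorLin M)
    (btmul (regular (CentralAlg.unit A)) M (reg 1))
    (LinearMap.ext fun m => by
      change M.lact (D.leftU 1) m = m
      rw [map_one, lact_one])
    (blin_ext (M := regular (CentralAlg.unit A)) (N := M) fun a m => btmul_one_lact a m)
  map_lact d t := by
    change boxLeftUnitorLin M _ = M.lact _ (boxLeftUnitorLin M t)
    induction t using boxUnitL_induction with
    | h0 => simp only [map_zero]
    | h2 x y hx hy => simp only [map_add, hx, hy]
    | h1 a m =>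
    induction d using CentralAlg.alg_induction with
    | h0 => simp only [map_zero, LinearMap.zero_apply]
    | h2 x y hx hy => simp only [map_add, LinearMap.add_apply, hx, hy]
    | h1 a' d =>
      change M.lact (D.leftU (a' * a)) (M.lact d m) =
        M.lact (D.leftU a' * d) (M.lact (D.leftU a) m)
      rw [map_mul, ← lact_mul, ← lact_mul, mul_assoc, mul_assoc]
      -- What remains is that the image of `a` in `D` commutes with `d`, that is, centrality of the
      -- structure map.
      exact congrArg (fun x => M.lact (D.leftU a' * x) m) (D.leftU_comm a d)
  map_ract d t := by
    change boxLeftUnitorLin M _ = M.ract _ (boxLeftUnitorLin M t)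
    induction t using boxUnitL_induction with
    | h0 => simp only [map_zero]
    | h2 x y hx hy => simp only [map_add, hx, hy]
    | h1 a m =>
    induction d using CentralAlg.alg_induction with
    | h0 => simp only [map_zero, MulOpposite.op_zero, LinearMap.zero_apply]
    | h2 x y hx hy => simp only [map_add, MulOpposite.op_add, LinearMap.add_apply, hx, hy]
    | h1 a' d =>
      change M.lact (D.leftU (a * a')) (M.ract (op d) m) =
        M.ract (op (D'.leftU a' * d)) (M.lact (D.leftU a) m)
      -- The right action of `a'` is converted into its left action, which is possible because the
      -- two actions of `A` on a 1-cell agree.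
      rw [ract_mul, ← lact_leftU, ← M.lact_ract, ← M.lact_ract, ← lact_mul, map_mul]
      exact congrArg (fun x => M.lact x (M.ract (op d) m)) (D.leftU_comm a (D.leftU a'))

/-- The semilinear isomorphism `m ⊗ b ↦ m · b`. -/
def boxRightUnitor : SemilinearEquiv (CentralAlg.runitEquiv D) (CentralAlg.runitEquiv D')
    (M.box (regular (CentralAlg.unit B))) M where
  toEquiv := LinearEquiv.ofLinearMap (boxRightUnitorLin M)
    ((btmul M (regular (CentralAlg.unit B))).flip (reg 1))
    (LinearMap.ext fun m => by
      change M.ract (op (D'.rightU 1)) m = m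
      rw [map_one, ract_one])
    (blin_ext (M := M) (N := regular (CentralAlg.unit B)) fun m b => btmul_ract_one b m)
  map_lact d t := by
    change boxRightUnitorLin M _ = M.lact _ (boxRightUnitorLin M t)
    induction t using boxUnitR_induction with
    | h0 => simp only [map_zero]
    | h2 x y hx hy => simp only [map_add, hx, hy]
    | h1 m b =>
    induction d using CentralAlg.alg_induction with
    | h0 => simp only [map_zero, LinearMap.zero_apply]
    | h2 x y hx hy => simp only [map_add, LinearMap.add_apply, hx, hy]
    | h1 d b' =>
      change M.ract (op (D'.rightU (b' * b))) (M.lact d m) =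
        M.lact (d * D.rightU b') (M.ract (op (D'.rightU b)) m)
      -- Dually, the left action of `b'` is converted into its right action before the two elements
      -- of `B` are interchanged.
      rw [lact_mul, lact_rightU, ← ract_mul, M.lact_ract, map_mul]
      exact congrArg (fun x => M.ract (op x) (M.lact d m)) (D'.rightU_comm (D'.rightU b') b)
  map_ract d t := by
    change boxRightUnitorLin M _ = M.ract _ (boxRightUnitorLin M t)
    induction t using boxUnitR_induction with
    | h0 => simp only [map_zero]
    | h2 x y hx hy => simp only [map_add, hx, hy]
    | h1 m b =>
    induction d using CentralAlg.alg_induction with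
    | h0 => simp only [map_zero, MulOpposite.op_zero, LinearMap.zero_apply]
    | h2 x y hx hy => simp only [map_add, MulOpposite.op_add, LinearMap.add_apply, hx, hy]
    | h1 d b' =>
      change M.ract (op (D'.rightU (b * b'))) (M.ract (op d) m) =
        M.ract (op (d * D'.rightU b')) (M.ract (op (D'.rightU b)) m)
      rw [map_mul, ← ract_mul, ← ract_mul, ← mul_assoc, ← mul_assoc]
      exact congrArg (fun x => M.ract (op (x * D'.rightU b')) m) (D'.rightU_comm d b)

lemma boxLeftUnitor_one_btmul (m : M.carrier) :
    (boxLeftUnitor M).toEquiv (btmul (regular (CentralAlg.unit A)) M (reg 1) m) = m :=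
  (boxLeftUnitorLin_btmul M 1 m).trans (by rw [map_one, lact_one])

lemma boxRightUnitor_btmul_one (m : M.carrier) :
    (boxRightUnitor M).toEquiv (btmul M (regular (CentralAlg.unit B)) m (reg 1)) = m :=
  (boxRightUnitorLin_btmul M m 1).trans (by rw [map_one, ract_one])

/-- The tensors `1 ⊗ m` span, and on them the constraints of the unit functor reduce to those of the
second factor. -/
lemma span_one_btmul : Submodule.span k
    (Set.range (btmul (regular (CentralAlg.unit A)) M (reg 1))) = ⊤ :=
  Submodule.eq_top_iff'.2 fun t => by
    induction t using boxUnitL_induction with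
    | h0 => exact zero_mem _
    | h2 x y hx hy => exact add_mem hx hy
    | h1 a m => exact Submodule.subset_span ⟨_, btmul_one_lact a m⟩

lemma span_btmul_one : Submodule.span k
    (Set.range fun m => btmul M (regular (CentralAlg.unit B)) m (reg 1)) = ⊤ :=
  Submodule.eq_top_iff'.2 fun t => by
    induction t using boxUnitR_induction with
    | h0 => exact zero_mem _
    | h2 x y hx hy => exact add_mem hx hy
    | h1 m b => exact Submodule.subset_span ⟨_, btmul_ract_one b m⟩

end CompatBimod

end BoxUnit

/-! ### Associativity and unit isomorphisms as semilinear transformations -/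

section ComAlgebra

variable {k : Type u} [Field k]

open CompatBimod BicategoryElements TricategoryBaseElements
open scoped Pseudofunctor.StrongTrans CategoryTheory.Prod

attribute [local irreducible] CentralAlg.tensor CompatBimod.box CompatBimod.tensor

namespace ComAlgebra

/-- The isomorphism `(m ⊗ n) ⊗ p ↦ m ⊗ (n ⊗ p)` between the values of the functors which the
associator relates. -/
def assocSemilinear {A₁ A₂ A₃ A₄ : CommAlgCat.{v} k}
    {x y : (CentralAlg A₁ A₂ × CentralAlg A₂ A₃) × CentralAlg A₃ A₄} (f : x ⟶ y) :
    SemilinearEquiv (CentralAlg.assocEquiv x.1.1 x.1.2 x.2)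
      (CentralAlg.assocEquiv y.1.1 y.1.2 y.2) (((comAlgBase k).assocL A₁ A₂ A₃ A₄).map f)
      (((comAlgBase k).assocR A₁ A₂ A₃ A₄).map f) :=
  let M : CompatBimod x.1.1 y.1.1 := f.1.1
  let N : CompatBimod x.1.2 y.1.2 := f.1.2
  let P : CompatBimod x.2 y.2 := f.2
  boxAssoc M N P

/-- The isomorphism of pseudofunctors `(D ⊗ E) ⊗ F ≅ D ⊗ (E ⊗ F)`. -/
def assocTrans (A₁ A₂ A₃ A₄ : CommAlgCat.{v} k) :
    SemilinearTrans ((comAlgBase k).assocL A₁ A₂ A₃ A₄) ((comAlgBase k).assocR A₁ A₂ A₃ A₄) := by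
  refine SemilinearTrans.ofSpan
    (fun x => CentralAlg.assocEquiv x.1.1 x.1.2 x.2)
    (fun f => assocSemilinear f) _
    (fun f => span_btmul_btmul f.1.1 f.1.2 f.2) ?_ ?_ ?_
  · rintro x y f g η _ ⟨m, n, p, rfl⟩
    -- Both functors act factor by factor on triple tensors, and rebracketing does not touch the
    -- factors. The unit and composition constraints are treated alike.
    exact (congrArg (assocSemilinear g).toEquiv
      (ev_assocL_map₂ (X := comAlgBase k) η.1.1 η.1.2 η.2 m n p)).trans
      (ev_assocR_map₂ (X := comAlgBase k) η.1.1 η.1.2 η.2 m n p).symm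
  · intro x
    exact (congrArg (assocSemilinear (𝟙 x)).toEquiv
      (ev_assocL_mapId_inv (X := comAlgBase k) x.1.1 x.1.2 x.2)).trans
      (ev_assocR_mapId_inv (X := comAlgBase k) x.1.1 x.1.2 x.2).symm
  · rintro x y z f g _ ⟨m, n, p, rfl⟩ _ ⟨m', n', p', rfl⟩
    exact (congrArg (assocSemilinear (f ≫ g)).toEquiv
      (ev_assocL_mapComp_inv (X := comAlgBase k) m n p m' n' p')).trans
      (ev_assocR_mapComp_inv (X := comAlgBase k) m n p m' n' p').symm

section

variable {A B : CommAlgCat.{v} k} {D D' D'' : CentralAlg A B}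

/-- The constant pseudofunctor has the unitor as its composition constraint, so after the shuffle
the two elements `1` in the unit slot are multiplied to a single `1`. -/
lemma ev_unitL_mapComp_inv {M : CompatBimod D D'} {M' : CompatBimod D' D''} (m : M.carrier)
    (m' : M'.carrier) :
    ev (((comAlgBase k).unitL A B).mapComp (a := D) (b := D') (c := D'') M M').inv
      (pair (btmul (𝟙 (CentralAlg.unit A)) M (ComAlg.one _) m)
        (btmul (𝟙 (CentralAlg.unit A)) M' (ComAlg.one _) m')) =
      btmul (𝟙 (CentralAlg.unit A)) (M.tensor M') (ComAlg.one _) (tmul M M' m m') := by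
  refine (ev_comp _ _ _).trans ((congrArg _ (ev_mapComp_inv (X := comAlgBase k)
    (one (CentralAlg.unit A)) (one (CentralAlg.unit A)) m m')).trans ?_)
  refine (ev_ten₂ (X := comAlgBase k) (λ_ (𝟙 (CentralAlg.unit A))).hom (𝟙 (M.tensor M'))
    _ _).trans ?_
  exact congrArg (fun x => btmul (𝟙 (CentralAlg.unit A)) (M.tensor M') x (tmul M M' m m'))
    (ev_leftUnitor_hom (one (CentralAlg.unit A)))

lemma ev_unitR_mapComp_inv {M : CompatBimod D D'} {M' : CompatBimod D' D''} (m : M.carrier)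
    (m' : M'.carrier) :
    ev (((comAlgBase k).unitR A B).mapComp (a := D) (b := D') (c := D'') M M').inv
      (pair (btmul M (𝟙 (CentralAlg.unit B)) m (ComAlg.one _))
        (btmul M' (𝟙 (CentralAlg.unit B)) m' (ComAlg.one _))) =
      btmul (M.tensor M') (𝟙 (CentralAlg.unit B)) (tmul M M' m m') (ComAlg.one _) := by
  refine (ev_comp _ _ _).trans ((congrArg _ (ev_mapComp_inv (X := comAlgBase k)
    m m' (one (CentralAlg.unit B)) (one (CentralAlg.unit B)))).trans ?_)
  refine (ev_ten₂ (X := comAlgBase k) (𝟙 (M.tensor M')) (λ_ (𝟙 (CentralAlg.unit B))).hom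
    _ _).trans ?_
  exact congrArg (fun x => btmul (M.tensor M') (𝟙 (CentralAlg.unit B)) (tmul M M' m m') x)
    (ev_leftUnitor_hom (one (CentralAlg.unit B)))

variable (D)

lemma ev_unitL_mapId_inv : ev (((comAlgBase k).unitL A B).mapId D).inv
      (one ((CentralAlg.unit A).tensor D)) =
    ten (X := comAlgBase k) (one (CentralAlg.unit A)) (one D) := by
  refine (ev_comp _ _ _).trans ((congrArg _ (ev_tenId_inv (X := comAlgBase k)
    (CentralAlg.unit A) D)).trans ?_)
  exact (ev_ten₂ (X := comAlgBase k) (𝟙 (𝟙 (CentralAlg.unit A))) (𝟙 (𝟙 D)) _ _).trans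
    (congrArg₂ _ (ev_id _) (ev_id _))

lemma ev_unitR_mapId_inv : ev (((comAlgBase k).unitR A B).mapId D).inv
      (one (D.tensor (CentralAlg.unit B))) =
    ten (X := comAlgBase k) (one D) (one (CentralAlg.unit B)) := by
  refine (ev_comp _ _ _).trans ((congrArg _ (ev_tenId_inv (X := comAlgBase k)
    D (CentralAlg.unit B))).trans ?_)
  exact (ev_ten₂ (X := comAlgBase k) (𝟙 (𝟙 D)) (𝟙 (𝟙 (CentralAlg.unit B))) _ _).trans
    (congrArg₂ _ (ev_id _) (ev_id _))

end

/-- The isomorphism of pseudofunctors `A ⊗ D ≅ D`. -/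
def lunitTrans (A B : CommAlgCat.{v} k) :
    SemilinearTrans ((comAlgBase k).unitL A B) (Pseudofunctor.id (CentralAlg A B)) :=
  SemilinearTrans.ofSpan (fun x => CentralAlg.lunitEquiv x) (fun f => boxLeftUnitor f) _
    (fun f => span_one_btmul f)
    (by
      rintro x y f g η _ ⟨m, rfl⟩
      refine (congrArg (boxLeftUnitor g).toEquiv
        (ev_ten₂ (X := comAlgBase k) (𝟙 (𝟙 (CentralAlg.unit A))) η (one _) m)).trans ?_
      exact (boxLeftUnitor_one_btmul g (ev η m)).trans
        (congrArg (ev η) (boxLeftUnitor_one_btmul f m).symm))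
    (fun x => (congrArg (boxLeftUnitor (𝟙 x)).toEquiv (ev_unitL_mapId_inv x)).trans
      (boxLeftUnitor_one_btmul (𝟙 x) (one x)))
    (by
      rintro x y z f g _ ⟨m, rfl⟩ _ ⟨m', rfl⟩
      -- The constraint merges `1 ⊗ m` and `1 ⊗ m'` into `1 ⊗ (m ⊗ m')`, and deleting the `1` before
      -- or after merging gives `m ⊗ m'`.
      refine (congrArg (boxLeftUnitor (f ≫ g)).toEquiv (ev_unitL_mapComp_inv m m')).trans ?_
      exact (boxLeftUnitor_one_btmul (f ≫ g) (CompatBimod.tmul f g m m')).trans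
        (congrArg₂ (fun m m' => CompatBimod.tmul f g m m') (boxLeftUnitor_one_btmul f m).symm
          (boxLeftUnitor_one_btmul g m').symm))

/-- The isomorphism of pseudofunctors `D ⊗ B ≅ D`. -/
def runitTrans (A B : CommAlgCat.{v} k) :
    SemilinearTrans ((comAlgBase k).unitR A B) (Pseudofunctor.id (CentralAlg A B)) :=
  SemilinearTrans.ofSpan (fun x => CentralAlg.runitEquiv x) (fun f => boxRightUnitor f) _
    (fun f => span_btmul_one f)
    (by
      rintro x y f g η _ ⟨m, rfl⟩
      refine (congrArg (boxRightUnitor g).toEquiv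
        (ev_ten₂ (X := comAlgBase k) η (𝟙 (𝟙 (CentralAlg.unit B))) m (one _))).trans ?_
      exact (boxRightUnitor_btmul_one g (ev η m)).trans
        (congrArg (ev η) (boxRightUnitor_btmul_one f m).symm))
    (fun x => (congrArg (boxRightUnitor (𝟙 x)).toEquiv (ev_unitR_mapId_inv x)).trans
      (boxRightUnitor_btmul_one (𝟙 x) (one x)))
    (by
      rintro x y z f g _ ⟨m, rfl⟩ _ ⟨m', rfl⟩
      refine (congrArg (boxRightUnitor (f ≫ g)).toEquiv (ev_unitR_mapComp_inv m m')).trans ?_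
      exact (boxRightUnitor_btmul_one (f ≫ g) (CompatBimod.tmul f g m m')).trans
        (congrArg₂ (fun m m' => CompatBimod.tmul f g m m') (boxRightUnitor_btmul_one f m).symm
          (boxRightUnitor_btmul_one g m').symm))

end ComAlgebra

end ComAlgebra

/-! ### The adjoint equivalences of `ComAlgebra` and their generators -/

section ComAlgebraCoherence

variable {k : Type u} [Field k]

open CompatBimod BicategoryElements TricategoryBaseElements
open scoped Pseudofunctor.StrongTrans CategoryTheory.Prod

attribute [local irreducible] CentralAlg.tensor CompatBimod.box CompatBimod.tensor

namespace ComAlgebra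

/-- The bimodules `(D ⊗ E) ⊗ F`. -/
def assocCompanion (A₁ A₂ A₃ A₄ : CommAlgCat.{v} k) :
    CompanionFamily (assocTrans A₁ A₂ A₃ A₄).equiv where
  cell x := assocBimod x.1.1 x.1.2 x.2
  gen x := (1 : (x.1.1.tensor x.1.2).tensor x.2)
  isCompanion x := IsCompanion.assocBimod x.1.1 x.1.2 x.2

/-- The bimodules `D ⊗ (E ⊗ F)`. -/
def assocCompanion' (A₁ A₂ A₃ A₄ : CommAlgCat.{v} k) :
    CompanionFamily (assocTrans A₁ A₂ A₃ A₄).symm.equiv where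
  cell x := assocBimod' x.1.1 x.1.2 x.2
  gen x := (1 : x.1.1.tensor (x.1.2.tensor x.2))
  isCompanion x := IsCompanion.assocBimod' x.1.1 x.1.2 x.2

/-- The bimodules `D` from `A ⊗ D` to `D`. -/
def lunitCompanion (A B : CommAlgCat.{v} k) : CompanionFamily (lunitTrans A B).equiv where
  cell x := lunitBimod x
  gen x := (1 : x.carrier)
  isCompanion x := IsCompanion.lunitBimod x

/-- The bimodules `D` from `D` to `A ⊗ D`. -/
def lunitCompanion' (A B : CommAlgCat.{v} k) : CompanionFamily (lunitTrans A B).symm.equiv where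
  cell x := lunitBimod' x
  gen x := (1 : x.carrier)
  isCompanion x := IsCompanion.lunitBimod' x

/-- The bimodules `D` from `D ⊗ B` to `D`. -/
def runitCompanion (A B : CommAlgCat.{v} k) : CompanionFamily (runitTrans A B).equiv where
  cell x := runitBimod x
  gen x := (1 : x.carrier)
  isCompanion x := IsCompanion.runitBimod x

/-- The bimodules `D` from `D` to `D ⊗ B`. -/
def runitCompanion' (A B : CommAlgCat.{v} k) : CompanionFamily (runitTrans A B).symm.equiv where
  cell x := runitBimod' x
  gen x := (1 : x.carrier)
  isCompanion x := IsCompanion.runitBimod' x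

variable (k) in
/-- The associator and the unitors of `ComAlgebra`. -/
noncomputable def equivs : TricategoryEquivs (comAlgBase.{u, v} k) where
  assoc A₁ A₂ A₃ A₄ :=
    (assocTrans A₁ A₂ A₃ A₄).equivalence (assocCompanion A₁ A₂ A₃ A₄) (assocCompanion' A₁ A₂ A₃ A₄)
  lUnitor A B := (lunitTrans A B).equivalence (lunitCompanion A B) (lunitCompanion' A B)
  rUnitor A B := (runitTrans A B).equivalence (runitCompanion A B) (runitCompanion' A B)

variable (k) in
/-- The generators `u` of the associators and unitors. -/
noncomputable def equivsElements : TricategoryEquivsElements.{v} (equivs.{u, v} k) where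
  a₁ f g h := (1 : (f.tensor g).tensor h)
  l₁ f := (1 : f.carrier)
  r₁' f := (1 : f.carrier)
  ι₁ a := one (CentralAlg.unit a)
  isGen_a₁ f g h := (IsCompanion.assocBimod f g h).generates
  isGen_l₁ f := (IsCompanion.lunitBimod f).generates
  isGen_r₁' f := (IsCompanion.runitBimod' f).generates
  isGen_ι₁ := isGen_one _
  ev_asNat_hom {a b c d f f' g g' h h' u v w} x y z :=
    (assocTrans a b c d).ev_square_hom (assocCompanion a b c d) (x := ((f, g), h))
      (y := ((f', g'), h')) ((u ×ₘ v) ×ₘ w) (btmul (box u v) w (btmul u v x y) z)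
  ev_luNat_hom {a b f _ u} x :=
    ((lunitTrans a b).ev_square_hom (lunitCompanion a b) u
      (btmul (𝟙 (CentralAlg.unit a)) u (ComAlg.one _) x)).trans
      (congrArg (fun y => tmul (lunitBimod f) u (1 : f.carrier) y) (boxLeftUnitor_one_btmul u x))
  ev_ruNat'_hom {a b f _ u} x :=
    -- The adjoint inverse comes from the inverse semilinear transformation, which sends `x` to `x ⊗
    -- 1`.
    ((runitTrans a b).symm.ev_square_hom (runitCompanion' a b) u x).trans
      (congrArg (fun y => tmul (runitBimod' f) (box u (𝟙 (CentralAlg.unit b))) (1 : f.carrier) y)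
        ((boxRightUnitor u).toEquiv.symm_apply_eq.2 (boxRightUnitor_btmul_one u x).symm))

end ComAlgebra

end ComAlgebraCoherence

/-! ### Identities between the canonical algebra isomorphisms -/

section CanonicalIsomorphismCoherence

variable {k : Type u} [Field k]

namespace CentralAlg

lemma zero_pure {A B C : CommAlgCat.{v} k} {D : CentralAlg A B} {E : CentralAlg B C} (e : E) :
    pure (0 : D) e = 0 :=
  (tmul D E).map_zero₂ e

lemma add_pure {A B C : CommAlgCat.{v} k} {D : CentralAlg A B} {E : CentralAlg B C} (d d' : D)
    (e : E) : pure (d + d') e = pure d e + pure d' e :=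
  (tmul D E).map_add₂ d d' e

/-- Both ways of rebracketing send `((d ⊗ e) ⊗ f) ⊗ g` to `d ⊗ (e ⊗ (f ⊗ g))`, and such tensors
span. The compatibility proofs `h₁`, …, `h₄` are left arbitrary so that those supplied by companions
can be inserted. -/
lemma assocEquiv_pentagon {A₁ A₂ A₃ A₄ A₅ : CommAlgCat.{v} k} (D : CentralAlg A₁ A₂)
    (E : CentralAlg A₂ A₃) (F : CentralAlg A₃ A₄) (G : CentralAlg A₄ A₅) (h₁ h₂ h₃ h₄)
    (t : ((D.tensor E).tensor F).tensor G) :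
    tensorEquiv AlgEquiv.refl (assocEquiv E F G) h₃ h₄ (assocEquiv D (E.tensor F) G
      (tensorEquiv (assocEquiv D E F) AlgEquiv.refl h₁ h₂ t)) =
      assocEquiv D E (F.tensor G) (assocEquiv (D.tensor E) F G t) := by
  induction t using alg_induction with
  | h0 => simp only [map_zero]
  | h2 x y hx hy => simp only [map_add, hx, hy]
  | h1 s g =>
  induction s using tripleL_induction with
  | h0 => simp only [zero_pure, map_zero]
  | h2 x y hx hy => simp only [add_pure, map_add, hx, hy]
  | h1 d e f =>
    simp only [tensorEquiv_pure, assocEquiv_pure, AlgEquiv.coe_refl, id_eq]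

variable {A B C : CommAlgCat.{v} k} (D : CentralAlg A B) (E : CentralAlg B C)

lemma runitEquiv_symm (d : D) : (runitEquiv D).symm d = pure (E := unit B) d 1 := rfl

/-- A pure tensor travels as `d ⊗ e ↦ (d ⊗ 1) ⊗ e ↦ d ⊗ (1 ⊗ e) ↦ d ⊗ e`. This is the algebra
identity behind `μ`. -/
lemma runitEquiv_triangle (h₁ h₂ h₃ h₄) (t : D.tensor E) :
    tensorEquiv AlgEquiv.refl (lunitEquiv E) h₃ h₄ (assocEquiv D (unit B) E
      (tensorEquiv (runitEquiv D).symm AlgEquiv.refl h₁ h₂ t)) = t := by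
  induction t using alg_induction with
  | h0 => simp only [map_zero]
  | h2 x y hx hy => simp only [map_add, hx, hy]
  | h1 d e =>
    simp only [tensorEquiv_pure, runitEquiv_symm, assocEquiv_pure, AlgEquiv.coe_refl, id_eq,
      lunitEquiv_pure]
    exact congrArg (pure d) ((congrArg (· * e) (map_one E.leftU)).trans (one_mul e))

/-- The structure map of `D ⊗ E` over `A` goes through `D`, so acting by `a` on `d` alone is
multiplying `d ⊗ e` by the image of `a`. This is the algebra identity behind `λ`. -/
lemma lunitEquiv_tensor (h₁ h₂) (t : ((unit A).tensor D).tensor E) :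
    tensorEquiv (lunitEquiv D) AlgEquiv.refl h₁ h₂ t =
      lunitEquiv (D.tensor E) (assocEquiv (unit A) D E t) := by
  induction t using tripleL_induction with
  | h0 => simp only [map_zero]
  | h2 x y hx hy => simp only [map_add, hx, hy]
  | h1 a d e =>
    rw [tensorEquiv_pure, assocEquiv_pure, lunitEquiv_pure, lunitEquiv_pure]
    exact (congrArg (pure (D.left a * d)) (one_mul e).symm).trans
      ((pure_mul_pure D E (D.left a) d 1 e).symm.trans
        (congrArg (· * pure d e) (tensor_left' D E a).symm))

/-- Both composites are `d ⊗ e ↦ d ⊗ (e ⊗ 1)`, which gives `ρ`. -/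
lemma runitEquiv_symm_tensor (h₁ h₂) (t : D.tensor E) :
    tensorEquiv AlgEquiv.refl (runitEquiv E).symm h₁ h₂ t =
      assocEquiv D E (unit C) ((runitEquiv (D.tensor E)).symm t) := by
  induction t using alg_induction with
  | h0 => simp only [map_zero]
  | h2 x y hx hy => simp only [map_add, hx, hy]
  | h1 d e =>
    rw [tensorEquiv_pure, runitEquiv_symm, runitEquiv_symm, assocEquiv_pure]
    rfl

end CentralAlg

end CanonicalIsomorphismCoherence

/-! ### Assembly of the tricategory and its canonical data -/

section ComAlgebraTricategory

open CompatBimod BicategoryElements TricategoryBaseElements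
open scoped Pseudofunctor.StrongTrans CategoryTheory.Prod

attribute [local irreducible] CentralAlg.tensor CompatBimod.box CompatBimod.tensor

namespace CompatBimod.IsCompanion

variable {k : Type u} [Field k] {A B C A₁ A₂ A₃ A₄ A₅ : CommAlgCat.{v} k}

/-- The isomorphism `(u ⊗ 1) ⊗ (u ⊗ (1 ⊗ u)) ↦ u ⊗ u` of the pentagon. -/
noncomputable def piIso (D : CentralAlg A₁ A₂) (E : CentralAlg A₂ A₃) (F : CentralAlg A₃ A₄)
    (G : CentralAlg A₄ A₅) :=
  (((assocBimod D E F).box (regular G)).tensor ((assocBimod D (E.tensor F) G).tensor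
    ((regular D).box (assocBimod E F G)))).iso
    ((assocBimod (D.tensor E) F G).tensor (assocBimod D E (F.tensor G)))
    (CentralAlg.assocEquiv_pentagon D E F G (assocBimod D E F).map_right (regular G).map_left
      (regular D).map_right (assocBimod E F G).map_left)

variable (D : CentralAlg A B) (E : CentralAlg B C)

/-- The isomorphism `(u ⊗ 1) ⊗ (u ⊗ (1 ⊗ u)) ↦ 1`. -/
noncomputable def muIso :=
  (((runitBimod' D).box (regular E)).tensor ((assocBimod D (CentralAlg.unit B) E).tensor
    ((regular D).box (lunitBimod E)))).iso (regular (D.tensor E))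
    (CentralAlg.runitEquiv_triangle D E (runitBimod' D).map_right (regular E).map_left
      (regular D).map_right (lunitBimod E).map_left)

/-- The isomorphism `u ⊗ 1 ↦ u ⊗ u`. -/
noncomputable def lamIso :=
  ((lunitBimod D).box (regular E)).iso
    ((assocBimod (CentralAlg.unit A) D E).tensor (lunitBimod (D.tensor E)))
    (CentralAlg.lunitEquiv_tensor D E _ _)

/-- The isomorphism `1 ⊗ u ↦ u ⊗ u`. -/
noncomputable def rhoIso :=
  ((regular D).box (runitBimod' E)).iso
    ((runitBimod' (D.tensor E)).tensor (assocBimod D E (CentralAlg.unit C)))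
    (CentralAlg.runitEquiv_symm_tensor D E _ _)

end CompatBimod.IsCompanion

namespace ComAlgebra

variable (k : Type u) [Field k]

/-- The modifications of `ComAlgebra`. -/
noncomputable def modificationsElements :
    TricategoryModificationsElements (equivsElements.{u, v} k) where
  π D E F G := IsCompanion.piIso D E F G
  μ D E := IsCompanion.muIso D E
  lam D E := IsCompanion.lamIso D E
  rho D E := IsCompanion.rhoIso D E
  ev_π _ _ _ _ := IsCompanion.iso_hom_apply _ _ _
  ev_μ _ _ := IsCompanion.iso_hom_apply _ _ _
  ev_lam _ _ := IsCompanion.iso_hom_apply _ _ _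
  ev_rho _ _ := IsCompanion.iso_hom_apply _ _ _

/-- The tricategory `ComAlgebra`. -/
noncomputable def tricategory : Tricategory (comAlgBase.{u, v} k) :=
  (modificationsElements k).tricategory

/-- The 1-cells are the canonical bimodules by construction. The values needed for the axioms were
recorded along with the generators; those of `a*`, `l*`, `r` and of the units and counits are read
off from the general formulas for companions. -/
theorem isCanonical : ComAlg.IsCanonical (tricategory.{u, v} k) where
  as_eq _ _ _ := rfl
  as_eq' _ _ _ := rfl
  lu_eq _ := rfl
  lu_eq' _ := rfl
  ru_eq _ := rfl
  ru_eq' _ := rfl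
  asNat M N P m n p := (equivsElements k).ev_asNat_hom (u := M) (v := N) (w := P) m n p
  asNat' {A₁ A₂ A₃ A₄ D D' E E' F F'} M N P m n p :=
    (assocTrans A₁ A₂ A₃ A₄).symm.ev_square_hom (assocCompanion' A₁ A₂ A₃ A₄)
      (x := ((D, E), F)) (y := ((D', E'), F'))
      ((M ×ₘ N) ×ₘ P) (btmul M (box N P) m (btmul N P n p))
  luNat M m := (equivsElements k).ev_luNat_hom (u := M) m
  luNat' {A B D _} M m := ((lunitTrans A B).symm.ev_square_hom (lunitCompanion' A B) M m).trans
    (congrArg (fun y => tmul (lunitBimod' D) (box (𝟙 (CentralAlg.unit A)) M) (1 : D) y)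
      ((boxLeftUnitor M).toEquiv.symm_apply_eq.2 (boxLeftUnitor_one_btmul M m).symm))
  ruNat {A B D _} M m :=
    ((runitTrans A B).ev_square_hom (runitCompanion A B) M
      (btmul M (𝟙 (CentralAlg.unit B)) m (ComAlg.one _))).trans
      (congrArg (fun y => tmul (runitBimod D) M (1 : D) y) (boxRightUnitor_btmul_one M m))
  ruNat' M m := (equivsElements k).ev_ruNat'_hom (u := M) m
  asUnit {A₁ A₂ A₃ A₄} D E F := (assocTrans A₁ A₂ A₃ A₄).ev_unitIso_hom
    (assocCompanion A₁ A₂ A₃ A₄) (assocCompanion' A₁ A₂ A₃ A₄) ((D, E), F)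
  asCounit {A₁ A₂ A₃ A₄} D E F := (assocTrans A₁ A₂ A₃ A₄).ev_counitIso_hom
    (assocCompanion A₁ A₂ A₃ A₄) (assocCompanion' A₁ A₂ A₃ A₄) ((D, E), F)
  luUnit {A B} D := (lunitTrans A B).ev_unitIso_hom (lunitCompanion A B) (lunitCompanion' A B) D
  luCounit {A B} D := (lunitTrans A B).ev_counitIso_hom (lunitCompanion A B)
    (lunitCompanion' A B) D
  ruUnit {A B} D := (runitTrans A B).ev_unitIso_hom (runitCompanion A B) (runitCompanion' A B) D
  ruCounit {A B} D := (runitTrans A B).ev_counitIso_hom (runitCompanion A B)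
    (runitCompanion' A B) D
  π D E F G := (modificationsElements k).ev_π D E F G
  μ D E := (modificationsElements k).ev_μ D E
  lam D E := (modificationsElements k).ev_lam D E
  rho D E := (modificationsElements k).ev_rho D E

end ComAlgebra

end ComAlgebraTricategory

theorem mainTheorem7 (k : Type u) [Field k] :
    -- the structure of the bicategories `T(A, B)`
    (∀ (A B : CommAlgCat.{v} k) (D E F G : CentralAlg A B) (M M' : D ⟶ E) (N N' : E ⟶ F)
      (P : F ⟶ G),
      M ≫ N = CompatBimod.tensor M N ∧
      𝟙 D = CompatBimod.regular D ∧
      (∀ (φ : M ⟶ M') (m : CompatBimod.carrier M) (n : CompatBimod.carrier N),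
        ComAlg.app (φ ▷ N) (CompatBimod.tmul M N m n) =
          CompatBimod.tmul M' N (ComAlg.app φ m) n) ∧
      (∀ (ψ : N ⟶ N') (m : CompatBimod.carrier M) (n : CompatBimod.carrier N),
        ComAlg.app (M ◁ ψ) (CompatBimod.tmul M N m n) =
          CompatBimod.tmul M N' m (ComAlg.app ψ n)) ∧
      (∀ (m : CompatBimod.carrier M) (n : CompatBimod.carrier N) (p : CompatBimod.carrier P),
        ComAlg.app (α_ M N P).hom
            (CompatBimod.tmul (M ≫ N) P (CompatBimod.tmul M N m n) p) =
          CompatBimod.tmul M (N ≫ P) m (CompatBimod.tmul N P n p)) ∧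
      (∀ m : CompatBimod.carrier M,
        ComAlg.app (λ_ M).inv m = CompatBimod.tmul (𝟙 D) M (ComAlg.one D) m ∧
        ComAlg.app (ρ_ M).inv m = CompatBimod.tmul M (𝟙 E) m (ComAlg.one E))) ∧
    -- the structure of the composition functors `T(A, B) × T(B, C) → T(A, C)`
    (∀ (A B C : CommAlgCat.{v} k) (D D' D'' : CentralAlg A B) (E E' E'' : CentralAlg B C)
      (M M₁ : D ⟶ D') (M' : D' ⟶ D'') (N N₁ : E ⟶ E') (N' : E' ⟶ E''),
      (comAlgBase k).ten₀ (a := A) (b := B) (c := C) D E = D.tensor E ∧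
      (comAlgBase k).ten₁ (a := A) (b := B) (c := C) M N = CompatBimod.box M N ∧
      (∀ (φ : M ⟶ M₁) (ψ : N ⟶ N₁) (m : CompatBimod.carrier M) (n : CompatBimod.carrier N),
        ComAlg.app ((comAlgBase k).ten₂ (a := A) (b := B) (c := C) φ ψ)
            (CompatBimod.btmul M N m n) =
          CompatBimod.btmul M₁ N₁ (ComAlg.app φ m) (ComAlg.app ψ n)) ∧
      (∀ (d : D) (e : E),
        ComAlg.app ((comAlgBase k).tenId (a := A) (b := B) (c := C) D E).hom
            (CompatBimod.btmul (𝟙 D) (𝟙 E) (CompatBimod.reg d) (CompatBimod.reg e)) =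
          CompatBimod.reg (CentralAlg.pure d e)) ∧
      (∀ (m : CompatBimod.carrier M) (n : CompatBimod.carrier N) (m' : CompatBimod.carrier M')
        (n' : CompatBimod.carrier N'),
        ComAlg.app (((tensorFunctor A B C).mapComp (Prod.mkHom M N) (Prod.mkHom M' N')).inv)
            (CompatBimod.tmul (CompatBimod.box M N) (CompatBimod.box M' N')
              (CompatBimod.btmul M N m n) (CompatBimod.btmul M' N' m' n')) =
          CompatBimod.btmul (M ≫ M') (N ≫ N') (CompatBimod.tmul M M' m m')
            (CompatBimod.tmul N N' n n'))) ∧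
    -- they underlie a tricategory whose coherence data are the canonical isomorphisms
    ∃ T : Tricategory (comAlgBase.{u, v} k), ComAlg.IsCanonical T := by
  -- The formulas for the hom bicategories and the composition functors hold by evaluation on pure
  -- tensors; only the tricategory structure carries content here.
  refine ⟨fun A B D E F G M M' N N' P => ⟨rfl, rfl, fun _ _ _ => rfl, fun _ _ _ => rfl,
    fun _ _ _ => rfl, fun _ => ⟨rfl, rfl⟩⟩, fun A B C D D' D'' E E' E'' M M₁ M' N N₁ N' =>
    ⟨rfl, rfl, fun _ _ _ _ => rfl, fun _ _ => rfl, fun _ _ _ _ => rfl⟩,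
    ComAlgebra.tricategory k, ComAlgebra.isCanonical k⟩
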